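/- **Theorem 1.2.** Let $B=B(0,1)$ be the open unit ball of $\mathbb{R}^3$, and let $C^n_c(B)$ be the space of $n$ times continuously differentiable functions $q\colon B\to\mathbb{C}$ with compact support in $B$, extended by zero to $\mathbb{R}^3$. Write $\|f\|_{C^s(X)}=\sum_{|\alpha|\le s}\sup_{X}|\partial^\alpha f|$. A distribution of order $n$ on $\mathbb{R}^3\times\mathbb{R}$ is a distribution of order at most $n$, that is, a continuous linear functional on the compactly supported $C^n$ functions. Let $n\ge 7$, $q\in C^n_c(B)$ and $a\in\partial B$. Then the point source problem $$(\partial_t^2-\Delta-q)U^a(x,t)=\delta(x-a,t)\ \text{ in }\mathbb{R}^3\times\mathbb{R},\qquad U^a=0\ \text{ for } t<0,$$ understood in the sense of distributions, has a unique solution $U^a$ in the set of distributions of order $n$ on $\mathbb{R}^3\times\mathbb{R}$. It is given by $$U^a(x,t)=\frac{\delta(t-|x-a|)}{4\pi|x-a|}+H(t-|x-a|)\,r^a(x,t)$$ for some $r^a\in C^1(\mathbb{R}^3\times\mathbb{R})$, where $\delta$ and $H$ are the Dirac delta and the Heaviside function on $\mathbb{R}$. The function $r^a$ can be chosen such that for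 every $T>0$ and every $\mathcal M\ge\|q\|_{C^7}$ $$\|r^a\|_{C^1(\mathbb{R}^3\times[0,T])}\le C_{T,\mathcal M},$$ where $C_{T,\mathcal M}<\infty$ depends only on $T$ and $\mathcal M$. Moreover $U^a$ is a $C^1$ function outside the light cone $t=|x-a|$. In particular the map $(a,\tau)\mapsto U^a(a,2\tau)$ is well defined $\partial B\times(0,1)\to\mathbb{C}$ and, for each $a$, continuously differentiable in $\tau$. Furthermore, for every $\mathcal M\ge 0$ there is a constant $C_{\mathcal M}<\infty$, depending only on $\mathcal M$, such that for all $n\ge7$, all $q_1,q_2\in C^n_c(B)$ with $\|q_j\|_{C^7}\le\mathcal M$, and each $\beta\in\{0,1\}$, the corresponding solutions $U^a_1,U^a_2$ satisfy $$\sup_{a\in\partial B}\ \sup_{0<\tau<1}\bigl|\partial_\tau^\beta (U_1^a-U_2^a)(a,2\tau)\bigr|\le C_{\mathcal M}\,\|q_1-q_2\|_{C^7}.$$ -/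

import Mathlib

open Set MeasureTheory TopologicalSpace Metric
open scoped Distributions ENNReal NNReal LineDeriv

noncomputable section

namespace PointSource

/-- Space `ℝ³` with its Euclidean norm. -/
abbrev Space : Type := EuclideanSpace ℝ (Fin 3)

/-- Space-time `ℝ³ × ℝ`; points are written `(x, t)`. -/
abbrev Spacetime : Type := Space × ℝ

/-- The open unit ball `B` of `ℝ³`. The space `C^n_c(B)` of complex valued potentials is
`𝓓^{n}(unitBall, ℂ)`; its elements are regarded as functions on `ℝ³` vanishing outside `B`. -/
def unitBall : Opens Space := ⟨ball (0 : Space) 1, isOpen_ball⟩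

/-- The coordinate directions of `ℝ³`. -/
def spaceDir (i : Fin 3) : Space := EuclideanSpace.single i (1 : ℝ)

/-- The time direction of space-time. -/
def timeDir : Spacetime := (0, 1)

/-- The four coordinate directions of space-time: first the three spatial ones, then time. -/
def spacetimeDir : Fin 4 → Spacetime :=
  ![(spaceDir 0, 0), (spaceDir 1, 0), (spaceDir 2, 0), timeDir]

section Norms

variable {V : Type*} [NormedAddCommGroup V] [NormedSpace ℝ V] {d : ℕ}

/-- The partial derivative `∂^α f = ∂_{e 0}^{α 0} ⋯ ∂_{e (d-1)}^{α (d-1)} f`, for the coordinate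
directions `e` and a multi-index `α`. -/
def partialDeriv (e : Fin d → V) (α : Fin d → ℕ) (f : V → ℂ) : V → ℂ :=
  (List.finRange d).foldr (fun i g => (fun h p => lineDeriv ℝ h p (e i))^[α i] g) f

/-- The multi-indices `α ∈ ℕ^d` with `|α| ≤ s`. -/
def multiIndices (d s : ℕ) : Finset (Fin d → ℕ) :=
  (Fintype.piFinset fun _ => Finset.range (s + 1)).filter fun α => ∑ i, α i ≤ s

/-- The norm `‖f‖_{C^s(X)} = ∑_{|α| ≤ s} sup_{p ∈ X} |∂^α f(p)|`, as an element of `[0, ∞]`. -/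
def cNorm (e : Fin d → V) (s : ℕ) (X : Set V) (f : V → ℂ) : ℝ≥0∞ :=
  ∑ α ∈ multiIndices d s, ⨆ p ∈ X, ‖partialDeriv e α f p‖ₑ

end Norms

/-- The norm `‖q‖_{C^7(ℝ³)}`; for functions vanishing outside the unit ball
it is the same as the norm of `C^7(B)`. -/
def potentialNorm (q : Space → ℂ) : ℝ≥0∞ := cNorm spaceDir 7 univ q

/-- The norm `‖r‖_{C^1(ℝ³ × [0,T])}`. -/
def c1Norm (T : ℝ) (r : Spacetime → ℂ) : ℝ≥0∞ :=
  cNorm spacetimeDir 1 (univ ×ˢ Icc 0 T) r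

/-- `(∂_t² - Δ) φ` for a smooth compactly supported `φ` on space-time. -/
def dAlembert (φ : 𝓓((⊤ : Opens Spacetime), ℝ)) : 𝓓((⊤ : Opens Spacetime), ℝ) :=
  ∂_{timeDir} (∂_{timeDir} φ)
    - ∑ i : Fin 3, ∂_{((spaceDir i, 0) : Spacetime)} (∂_{((spaceDir i, 0) : Spacetime)} φ)

/-- A smooth test function, regarded as a test function of class `C^n`. -/
def ofSmooth (n : ℕ) (φ : 𝓓((⊤ : Opens Spacetime), ℝ)) :
    𝓓^{(n : ℕ∞)}((⊤ : Opens Spacetime), ℝ) :=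
  TestFunction.monoCLM ℝ φ

/-- The `C^n` test function `(x, t) ↦ f(x) φ(x, t)`, for `f` a function of class `C^n` of `x`. -/
def mulTest (n : ℕ) (f : Space → ℝ) (hf : ContDiff ℝ n f) (φ : 𝓓((⊤ : Opens Spacetime), ℝ)) :
    𝓓^{(n : ℕ∞)}((⊤ : Opens Spacetime), ℝ) where
  toFun p := f p.1 * φ p
  contDiff' := (hf.comp contDiff_fst).mul (φ.contDiff.of_le (by exact_mod_cast le_top))
  hasCompactSupport' := φ.hasCompactSupport.mul_left
  tsupport_subset' := fun _ _ => mem_univ _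

/-- The pairing `⟨q U, φ⟩` of the product of a complex potential `q ∈ C^n_c(B)` (a function of `x`)
and a distribution `U` of order at most `n` with a real test function `φ`:
this is `⟨U, q φ⟩ = ⟨U, (Re q) φ⟩ + i ⟨U, (Im q) φ⟩`. -/
def mulPairing {n : ℕ} (q : 𝓓^{(n : ℕ∞)}(unitBall, ℂ))
    (U : 𝓓'^{(n : ℕ∞)}((⊤ : Opens Spacetime), ℂ)) (φ : 𝓓((⊤ : Opens Spacetime), ℝ)) : ℂ :=
  U (mulTest n (fun x => (q x).re) (Complex.reCLM.contDiff.comp q.contDiff) φ)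
    + Complex.I * U (mulTest n (fun x => (q x).im) (Complex.imCLM.contDiff.comp q.contDiff) φ)

/-- `U`, a distribution of order at most `n` on `ℝ³ × ℝ`, solves the point source problem
`(∂_t² - Δ - q) U = δ(x - a, t)` with `U = 0` for `t < 0`, in the sense of distributions. -/
structure IsPointSourceSolution {n : ℕ} (q : 𝓓^{(n : ℕ∞)}(unitBall, ℂ)) (a : Space)
    (U : 𝓓'^{(n : ℕ∞)}((⊤ : Opens Spacetime), ℂ)) : Prop where
  equation : ∀ φ : 𝓓((⊤ : Opens Spacetime), ℝ),
    U (ofSmooth n (dAlembert φ)) - mulPairing q U φ = ((φ ((a, 0) : Spacetime) : ℝ) : ℂ)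
  vanishing : Distribution.IsVanishingOn U {p : Spacetime | p.2 < 0}

/-- The Heaviside function. -/
def heaviside (s : ℝ) : ℝ := if 0 < s then 1 else 0

/-- `U` is the distribution `δ(t - |x-a|) / (4π|x-a|) + H(t - |x-a|) r(x,t)`. -/
def HasExpansion {n : ℕ} (U : 𝓓'^{(n : ℕ∞)}((⊤ : Opens Spacetime), ℂ)) (a : Space)
    (r : Spacetime → ℂ) : Prop :=
  ∀ φ : 𝓓^{(n : ℕ∞)}((⊤ : Opens Spacetime), ℝ),
    U φ = ((∫ x : Space, φ ((x, ‖x - a‖) : Spacetime) / (4 * Real.pi * ‖x - a‖) : ℝ) : ℂ)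
      + ∫ p : Spacetime, ((heaviside (p.2 - ‖p.1 - a‖) * φ p : ℝ) : ℂ) * r p

/-- The complement of the light cone `t = |x - a|`. -/
def offCone (a : Space) : Set Spacetime := {p | p.2 ≠ ‖p.1 - a‖}

/-- On the open set `W` the distribution `U` is the continuous function `u`. -/
def EqFunctionOn {n : ℕ} (U : 𝓓'^{(n : ℕ∞)}((⊤ : Opens Spacetime), ℂ)) (u : Spacetime → ℂ)
    (W : Set Spacetime) : Prop :=
  ContinuousOn u W ∧
    ∀ φ : 𝓓^{(n : ℕ∞)}((⊤ : Opens Spacetime), ℝ), tsupport φ ⊆ W →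
      U φ = ∫ p : Spacetime, ((φ p : ℝ) : ℂ) * u p

end PointSource

end

/-! Existence is a progressing wave expansion and uniqueness is duality. Move the pole to the origin
and put σ = t² - |x|². The distribution δ(t-|x|)/(4π|x|) is a fundamental solution of the wave
operator (`integral_box_cone`), so only the potential term q/(4π|x|) on the cone remains to be
cancelled. Seek the regular part inside the cone as b₀ + b₁σ + b₂σ²/2 + w. Green's identity in the
cone (`integral_green_cone`) shows that the jump of H(t-|x|)v cancels that term exactly when b₀ +
x·∇b₀ = q/(8π). Since box σ = 8, box σ² = 24σ and ∇σ = -2x, the powers σ⁰ and σ¹ in (box - q)v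
vanish when 8b₁ + 4x·∇b₁ = Δb₀ + qb₀ and 12b₂ + 4x·∇b₂ = Δb₁ + qb₁ (`box_ansatz`). Radial means ∫₀¹
sᵐ f(sx) ds solve all three transport equations (`radial_transport`).

What is left is the source H(t-|x|) σ²/2 · (Δb₂ + qb₂). The factor σ₊² is C¹, and each Laplacian
costs two derivatives, so q in C⁷ leaves a C¹ coefficient. The remainder w with this source solves w
= (retarded potential of source + qw). After multiplication by e^{-ℓt} the retarded kernel becomes
e^{-ℓ|z|}/(4π|z|), of mass 1/ℓ². For large ℓ the equation is a contraction in C¹ and is summed by a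
Neumann series (`bddC_resolvent`). Every operation used is bounded and Lipschitz in q, which is
recorded by `IsLip` and yields the quantitative claims. All bounds are translation invariant, hence
uniform in a.

For uniqueness, let W solve the homogeneous equation and vanish for t < 0. Given a C^n function ψ of
compact support, the same contraction with advanced potentials gives φ of class C^n with box φ = ψ +
qφ (`exists_backward_solution`). Testing W with φ, cut off in the past, gives ⟨W,ψ⟩ = 0. As φ is
only C^n while the equation is tested with smooth functions, φ is mollified first, and the
continuity of W on C^n functions permits the limit (`complexify_initialCutoff_eq_zero`). -/

noncomputable section

namespace PointSource

open Filter Topology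

/-! ### Functions with bounded derivatives and averages of them -/

section Bounded

variable {V W : Type} [NormedAddCommGroup V] [NormedSpace ℝ V]
  [NormedAddCommGroup W] [NormedSpace ℝ W]

/-- `f` is of class `C^k` and its derivatives of order at most `k` are bounded by `A`. -/
def BddC {E : Type} [NormedAddCommGroup E] [NormedSpace ℝ E] (k : ℕ) (A : ℝ) (f : V → E) : Prop :=
  ContDiff ℝ k f ∧ ∀ j ≤ k, ∀ p, ‖iteratedFDeriv ℝ j f p‖ ≤ A

variable {E : Type} [NormedAddCommGroup E] [NormedSpace ℝ E] {k : ℕ} {A B : ℝ} {f g : V → E}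

theorem BddC.norm_le (h : BddC k A f) (p : V) : ‖f p‖ ≤ A := by
  simpa using h.2 0 (Nat.zero_le _) p

theorem BddC.nonneg (h : BddC k A f) : 0 ≤ A := (norm_nonneg _).trans (h.norm_le 0)

theorem BddC.mono {l : ℕ} (h : BddC k A f) (hl : l ≤ k) (hA : A ≤ B) : BddC l B f :=
  ⟨h.1.of_le (by exact_mod_cast hl), fun j hj p => (h.2 j (hj.trans hl) p).trans hA⟩

theorem bddC_zero_iff : BddC 0 A f ↔ Continuous f ∧ ∀ p, ‖f p‖ ≤ A := by
  simp [BddC, contDiff_zero]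

/-- One constant bounds the function and all its derivatives, so peeling off one derivative leaves
the constant unchanged. The later inductions on the order of differentiation rest on this. -/
theorem bddC_succ_iff :
    BddC (k + 1) A f ↔ (∀ p, ‖f p‖ ≤ A) ∧ Differentiable ℝ f ∧ BddC k A (fderiv ℝ f) := by
  constructor
  · intro h
    have h1 : ContDiff ℝ ((k : WithTop ℕ∞) + 1) f := by exact_mod_cast h.1
    refine ⟨h.norm_le, h1.differentiable (by simp), (contDiff_succ_iff_fderiv.1 h1).2.2, ?_⟩
    intro j hj p
    rw [norm_iteratedFDeriv_fderiv]
    exact h.2 _ (by omega) p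
  · rintro ⟨h0, hd, h1⟩
    refine ⟨?_, ?_⟩
    · have : ContDiff ℝ ((k : WithTop ℕ∞) + 1) f :=
        contDiff_succ_iff_fderiv.2 ⟨hd, by simp, h1.1⟩
      exact_mod_cast this
    · intro j hj p
      cases j with
      | zero => simpa using h0 p
      | succ j =>
        rw [← norm_iteratedFDeriv_fderiv]
        exact h1.2 j (by omega) p

theorem BddC.fderiv (h : BddC (k + 1) A f) : BddC k A (fderiv ℝ f) := (bddC_succ_iff.1 h).2.2

theorem BddC.add (hf : BddC k A f) (hg : BddC k B g) : BddC k (A + B) (fun p => f p + g p) := by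
  refine ⟨hf.1.add hg.1, fun j hj p => ?_⟩
  have hj' : (j : WithTop ℕ∞) ≤ k := by exact_mod_cast hj
  rw [show (fun p => f p + g p) = f + g from rfl, iteratedFDeriv_add_apply
    (hf.1.of_le hj').contDiffAt (hg.1.of_le hj').contDiffAt]
  exact (norm_add_le _ _).trans (add_le_add (hf.2 j hj p) (hg.2 j hj p))

theorem BddC.neg (hf : BddC k A f) : BddC k A (fun p => -f p) := by
  refine ⟨hf.1.neg, fun j hj p => ?_⟩
  rw [show (fun p => -f p) = -f from rfl, iteratedFDeriv_neg_apply, norm_neg]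
  exact hf.2 j hj p

theorem BddC.sub (hf : BddC k A f) (hg : BddC k B g) : BddC k (A + B) (fun p => f p - g p) := by
  simpa only [sub_eq_add_neg] using hf.add hg.neg

theorem BddC.clm (L : E →L[ℝ] W) (hf : BddC k A f) : BddC k (‖L‖ * A) (fun p => L (f p)) := by
  refine ⟨L.contDiff.comp hf.1, fun j hj p => ?_⟩
  have hj' : (j : WithTop ℕ∞) ≤ k := by exact_mod_cast hj
  exact (L.norm_iteratedFDeriv_comp_left (hf.1.of_le hj').contDiffAt le_rfl).trans
    (mul_le_mul_of_nonneg_left (hf.2 j hj p) (norm_nonneg _))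

/-- The factor 2^k is the sum of the binomial coefficients in the Leibniz rule. It reappears in the
smallness condition `2 ^ k * Q * 2 ≤ ℓ ^ 2` of the Neumann series. -/
theorem BddC.mul {f g : V → ℂ} (hf : BddC k A f) (hg : BddC k B g) :
    BddC k (2 ^ k * A * B) (fun p => f p * g p) := by
  refine ⟨hf.1.mul hg.1, fun j hj p => ?_⟩
  have hj' : (j : WithTop ℕ∞) ≤ k := by exact_mod_cast hj
  have hA := hf.nonneg
  have hB := hg.nonneg
  refine (norm_iteratedFDeriv_mul_le hf.1 hg.1 p hj').trans ?_
  calc ∑ i ∈ Finset.range (j + 1), (j.choose i : ℝ) * ‖iteratedFDeriv ℝ i f p‖ *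
          ‖iteratedFDeriv ℝ (j - i) g p‖
      ≤ ∑ i ∈ Finset.range (j + 1), (j.choose i : ℝ) * (A * B) := by
        refine Finset.sum_le_sum fun i hi => ?_
        have hi' : i ≤ j := by simpa [Nat.lt_succ_iff] using hi
        rw [mul_assoc]
        exact mul_le_mul_of_nonneg_left (mul_le_mul (hf.2 _ (by omega) p) (hg.2 _ (by omega) p)
          (norm_nonneg _) hA) (by positivity)
    _ = 2 ^ j * (A * B) := by
        rw [← Finset.sum_mul]
        congr 1
        exact_mod_cast Nat.sum_range_choose j
    _ ≤ 2 ^ k * A * B := by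
        rw [mul_assoc]
        exact mul_le_mul_of_nonneg_right (pow_le_pow_right₀ (by norm_num) hj) (by positivity)

theorem BddC.const_mul {f : V → ℂ} (c : ℂ) (hf : BddC k A f) :
    BddC k (‖c‖ * A) (fun p => c * f p) := by
  refine ⟨contDiff_const.mul hf.1, fun j hj p => ?_⟩
  have hj' : (j : WithTop ℕ∞) ≤ k := by exact_mod_cast hj
  rw [show (fun p => c * f p) = c • f from rfl,
    iteratedFDeriv_const_smul_apply (hf.1.of_le hj').contDiffAt, norm_smul]
  exact mul_le_mul_of_nonneg_left (hf.2 j hj p) (norm_nonneg _)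

theorem BddC.comp_linear (L : V →L[ℝ] W) (hL : ‖L‖ ≤ 1) {f : W → E} (hf : BddC k A f) :
    BddC k A (fun p => f (L p)) := by
  refine ⟨hf.1.comp L.contDiff, fun j hj p => ?_⟩
  have hj' : (j : WithTop ℕ∞) ≤ k := by exact_mod_cast hj
  rw [show (fun p => f (L p)) = f ∘ L from rfl, L.iteratedFDeriv_comp_right hf.1 p hj']
  refine (ContinuousMultilinearMap.norm_compContinuousLinearMap_le _ _).trans ?_
  calc ‖iteratedFDeriv ℝ j f (L p)‖ * ∏ _i : Fin j, ‖L‖ ≤ ‖iteratedFDeriv ℝ j f (L p)‖ * 1 := by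
        refine mul_le_mul_of_nonneg_left ?_ (norm_nonneg _)
        exact Finset.prod_le_one (fun _ _ => norm_nonneg _) fun _ _ => hL
    _ ≤ A := by simpa using hf.2 j hj (L p)

theorem BddC.comp_fst {f : V → E} (hf : BddC k A f) : BddC k A (fun p : V × W => f p.1) :=
  hf.comp_linear (ContinuousLinearMap.fst ℝ V W) (ContinuousLinearMap.norm_fst_le ..)

theorem BddC.comp_snd {f : W → E} (hf : BddC k A f) : BddC k A (fun p : V × W => f p.2) :=
  hf.comp_linear (ContinuousLinearMap.snd ℝ V W) (ContinuousLinearMap.norm_snd_le ..)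

theorem BddC.comp_add_left (hf : BddC k A f) (a : V) : BddC k A (fun p => f (a + p)) := by
  refine ⟨hf.1.comp (contDiff_const.add contDiff_id), fun j hj p => ?_⟩
  rw [iteratedFDeriv_comp_add_left]
  exact hf.2 j hj _

theorem BddC.congr (hf : BddC k A f) (h : ∀ p, g p = f p) : BddC k A g := by
  rwa [show g = f from funext h]

theorem bddC_zero_fun (hA : 0 ≤ A) : BddC k A (fun _ : V => (0 : E)) := by
  refine ⟨contDiff_const, fun j _ p => ?_⟩
  rw [iteratedFDeriv_fun_zero]
  simpa using hA

theorem exists_bddC_of_hasCompactSupport {f : V → E} (hf : ContDiff ℝ k f)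
    (hc : HasCompactSupport f) : ∃ A, BddC k A f := by
  have : ∀ j : ℕ, ∃ A, j ≤ k → ∀ p, ‖iteratedFDeriv ℝ j f p‖ ≤ A := by
    intro j
    by_cases hj : j ≤ k
    · obtain ⟨A, hA⟩ := (hf.continuous_iteratedFDeriv (by exact_mod_cast hj)
        ).bounded_above_of_compact_support (hc.iteratedFDeriv j)
      exact ⟨A, fun _ => hA⟩
    · exact ⟨0, fun h => absurd h hj⟩
  choose A hA using this
  refine ⟨∑ j ∈ Finset.range (k + 1), |A j|, hf, fun j hj p => (hA j hj p).trans ?_⟩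
  exact (le_abs_self _).trans (Finset.single_le_sum (f := fun j => |A j|)
    (fun _ _ => abs_nonneg _) (Finset.mem_range.2 (by omega)))

/-- The superposition of the dilated and translated functions `f (α ω • p + τ ω)`. -/
def avg {Ω : Type} [MeasurableSpace Ω] (μ : Measure Ω) (κ α : Ω → ℝ) (τ : Ω → V) (f : V → E)
    (p : V) : E :=
  ∫ ω, κ ω • f (α ω • p + τ ω) ∂μ

variable {Ω : Type} [MeasurableSpace Ω] {μ : Measure Ω} {κ α : Ω → ℝ} {τ : Ω → V}

theorem norm_avg_le (hκ : Integrable κ μ) (hf : ∀ p, ‖f p‖ ≤ A) (p : V) :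
    ‖avg μ κ α τ f p‖ ≤ A * ∫ ω, ‖κ ω‖ ∂μ := by
  rw [← integral_const_mul]
  refine norm_integral_le_of_norm_le (hκ.norm.const_mul A) (Filter.Eventually.of_forall fun ω => ?_)
  rw [norm_smul, mul_comm]
  exact mul_le_mul_of_nonneg_right (hf _) (norm_nonneg _)

theorem aestronglyMeasurable_avg (hκ : AEStronglyMeasurable κ μ) (hα : AEStronglyMeasurable α μ)
    (hτ : AEStronglyMeasurable τ μ) (hf : Continuous f) (p : V) :
    AEStronglyMeasurable (fun ω => κ ω • f (α ω • p + τ ω)) μ :=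
  hκ.smul (hf.comp_aestronglyMeasurable ((hα.smul_const p).add hτ))

theorem integrable_avg (hκ : Integrable κ μ) (hα : AEStronglyMeasurable α μ)
    (hτ : AEStronglyMeasurable τ μ) (hf : BddC k A f) (p : V) :
    Integrable (fun ω => κ ω • f (α ω • p + τ ω)) μ := by
  refine (hκ.norm.const_mul A).mono'
    (aestronglyMeasurable_avg hκ.1 hα hτ hf.1.continuous p) (Filter.Eventually.of_forall fun ω => ?_)
  rw [norm_smul, mul_comm]
  exact mul_le_mul_of_nonneg_right (hf.norm_le _) (norm_nonneg _)

theorem hasFDerivAt_avg [CompleteSpace E] (hκ : Integrable κ μ) (hα : AEStronglyMeasurable α μ)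
    (hα1 : ∀ ω, |α ω| ≤ 1) (hτ : AEStronglyMeasurable τ μ) (hf : BddC 1 A f) (p : V) :
    HasFDerivAt (avg μ κ α τ f) (avg μ (fun ω => κ ω * α ω) α τ (fderiv ℝ f) p) p := by
  have hd : Differentiable ℝ f := hf.1.differentiable (by simp)
  have hf' := hf.fderiv (k := 0)
  have hκα : AEStronglyMeasurable (fun ω => κ ω * α ω) μ := hκ.1.mul hα
  refine hasFDerivAt_integral_of_dominated_of_fderiv_le (μ := μ) (s := univ)
    (F := fun p ω => κ ω • f (α ω • p + τ ω))
    (F' := fun p ω => (κ ω * α ω) • fderiv ℝ f (α ω • p + τ ω))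
    (bound := fun ω => A * ‖κ ω‖) Filter.univ_mem
    (Filter.Eventually.of_forall fun p => aestronglyMeasurable_avg hκ.1 hα hτ hf.1.continuous p)
    (integrable_avg hκ hα hτ hf p)
    (aestronglyMeasurable_avg hκα hα hτ hf'.1.continuous p) ?_ (hκ.norm.const_mul A) ?_
  · refine Filter.Eventually.of_forall fun ω p _ => ?_
    rw [norm_smul, norm_mul, mul_comm]
    refine mul_le_mul (hf'.norm_le _) ?_ (by positivity) hf.nonneg
    exact mul_le_of_le_one_right (norm_nonneg _) (hα1 ω)
  · refine Filter.Eventually.of_forall fun ω p _ => ?_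
    have h1 : HasFDerivAt (fun p : V => α ω • p + τ ω) (α ω • ContinuousLinearMap.id ℝ V) p :=
      ((hasFDerivAt_id p).const_smul (α ω)).add_const _
    have h2 := ((hd (α ω • p + τ ω)).hasFDerivAt.comp p h1).const_smul (κ ω)
    refine h2.congr_fderiv ?_
    ext v
    simp [mul_smul]

theorem integrable_mul_of_abs_le_one (hκ : Integrable κ μ) (hα : AEStronglyMeasurable α μ)
    (hα1 : ∀ ω, |α ω| ≤ 1) : Integrable (fun ω => κ ω * α ω) μ := by
  refine hκ.mono (hκ.1.mul hα) (Filter.Eventually.of_forall fun ω => ?_)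
  rw [norm_mul]
  exact mul_le_of_le_one_right (norm_nonneg _) (hα1 ω)

/-- Differentiating under the integral replaces κ by κα, whose L¹ norm is no larger because |α| ≤ 1.
The induction passes from f to its derivative, so the target space E and the weight κ must vary. The
case α = 1 covers potentials and mollification, the case τ = 0 covers radial means. -/
theorem BddC.avg : ∀ {k : ℕ} {E : Type} [NormedAddCommGroup E] [NormedSpace ℝ E] [CompleteSpace E]
    {f : V → E} {κ : Ω → ℝ} (_ : Integrable κ μ) (_ : AEStronglyMeasurable α μ)
    (_ : ∀ ω, |α ω| ≤ 1) (_ : AEStronglyMeasurable τ μ) (_ : BddC k A f),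
    BddC k (A * ∫ ω, ‖κ ω‖ ∂μ) (avg μ κ α τ f)
  | 0, E, _, _, _, f, κ, hκ, hα, hα1, hτ, hf => by
    refine bddC_zero_iff.2 ⟨?_, norm_avg_le hκ hf.norm_le⟩
    refine continuous_of_dominated (bound := fun ω => A * ‖κ ω‖)
      (fun p => aestronglyMeasurable_avg hκ.1 hα hτ hf.1.continuous p) ?_ (hκ.norm.const_mul A) ?_
    · refine fun p => Filter.Eventually.of_forall fun ω => ?_
      rw [norm_smul, mul_comm]
      exact mul_le_mul_of_nonneg_right (hf.norm_le _) (norm_nonneg _)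
    · refine Filter.Eventually.of_forall fun ω => ?_
      have := hf.1.continuous
      fun_prop
  | k + 1, E, _, _, _, f, κ, hκ, hα, hα1, hτ, hf => by
    have hd := fun p => hasFDerivAt_avg hκ hα hα1 hτ (hf.mono (by omega) le_rfl) p
    refine bddC_succ_iff.2 ⟨norm_avg_le hκ hf.norm_le, fun p => (hd p).differentiableAt, ?_⟩
    rw [show _root_.fderiv ℝ (PointSource.avg μ κ α τ f) = _ from funext fun p => (hd p).fderiv]
    have hκα := integrable_mul_of_abs_le_one hκ hα hα1
    refine (BddC.avg hκα hα hα1 hτ hf.fderiv).mono le_rfl ?_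
    refine mul_le_mul_of_nonneg_left (integral_mono hκα.norm hκ.norm fun ω => ?_) hf.nonneg
    simp only [norm_mul]
    exact mul_le_of_le_one_right (norm_nonneg _) (hα1 ω)

theorem fderiv_avg [CompleteSpace E] (hκ : Integrable κ μ) (hα : AEStronglyMeasurable α μ)
    (hα1 : ∀ ω, |α ω| ≤ 1) (hτ : AEStronglyMeasurable τ μ) (hf : BddC 1 A f) :
    _root_.fderiv ℝ (avg μ κ α τ f) = avg μ (fun ω => κ ω * α ω) α τ (_root_.fderiv ℝ f) :=
  funext fun p => (hasFDerivAt_avg hκ hα hα1 hτ hf p).fderiv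

theorem fderiv_avg_apply [CompleteSpace E] (hκ : Integrable κ μ) (hα : AEStronglyMeasurable α μ)
    (hα1 : ∀ ω, |α ω| ≤ 1) (hτ : AEStronglyMeasurable τ μ) (hf : BddC 1 A f) (p v : V) :
    _root_.fderiv ℝ (avg μ κ α τ f) p v =
      avg μ (fun ω => κ ω * α ω) α τ (fun p => _root_.fderiv ℝ f p v) p := by
  rw [fderiv_avg hκ hα hα1 hτ hf]
  unfold avg
  rw [ContinuousLinearMap.integral_apply
    (integrable_avg (integrable_mul_of_abs_le_one hκ hα hα1) hα hτ (hf.fderiv (k := 0)) p)]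
  simp

theorem avg_add (hκ : Integrable κ μ) (hα : AEStronglyMeasurable α μ)
    (hτ : AEStronglyMeasurable τ μ) (hf : BddC k A f) (hg : BddC k B g) (p : V) :
    avg μ κ α τ (fun p => f p + g p) p = avg μ κ α τ f p + avg μ κ α τ g p := by
  unfold avg
  rw [← integral_add (integrable_avg hκ hα hτ hf p) (integrable_avg hκ hα hτ hg p)]
  simp only [smul_add]

theorem avg_sub (hκ : Integrable κ μ) (hα : AEStronglyMeasurable α μ)
    (hτ : AEStronglyMeasurable τ μ) (hf : BddC k A f) (hg : BddC k B g) (p : V) :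
    avg μ κ α τ (fun p => f p - g p) p = avg μ κ α τ f p - avg μ κ α τ g p := by
  unfold avg
  rw [← integral_sub (integrable_avg hκ hα hτ hf p) (integrable_avg hκ hα hτ hg p)]
  simp only [smul_sub]

theorem exists_ne_zero_of_avg_ne_zero {p : V} (h : avg μ κ α τ f p ≠ 0) :
    ∃ ω, f (α ω • p + τ ω) ≠ 0 := by
  by_contra! hc
  exact h (by simp [avg, hc])

end Bounded

/-! ### Second directional derivatives and the wave operator -/

section SecondDerivatives

variable {V : Type} [NormedAddCommGroup V] [NormedSpace ℝ V] {k : ℕ} {A B : ℝ}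

/-- The second derivative of `f` in the direction `v`. -/
def dd (v : V) (f : V → ℂ) (p : V) : ℂ := fderiv ℝ (fun q => fderiv ℝ f q v) p v

theorem contDiff_fderiv_dir {f : V → ℂ} (hf : ContDiff ℝ (k + 1 : ℕ) f) (v : V) :
    ContDiff ℝ k (fun q => fderiv ℝ f q v) :=
  (hf.fderiv_right (m := k) (by norm_cast)).clm_apply contDiff_const

theorem differentiable_fderiv_dir {f : V → ℂ} (hf : ContDiff ℝ 2 f) (v : V) :
    Differentiable ℝ (fun q => fderiv ℝ f q v) :=
  (contDiff_fderiv_dir (k := 1) hf v).differentiable (by simp)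

theorem BddC.fderiv_dir {f : V → ℂ} (hf : BddC (k + 1) A f) {v : V} (hv : ‖v‖ ≤ 1) :
    BddC k A (fun q => _root_.fderiv ℝ f q v) := by
  refine ((hf.fderiv).clm (ContinuousLinearMap.apply ℝ ℂ v)).mono le_rfl ?_
  refine mul_le_of_le_one_left hf.nonneg (ContinuousLinearMap.opNorm_le_bound _ zero_le_one ?_)
  intro L
  rw [one_mul]
  exact (L.le_opNorm v).trans (mul_le_of_le_one_right (norm_nonneg _) hv)

theorem BddC.dd {f : V → ℂ} (hf : BddC (k + 2) A f) {v : V} (hv : ‖v‖ ≤ 1) :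
    BddC k A (dd v f) :=
  (hf.fderiv_dir hv).fderiv_dir hv

theorem contDiff_dd {f : V → ℂ} (hf : ContDiff ℝ (k + 2 : ℕ) f) (v : V) :
    ContDiff ℝ k (dd v f) :=
  contDiff_fderiv_dir (k := k) (contDiff_fderiv_dir (k := k + 1) hf v) v

theorem fderiv_mul_dir {f g : V → ℂ} (hf : Differentiable ℝ f) (hg : Differentiable ℝ g) (p v : V) :
    fderiv ℝ (fun p => f p * g p) p v = f p * fderiv ℝ g p v + fderiv ℝ f p v * g p := by
  rw [show (fun p => f p * g p) = f * g from rfl, fderiv_mul (hf p) (hg p)]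
  simp
  ring

theorem dd_mul {f g : V → ℂ} (hf : ContDiff ℝ 2 f) (hg : ContDiff ℝ 2 g) (v p : V) :
    dd v (fun p => f p * g p) p =
      f p * dd v g p + 2 * (fderiv ℝ f p v * fderiv ℝ g p v) + dd v f p * g p := by
  have hf1 : Differentiable ℝ f := hf.differentiable (by simp)
  have hg1 : Differentiable ℝ g := hg.differentiable (by simp)
  have hf2 := differentiable_fderiv_dir hf v
  have hg2 := differentiable_fderiv_dir hg v
  unfold dd
  simp_rw [fderiv_mul_dir hf1 hg1]
  rw [fderiv_fun_add (by fun_prop) (by fun_prop)]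
  simp only [add_apply]
  rw [fderiv_mul_dir hf1 hg2, fderiv_mul_dir hf2 hg1]
  ring

theorem dd_add {f g : V → ℂ} (hf : ContDiff ℝ 2 f) (hg : ContDiff ℝ 2 g) (v p : V) :
    dd v (fun p => f p + g p) p = dd v f p + dd v g p := by
  have hf1 : Differentiable ℝ f := hf.differentiable (by simp)
  have hg1 : Differentiable ℝ g := hg.differentiable (by simp)
  unfold dd
  have : (fun q => fderiv ℝ (fun p => f p + g p) q v) =
      fun q => fderiv ℝ f q v + fderiv ℝ g q v := by
    ext q
    rw [fderiv_fun_add (hf1 q) (hg1 q)]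
    rfl
  rw [this, fderiv_fun_add (differentiable_fderiv_dir hf v p)
    (differentiable_fderiv_dir hg v p)]
  rfl

theorem dd_sub {f g : V → ℂ} (hf : ContDiff ℝ 2 f) (hg : ContDiff ℝ 2 g) (v p : V) :
    dd v (fun p => f p - g p) p = dd v f p - dd v g p := by
  have hf1 : Differentiable ℝ f := hf.differentiable (by simp)
  have hg1 : Differentiable ℝ g := hg.differentiable (by simp)
  unfold dd
  have : (fun q => fderiv ℝ (fun p => f p - g p) q v) =
      fun q => fderiv ℝ f q v - fderiv ℝ g q v := by
    ext q
    rw [fderiv_fun_sub (hf1 q) (hg1 q)]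
    rfl
  rw [this, fderiv_fun_sub (differentiable_fderiv_dir hf v p)
    (differentiable_fderiv_dir hg v p)]
  rfl

theorem dd_comp_add_left (f : V → ℂ) (a v p : V) :
    dd v (fun p => f (a + p)) p = dd v f (a + p) := by
  unfold dd
  simp_rw [fderiv_comp_add_left]
  rw [fderiv_comp_add_left (f := fun q => fderiv ℝ f q v)]

theorem dd_avg {Ω : Type} [MeasurableSpace Ω] {μ : Measure Ω} {κ : Ω → ℝ} {τ : Ω → V}
    {f : V → ℂ} (hκ : Integrable κ μ) (hτ : AEStronglyMeasurable τ μ) (hf : BddC 2 A f)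
    (p v : V) : dd v (avg μ κ (fun _ => 1) τ f) p = avg μ κ (fun _ => 1) τ (dd v f) p := by
  have h1 : AEStronglyMeasurable (fun _ : Ω => (1 : ℝ)) μ := aestronglyMeasurable_const
  have h2 : ∀ ω : Ω, |(fun _ : Ω => (1 : ℝ)) ω| ≤ 1 := fun _ => by simp
  obtain ⟨B, hB⟩ : ∃ B, BddC 1 B (fun q => fderiv ℝ f q v) :=
    ⟨_, (hf.fderiv (k := 1)).clm (ContinuousLinearMap.apply ℝ ℂ v)⟩
  unfold dd
  have : (fun q => fderiv ℝ (avg μ κ (fun _ => 1) τ f) q v) =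
      avg μ κ (fun _ => 1) τ (fun q => fderiv ℝ f q v) := by
    ext q
    rw [fderiv_avg_apply hκ h1 h2 hτ (hf.mono (by norm_num) le_rfl)]
    simp
  rw [this, fderiv_avg_apply hκ h1 h2 hτ hB]
  simp

end SecondDerivatives

/-- The Laplacian of a function on `ℝ³`. -/
def lap (f : Space → ℂ) (x : Space) : ℂ := ∑ i, dd (spaceDir i) f x

/-- The wave operator `∂_t² - Δ` acting on functions on space-time. -/
def box (f : Spacetime → ℂ) (p : Spacetime) : ℂ :=
  dd timeDir f p - ∑ i, dd ((spaceDir i, 0) : Spacetime) f p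

theorem norm_spaceDir (i : Fin 3) : ‖spaceDir i‖ = 1 := by simp [spaceDir]

theorem norm_timeDir : ‖timeDir‖ = 1 := by simp [timeDir, Prod.norm_def]

theorem norm_spaceDir_zero (i : Fin 3) : ‖((spaceDir i, 0) : Spacetime)‖ = 1 := by
  simp [Prod.norm_def, norm_spaceDir]

theorem BddC.sum {V ι : Type} [NormedAddCommGroup V] [NormedSpace ℝ V] {k : ℕ} (s : Finset ι)
    {A : ι → ℝ} {f : ι → V → ℂ} (h : ∀ i ∈ s, BddC k (A i) (f i)) :
    BddC k (∑ i ∈ s, A i) (fun p => ∑ i ∈ s, f i p) := by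
  classical
  induction s using Finset.induction_on with
  | empty => simpa using bddC_zero_fun le_rfl
  | insert i s hi ih =>
    simp only [Finset.sum_insert hi]
    exact (h i (by simp)).add (ih fun j hj => h j (by simp [hj]))

theorem BddC.lap {k : ℕ} {A : ℝ} {f : Space → ℂ} (hf : BddC (k + 2) A f) :
    BddC k (3 * A) (lap f) := by
  have := BddC.sum Finset.univ (fun i _ => hf.dd (norm_spaceDir i).le)
  rw [Finset.sum_const, Finset.card_univ, Fintype.card_fin, nsmul_eq_mul] at this
  exact this

theorem box_add {f g : Spacetime → ℂ} (hf : ContDiff ℝ 2 f) (hg : ContDiff ℝ 2 g) (p : Spacetime) :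
    box (fun p => f p + g p) p = box f p + box g p := by
  simp only [box, dd_add hf hg, Finset.sum_add_distrib]
  ring

theorem box_comp_add_left (f : Spacetime → ℂ) (a p : Spacetime) :
    box (fun p => f (a + p)) p = box f (a + p) := by
  simp only [box, dd_comp_add_left]

theorem box_avg {Ω : Type} [MeasurableSpace Ω] {μ : Measure Ω} {κ : Ω → ℝ} {τ : Ω → Spacetime}
    {f : Spacetime → ℂ} {A : ℝ} (hκ : Integrable κ μ) (hτ : AEStronglyMeasurable τ μ)
    (hf : BddC 2 A f) (p : Spacetime) :
    box (avg μ κ (fun _ => 1) τ f) p = avg μ κ (fun _ => 1) τ (box f) p := by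
  have h1 : AEStronglyMeasurable (fun _ : Ω => (1 : ℝ)) μ := aestronglyMeasurable_const
  have ht : BddC 0 A (dd timeDir f) := hf.dd norm_timeDir.le
  have hx : ∀ i : Fin 3, BddC 0 A (dd ((spaceDir i, 0) : Spacetime) f) :=
    fun i => hf.dd (norm_spaceDir_zero i).le
  unfold box
  simp_rw [dd_avg hκ hτ hf]
  rw [avg_sub hκ h1 hτ ht (BddC.sum Finset.univ fun i _ => hx i)]
  congr 1
  unfold avg
  simp_rw [Finset.smul_sum]
  rw [integral_finsetSum]
  exact fun i _ => integrable_avg hκ h1 hτ (hx i) p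

/-! ### The damped potential and its Neumann series -/

theorem integrable_norm_iff {f : ℝ → ℝ} :
    Integrable (fun z : Space => f ‖z‖) ↔ IntegrableOn (fun y : ℝ => y ^ 2 * f y) (Ioi 0) := by
  have := integrable_fun_norm_addHaar (volume : Measure Space) (f := f)
  simpa using this

theorem integral_norm {f : ℝ → ℝ} :
    ∫ z : Space, f ‖z‖ = 4 * Real.pi * ∫ y in Ioi (0 : ℝ), y ^ 2 * f y := by
  have := integral_fun_norm_addHaar (volume : Measure Space) f
  rw [this]
  simp only [finrank_euclideanSpace, Fintype.card_fin, Measure.real,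
    EuclideanSpace.volume_ball_fin_three, smul_eq_mul, nsmul_eq_mul]
  rw [ENNReal.toReal_mul, ENNReal.toReal_ofReal (by positivity)]
  simp
  ring

/-- The kernel `e^{-ℓ|z|} / (4π|z|)`. -/
def ker (ℓ : ℝ) (z : Space) : ℝ := Real.exp (-(ℓ * ‖z‖)) / (4 * Real.pi * ‖z‖)

theorem ker_nonneg (ℓ : ℝ) (z : Space) : 0 ≤ ker ℓ z := by unfold ker; positivity

theorem integrableOn_mul_exp {ℓ : ℝ} (hℓ : 0 < ℓ) :
    IntegrableOn (fun y : ℝ => y * Real.exp (-(ℓ * y))) (Ioi 0) := by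
  refine (integrableOn_rpow_mul_exp_neg_mul_rpow (p := 1) (s := 1) (by norm_num) (by norm_num) hℓ
    ).congr_fun (fun y _ => ?_) measurableSet_Ioi
  simp

theorem integrable_ker {ℓ : ℝ} (hℓ : 0 < ℓ) : Integrable (ker ℓ) := by
  refine integrable_norm_iff (f := fun y => Real.exp (-(ℓ * y)) / (4 * Real.pi * y)).2 ?_
  refine IntegrableOn.congr_fun (Integrable.const_mul (integrableOn_mul_exp hℓ) (1 / (4 * Real.pi)))
    (fun y hy => ?_) measurableSet_Ioi
  have : y ≠ 0 := (mem_Ioi.1 hy).ne'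
  field_simp

/-- In polar coordinates this is ∫ y e^{-ℓy} dy = Γ(2)/ℓ². The mass bounds the norm of `pot ℓ ε` in
every C^k, and damping makes it as small as desired. -/
theorem integral_norm_ker {ℓ : ℝ} (hℓ : 0 < ℓ) : ∫ z, ‖ker ℓ z‖ = 1 / ℓ ^ 2 := by
  simp_rw [Real.norm_of_nonneg (ker_nonneg ℓ _)]
  unfold ker
  rw [integral_norm (f := fun y => Real.exp (-(ℓ * y)) / (4 * Real.pi * y))]
  have h1 : ∫ y in Ioi (0 : ℝ), y ^ 2 * (Real.exp (-(ℓ * y)) / (4 * Real.pi * y)) =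
      ∫ y in Ioi (0 : ℝ), 1 / (4 * Real.pi) * (y ^ ((2 : ℝ) - 1) * Real.exp (-(ℓ * y))) := by
    refine setIntegral_congr_fun measurableSet_Ioi fun y hy => ?_
    have : y ≠ 0 := (mem_Ioi.1 hy).ne'
    norm_num
    field_simp
  rw [h1, integral_const_mul, Real.integral_rpow_mul_exp_neg_mul_Ioi two_pos hℓ]
  norm_num
  field_simp

/-- The retarded (`ε = 1`) or advanced (`ε = -1`) potential of `f`, with the damping factor
`e^{-ℓ|z|}`. -/
def pot (ℓ ε : ℝ) (f : Spacetime → ℂ) : Spacetime → ℂ :=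
  avg volume (ker ℓ) (fun _ => 1) (fun z => ((-z, -(ε * ‖z‖)) : Spacetime)) f

theorem aestronglyMeasurable_shift (ε : ℝ) :
    AEStronglyMeasurable (fun z : Space => ((-z, -(ε * ‖z‖)) : Spacetime)) volume :=
  (by fun_prop : Continuous fun z : Space => ((-z, -(ε * ‖z‖)) : Spacetime)).aestronglyMeasurable

section Resolvent

variable {k : ℕ} {A B Q ℓ ε : ℝ} {f g F : Spacetime → ℂ} {q : Space → ℂ}

theorem BddC.pot (hℓ : 0 < ℓ) (hf : BddC k A f) : BddC k (A / ℓ ^ 2) (pot ℓ ε f) := by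
  have := hf.avg (integrable_ker hℓ) (α := fun _ => 1) aestronglyMeasurable_const (by simp)
    (aestronglyMeasurable_shift ε)
  rwa [integral_norm_ker hℓ, mul_one_div] at this

theorem pot_add (hℓ : 0 < ℓ) (hf : BddC k A f) (hg : BddC k B g) (p : Spacetime) :
    pot ℓ ε (fun p => f p + g p) p = pot ℓ ε f p + pot ℓ ε g p :=
  avg_add (integrable_ker hℓ) aestronglyMeasurable_const (aestronglyMeasurable_shift ε) hf hg p

theorem pot_sub (hℓ : 0 < ℓ) (hf : BddC k A f) (hg : BddC k B g) (p : Spacetime) :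
    pot ℓ ε (fun p => f p - g p) p = pot ℓ ε f p - pot ℓ ε g p :=
  avg_sub (integrable_ker hℓ) aestronglyMeasurable_const (aestronglyMeasurable_shift ε) hf hg p

theorem BddC.pot_mul (hℓ : 0 < ℓ) (hq : BddC k Q q) (hQ : 2 ^ k * Q * 2 ≤ ℓ ^ 2)
    (hg : BddC k A g) : BddC k (A * (1 / 2)) (PointSource.pot ℓ ε fun p => q p.1 * g p) := by
  refine ((hq.comp_fst.mul hg).pot hℓ).mono le_rfl ?_
  rw [div_le_iff₀ (by positivity)]
  nlinarith [hg.nonneg]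

/-- The terms of the Neumann series for `g = pot (F + q g)`. -/
def neumann (ℓ ε : ℝ) (q : Space → ℂ) (F : Spacetime → ℂ) : ℕ → Spacetime → ℂ
  | 0 => pot ℓ ε F
  | n + 1 => pot ℓ ε fun p => q p.1 * neumann ℓ ε q F n p

/-- The solution of `g = pot (F + q g)`. -/
def resolvent (ℓ ε : ℝ) (q : Space → ℂ) (F : Spacetime → ℂ) (p : Spacetime) : ℂ :=
  ∑' n, neumann ℓ ε q F n p

theorem bddC_neumann (hℓ : 0 < ℓ) (hq : BddC k Q q) (hQ : 2 ^ k * Q * 2 ≤ ℓ ^ 2)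
    (hF : BddC k A F) (n : ℕ) : BddC k (A / ℓ ^ 2 * (1 / 2) ^ n) (neumann ℓ ε q F n) := by
  induction n with
  | zero => simpa [neumann] using hF.pot hℓ
  | succ n ih =>
    rw [pow_succ (1 / 2 : ℝ), ← mul_assoc]
    exact BddC.pot_mul hℓ hq hQ ih

theorem bddC_resolvent (hℓ : 0 < ℓ) (hq : BddC k Q q) (hQ : 2 ^ k * Q * 2 ≤ ℓ ^ 2)
    (hF : BddC k A F) : BddC k (2 * (A / ℓ ^ 2)) (resolvent ℓ ε q F) := by
  have hb := bddC_neumann (ε := ε) hℓ hq hQ hF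
  have hs : HasSum (fun n : ℕ => A / ℓ ^ 2 * (1 / 2) ^ n) (2 * (A / ℓ ^ 2)) := by
    rw [mul_comm 2]
    exact hasSum_geometric_two.mul_left _
  have hv : ∀ j : ℕ, ((j : ℕ∞)) ≤ (k : ℕ∞) →
      Summable ((fun _ n => A / ℓ ^ 2 * (1 / 2) ^ n : ℕ → ℕ → ℝ) j) := fun _ _ => hs.summable
  have hle : ∀ (j n : ℕ) (p : Spacetime), ((j : ℕ∞)) ≤ (k : ℕ∞) →
      ‖iteratedFDeriv ℝ j (neumann ℓ ε q F n) p‖ ≤ A / ℓ ^ 2 * (1 / 2) ^ n :=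
    fun j n p hj => (hb n).2 j (by exact_mod_cast hj) p
  refine ⟨contDiff_tsum (fun n => (hb n).1) hv hle, fun j hj p => ?_⟩
  have hj' : (j : ℕ∞) ≤ (k : ℕ∞) := by exact_mod_cast hj
  have := iteratedFDeriv_tsum_apply (N := (k : ℕ∞)) (fun n => (hb n).1) hv hle hj' p
  unfold resolvent
  rw [this]
  exact tsum_of_norm_bounded hs fun n => hle j n p hj'

/-- Splitting off the zeroth term of the series leaves the sum of the potentials of q times the
terms. The geometric bound allows the sum to be taken inside the integral. -/
theorem resolvent_eq (hℓ : 0 < ℓ) (hq : BddC k Q q) (hQ : 2 ^ k * Q * 2 ≤ ℓ ^ 2)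
    (hF : BddC k A F) (p : Spacetime) :
    resolvent ℓ ε q F p = pot ℓ ε (fun p => F p + q p.1 * resolvent ℓ ε q F p) p := by
  have hb := bddC_neumann (ε := ε) hℓ hq hQ hF
  have hs : Summable (fun n : ℕ => A / ℓ ^ 2 * (1 / 2) ^ n) := summable_geometric_two.mul_left _
  have hsum : ∀ p, Summable fun n => neumann ℓ ε q F n p := fun p =>
    Summable.of_norm_bounded hs fun n => (hb n).norm_le p
  rw [pot_add hℓ hF (hq.comp_fst.mul (bddC_resolvent hℓ hq hQ hF))]
  unfold resolvent
  rw [(hsum p).tsum_eq_zero_add]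
  congr 1
  simp only [neumann]
  have hi : ∀ n, Integrable (fun z : Space => ker ℓ z • (fun p : Spacetime =>
      q p.1 * neumann ℓ ε q F n p) ((1 : ℝ) • p + (-z, -(ε * ‖z‖)))) := fun n =>
    integrable_avg (α := fun _ => 1) (integrable_ker hℓ) aestronglyMeasurable_const
      (aestronglyMeasurable_shift ε) (hq.comp_fst.mul (hb n)) p
  have := hasSum_integral_of_summable_integral_norm hi ?_
  · unfold pot avg
    rw [this.tsum_eq]
    refine integral_congr_ae (Filter.Eventually.of_forall fun z => ?_)
    simp only
    rw [← tsum_mul_left, tsum_const_smul'']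
  · refine Summable.of_nonneg_of_le (fun n => integral_nonneg fun _ => norm_nonneg _)
      (fun n => ?_) ((hs.mul_left (2 ^ k * Q)).mul_right (∫ z, ‖ker ℓ z‖))
    rw [← integral_const_mul]
    refine integral_mono (hi n).norm ((integrable_ker hℓ).norm.const_mul _) fun z => ?_
    simp only [norm_smul]
    rw [mul_comm]
    exact mul_le_mul_of_nonneg_right ((hq.comp_fst.mul (hb n)).norm_le _) (norm_nonneg _)

/-- Finite speed of propagation: S is required to contain every point influenced by one of its
points. It is applied to the open forward cone for ε = 1 and to |x| + t ≤ 2R for ε = -1. -/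
theorem support_pot {S : Set Spacetime} (hS : ∀ p z, p + (-z, -(ε * ‖z‖)) ∈ S → p ∈ S)
    (hf : ∀ p, f p ≠ 0 → p ∈ S) : ∀ p, pot ℓ ε f p ≠ 0 → p ∈ S := by
  intro p hp
  obtain ⟨z, hz⟩ := exists_ne_zero_of_avg_ne_zero hp
  rw [one_smul] at hz
  exact hS p z (hf _ hz)

theorem support_resolvent {S : Set Spacetime} (hS : ∀ p z, p + (-z, -(ε * ‖z‖)) ∈ S → p ∈ S)
    (hF : ∀ p, F p ≠ 0 → p ∈ S) : ∀ p, resolvent ℓ ε q F p ≠ 0 → p ∈ S := by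
  have : ∀ n p, neumann ℓ ε q F n p ≠ 0 → p ∈ S := by
    intro n
    induction n with
    | zero => exact support_pot hS hF
    | succ n ih => exact support_pot hS fun p hp => ih p (right_ne_zero_of_mul hp)
  intro p hp
  by_contra hc
  refine hp ?_
  unfold resolvent
  rw [tsum_congr fun n => not_not.1 (mt (this n p) hc), tsum_zero]

/-- The equation improves any bound C to A/ℓ² + C/2, and iteration converges to the fixed point
2A/ℓ². The prior bound B thus disappears. Applied to a difference of two resolvents, this gives
Lipschitz dependence on the potential. -/
theorem bddC_of_eq_pot (hℓ : 0 < ℓ) (hq : BddC k Q q) (hQ : 2 ^ k * Q * 2 ≤ ℓ ^ 2)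
    (hF : BddC k A F) (hg : BddC k B g)
    (h : ∀ p, g p = pot ℓ ε (fun p => F p + q p.1 * g p) p) : BddC k (2 * (A / ℓ ^ 2)) g := by
  have step : ∀ C, BddC k C g → BddC k (A / ℓ ^ 2 + C * (1 / 2)) g := fun C hC =>
    ((hF.pot hℓ).add (BddC.pot_mul hℓ hq hQ hC)).congr fun p => by
      rw [h p, pot_add hℓ hF (hq.comp_fst.mul hC)]
  have iter : ∀ n : ℕ, BddC k (2 * (A / ℓ ^ 2) + B * (1 / 2) ^ n) g := by
    intro n
    have hA : 0 ≤ A / ℓ ^ 2 := div_nonneg hF.nonneg (by positivity)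
    induction n with
    | zero => exact hg.mono le_rfl (by simpa using hA)
    | succ n ih =>
      refine (step _ ih).mono le_rfl (le_of_eq ?_)
      ring
  refine ⟨hg.1, fun j hj p => ?_⟩
  have hlim : Filter.Tendsto (fun n : ℕ => 2 * (A / ℓ ^ 2) + B * (1 / 2 : ℝ) ^ n) Filter.atTop
      (nhds (2 * (A / ℓ ^ 2) + B * 0)) :=
    tendsto_const_nhds.add ((tendsto_pow_atTop_nhds_zero_of_lt_one (by norm_num)
      (by norm_num)).const_mul B)
  rw [mul_zero, add_zero] at hlim
  exact ge_of_tendsto' hlim fun n => (iter n).2 j hj p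

end Resolvent

/-! ### The fundamental solution, by approximating the cone with hyperboloids -/

/-- The smooth approximation `√(|z|² + ε²)` of `|z|`. -/
def smoothNorm (ε : ℝ) (z : Space) : ℝ := Real.sqrt (‖z‖ ^ 2 + ε ^ 2)

theorem smoothNorm_sq (ε : ℝ) (z : Space) : smoothNorm ε z ^ 2 = ‖z‖ ^ 2 + ε ^ 2 :=
  Real.sq_sqrt (by positivity)

theorem smoothNorm_pos {ε : ℝ} (hε : 0 < ε) (z : Space) : 0 < smoothNorm ε z :=
  Real.sqrt_pos.2 (by positivity)

theorem norm_le_smoothNorm (ε : ℝ) (z : Space) : ‖z‖ ≤ smoothNorm ε z :=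
  Real.le_sqrt_of_sq_le (by nlinarith [sq_nonneg ε])

theorem le_smoothNorm (ε : ℝ) (z : Space) : ε ≤ smoothNorm ε z :=
  Real.le_sqrt_of_sq_le (by nlinarith [sq_nonneg ‖z‖])

@[fun_prop]
theorem continuous_smoothNorm_right (ε : ℝ) : Continuous (smoothNorm ε) := by
  unfold smoothNorm
  fun_prop

theorem smoothNorm_zero (z : Space) : smoothNorm 0 z = ‖z‖ := by
  simp [smoothNorm]

theorem tendsto_smoothNorm (z : Space) :
    Tendsto (fun ε => smoothNorm ε z) (𝓝[>] 0) (𝓝 ‖z‖) := by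
  have h : Continuous fun ε => smoothNorm ε z := by
    unfold smoothNorm
    fun_prop
  have h1 : Tendsto (fun ε => smoothNorm ε z) (𝓝 0) (𝓝 ‖z‖) := by
    have h2 := h.tendsto 0
    simp only [smoothNorm_zero] at h2
    exact h2
  exact tendsto_nhdsWithin_of_tendsto_nhds h1

theorem norm_sq_eq_sum (z : Space) : ‖z‖ ^ 2 = z 0 ^ 2 + z 1 ^ 2 + z 2 ^ 2 := by
  rw [EuclideanSpace.norm_sq_eq, Fin.sum_univ_three]
  simp

theorem add_smul_spaceDir_apply (z : Space) (i : Fin 3) (r : ℝ) :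
    (z + r • spaceDir i) i = z i + r := by
  simp [spaceDir]

theorem abs_apply_le_norm (z : Space) (i : Fin 3) : |z i| ≤ ‖z‖ := by
  simpa using PiLp.norm_apply_le z i

theorem norm_add_smul_spaceDir_sq (z : Space) (i : Fin 3) (r : ℝ) :
    ‖z + r • spaceDir i‖ ^ 2 = ‖z‖ ^ 2 + 2 * r * z i + r ^ 2 := by
  rw [norm_add_sq_real, norm_smul, norm_spaceDir, inner_smul_right]
  simp [spaceDir, EuclideanSpace.inner_single_right]
  ring

theorem hasDerivAt_smoothNorm {ε : ℝ} (hε : 0 < ε) (z : Space) (i : Fin 3) :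
    HasDerivAt (fun r : ℝ => smoothNorm ε (z + r • spaceDir i)) (z i / smoothNorm ε z) 0 := by
  have h1 : HasDerivAt (fun r : ℝ => ‖z + r • spaceDir i‖ ^ 2 + ε ^ 2) (2 * z i) 0 := by
    simp_rw [norm_add_smul_spaceDir_sq]
    have := ((((hasDerivAt_id (0 : ℝ)).const_mul 2).mul_const (z i)).const_add (‖z‖ ^ 2)).add
      (hasDerivAt_pow 2 (0 : ℝ)) |>.add_const (ε ^ 2)
    simpa using this
  have h2 := h1.sqrt (by positivity)
  refine h2.congr_deriv ?_
  have := smoothNorm_pos hε z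
  simp only [zero_smul, add_zero]
  change 2 * z i / (2 * smoothNorm ε z) = _
  field_simp

/-- The shift u is zero in the divergence identities. It becomes the time variable when the region
above the hyperboloid is sliced into translated hyperboloids. -/
theorem hasLineDerivAt_comp_smoothNorm {ε : ℝ} (hε : 0 < ε) {F : Spacetime → ℂ}
    (hF : Differentiable ℝ F) (u : ℝ) (z : Space) (i : Fin 3) :
    HasLineDerivAt ℝ (fun z => F (z, smoothNorm ε z + u))
      (fderiv ℝ F (z, smoothNorm ε z + u) (spaceDir i, 0) +
        (z i / smoothNorm ε z) • fderiv ℝ F (z, smoothNorm ε z + u) timeDir) z (spaceDir i) := by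
  have h1 : HasDerivAt (fun r : ℝ => ((z + r • spaceDir i,
      smoothNorm ε (z + r • spaceDir i) + u) : Spacetime))
      (spaceDir i, z i / smoothNorm ε z) 0 := by
    refine HasDerivAt.prodMk ?_ ((hasDerivAt_smoothNorm hε z i).add_const u)
    simpa using ((hasDerivAt_id (0 : ℝ)).smul_const (spaceDir i)).const_add z
  have h0 : ((z + (0 : ℝ) • spaceDir i, smoothNorm ε (z + (0 : ℝ) • spaceDir i) + u) : Spacetime) =
      (z, smoothNorm ε z + u) := by simp
  have h2 := HasFDerivAt.comp_hasDerivAt (0 : ℝ) (l := F) (by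
    exact (hF _).hasFDerivAt) h1
  rw [h0] at h2
  refine h2.congr_deriv ?_
  rw [← map_smul, ← map_add]
  congr 1
  simp [timeDir]

theorem integral_lineDeriv_eq_zero {X X' : Space → ℂ} {v : Space} {R : ℝ}
    (hX : ∀ z, HasLineDerivAt ℝ X (X' z) z v) (hc : Continuous X) (hc' : Continuous X')
    (h0 : ∀ z, R < ‖z‖ → X z = 0) (h0' : ∀ z, R < ‖z‖ → X' z = 0) :
    Integrable X' ∧ ∫ z, X' z = 0 := by
  have hs : ∀ {Y : Space → ℂ}, (∀ z, R < ‖z‖ → Y z = 0) → HasCompactSupport Y := by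
    intro Y hY
    refine HasCompactSupport.intro (isCompact_closedBall (0 : Space) R) fun z hz => hY z ?_
    simpa using hz
  have hi := hc.integrable_of_hasCompactSupport (μ := volume) (hs h0)
  have hi' := hc'.integrable_of_hasCompactSupport (μ := volume) (hs h0')
  refine ⟨hi', ?_⟩
  -- Integration by parts against the constant function 1.
  have := integral_bilinear_hasLineDerivAt_right_eq_neg_left_of_integrable (μ := volume)
    (f := fun _ => (1 : ℂ)) (f' := fun _ => 0) (g := X) (g' := X') (v := v)
    (B := ContinuousLinearMap.mul ℝ ℂ) (by simp) (by simpa using hi') (by simpa using hi)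
    (fun x _ => by
      have := hasDerivAt_const (0 : ℝ) (1 : ℂ)
      exact this) (fun x _ => hX x)
  simpa using this

theorem fderiv_eq_zero_of_late {F : Spacetime → ℂ} {R : ℝ} (hF : ∀ p : Spacetime, R < p.2 → F p = 0)
    (p : Spacetime) (hp : R < p.2) : fderiv ℝ F p = 0 := by
  have : F =ᶠ[𝓝 p] fun _ => 0 := by
    filter_upwards [(isOpen_lt continuous_const continuous_snd).mem_nhds hp] with x hx
    exact hF x hx
  rw [this.fderiv_eq]
  simp

/-- Vanishing for late times is weaker than compact support, but in the region |x| ≤ t it leaves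
only a compact set. -/
theorem exists_bound_of_late {F : Spacetime → ℂ} {R : ℝ} (hF : Continuous F)
    (h0 : ∀ p : Spacetime, R < p.2 → F p = 0) :
    ∃ B, 0 ≤ B ∧ ∀ p : Spacetime, ‖p.1‖ ≤ p.2 → ‖F p‖ ≤ B := by
  have hK : IsCompact (closedBall (0 : Space) R ×ˢ Icc (0 : ℝ) R) :=
    (isCompact_closedBall _ _).prod isCompact_Icc
  obtain ⟨B, hB⟩ := hK.exists_bound_of_continuousOn hF.continuousOn
  refine ⟨|B|, abs_nonneg _, fun p hp => ?_⟩
  by_cases h : R < p.2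
  · simp [h0 p h]
  · refine (hB p ⟨?_, (norm_nonneg _).trans hp, not_lt.1 h⟩).trans (le_abs_self _)
    simpa using hp.trans (not_lt.1 h)

/-- The hypothesis `hC` allows the weights a singularity of type 1/|z|, uniformly in ε; this is
integrable in three dimensions. -/
theorem tendsto_integral_smoothNorm {F : Spacetime → ℂ} {R C : ℝ} (hF : Continuous F)
    (h0 : ∀ p : Spacetime, R < p.2 → F p = 0) {m : ℝ → Space → ℝ} {m₀ : Space → ℝ}
    (hm : ∀ ε, 0 < ε → Continuous (m ε)) (hC : ∀ ε, 0 < ε → ∀ z, |m ε z| * ‖z‖ ≤ C * (1 + ‖z‖))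
    (hlim : ∀ z, z ≠ 0 → Tendsto (fun ε => m ε z) (𝓝[>] 0) (𝓝 (m₀ z))) :
    Tendsto (fun ε => ∫ z, m ε z • F (z, smoothNorm ε z)) (𝓝[>] 0)
      (𝓝 (∫ z, m₀ z • F (z, ‖z‖))) := by
  obtain ⟨B, hB0, hB⟩ := exists_bound_of_late hF h0
  have hC0 : 0 ≤ C := by
    have := hC 1 one_pos 0
    simpa using this
  -- On |z| ≤ |R| the function 1/|z| is at most 4π e^{|R|} `ker 1 z`, so a multiple of this
  -- integrable kernel serves as majorant.
  refine tendsto_integral_filter_of_dominated_convergence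
    (fun z => (B * C * (1 + |R|) * (4 * Real.pi) * Real.exp |R|) * ker 1 z) ?_ ?_
    ((integrable_ker one_pos).const_mul _) ?_
  · filter_upwards [self_mem_nhdsWithin] with ε hε
    have := hm ε hε
    exact (by fun_prop : Continuous _).aestronglyMeasurable
  · filter_upwards [self_mem_nhdsWithin] with ε hε
    filter_upwards [Measure.ae_ne volume (0 : Space)] with z hz
    have hz' : 0 < ‖z‖ := norm_pos_iff.2 hz
    have hk := ker_nonneg 1 z
    by_cases h : R < smoothNorm ε z
    · rw [h0 _ h]
      simp only [smul_zero, norm_zero]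
      positivity
    · have hzR : ‖z‖ ≤ |R| := (norm_le_smoothNorm ε z).trans ((not_lt.1 h).trans (le_abs_self R))
      rw [norm_smul, Real.norm_eq_abs]
      have h1 : |m ε z| ≤ C * (1 + |R|) / ‖z‖ := by
        rw [le_div_iff₀ hz']
        exact (hC ε hε z).trans (by gcongr)
      have h2 : 1 / ‖z‖ ≤ 4 * Real.pi * Real.exp |R| * ker 1 z := by
        unfold ker
        rw [one_mul, Real.exp_neg]
        have : Real.exp ‖z‖ ≤ Real.exp |R| := Real.exp_le_exp.2 hzR
        have h3 := Real.exp_pos ‖z‖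
        rw [div_le_iff₀ hz']
        field_simp
        exact this
      calc |m ε z| * ‖F (z, smoothNorm ε z)‖ ≤ (C * (1 + |R|) / ‖z‖) * B :=
            mul_le_mul h1 (hB _ (norm_le_smoothNorm ε z)) (norm_nonneg _) (by positivity)
        _ = B * C * (1 + |R|) * (1 / ‖z‖) := by ring
        _ ≤ B * C * (1 + |R|) * (4 * Real.pi * Real.exp |R| * ker 1 z) := by gcongr
        _ = _ := by ring
  · filter_upwards [Measure.ae_ne volume (0 : Space)] with z hz
    refine (hlim z hz).smul ?_
    exact (hF.tendsto _).comp (tendsto_const_nhds.prodMk_nhds (tendsto_smoothNorm z))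

theorem fderiv_dir_symm {V : Type} [NormedAddCommGroup V] [NormedSpace ℝ V] {h : V → ℂ}
    (hh : ContDiff ℝ 2 h) (p v w : V) :
    fderiv ℝ (fun q => fderiv ℝ h q v) p w = fderiv ℝ (fun q => fderiv ℝ h q w) p v := by
  have hs : IsSymmSndFDerivAt ℝ h p := hh.contDiffAt.isSymmSndFDerivAt (by simp)
  have hd : DifferentiableAt ℝ (fderiv ℝ h) p :=
    ((hh.fderiv_right (m := 1) (by norm_num)).differentiable (by simp)) p
  have key : ∀ v w, fderiv ℝ (fun q => fderiv ℝ h q v) p w = fderiv ℝ (fderiv ℝ h) p w v := by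
    intro v w
    rw [fderiv_clm_apply hd (differentiableAt_const v)]
    simp
  rw [key, key]
  exact hs w v

section Coefficients

variable {ε : ℝ} (z : Space) (i : Fin 3)

theorem hasDerivAt_coord : HasDerivAt (fun r : ℝ => (z + r • spaceDir i) i) 1 0 := by
  simp_rw [add_smul_spaceDir_apply]
  exact (hasDerivAt_id _).const_add _

theorem hasDerivAt_inv_smoothNorm (hε : 0 < ε) :
    HasDerivAt (fun r : ℝ => (smoothNorm ε (z + r • spaceDir i))⁻¹)
      (-(z i / smoothNorm ε z ^ 3)) 0 := by
  have hs := smoothNorm_pos hε z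
  refine ((hasDerivAt_smoothNorm hε z i).inv (by simpa using hs.ne')).congr_deriv ?_
  simp only [zero_smul, add_zero]
  field_simp

theorem hasDerivAt_coord_mul_inv_pow (hε : 0 < ε) (n : ℕ) :
    HasDerivAt (fun r : ℝ => (z + r • spaceDir i) i * (smoothNorm ε (z + r • spaceDir i))⁻¹ ^ n)
      ((smoothNorm ε z)⁻¹ ^ n - n * z i ^ 2 * (smoothNorm ε z)⁻¹ ^ (n + 2)) 0 := by
  have hs := smoothNorm_pos hε z
  refine ((hasDerivAt_coord z i).mul ((hasDerivAt_inv_smoothNorm z i hε).pow n)).congr_deriv ?_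
  simp only [zero_smul, add_zero, Pi.pow_apply]
  cases n with
  | zero => simp
  | succ n =>
    simp only [Nat.add_sub_cancel, inv_pow]
    push_cast
    field_simp
    ring

end Coefficients

theorem sum_sq_eq (ε : ℝ) (z : Space) :
    ((z 0 : ℝ) : ℂ) ^ 2 + ((z 1 : ℝ) : ℂ) ^ 2 + ((z 2 : ℝ) : ℂ) ^ 2 =
      (smoothNorm ε z : ℂ) ^ 2 - (ε : ℂ) ^ 2 := by
  have := smoothNorm_sq ε z
  rw [norm_sq_eq_sum] at this
  have h2 := congrArg (fun x : ℝ => (x : ℂ)) this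
  push_cast at h2
  linear_combination -h2

theorem integrable_smul_smoothNorm {ε : ℝ} {F : Spacetime → ℂ} {R : ℝ} (hF : Continuous F)
    (h0 : ∀ p : Spacetime, R < p.2 → F p = 0) {m : Space → ℝ} (hm : Continuous m) :
    Integrable fun z => m z • F (z, smoothNorm ε z) := by
  refine (by fun_prop : Continuous _).integrable_of_hasCompactSupport
    (HasCompactSupport.intro (isCompact_closedBall (0 : Space) R) fun z hz => ?_)
  have hz' : R < ‖z‖ := by simpa using hz
  rw [h0 _ (hz'.trans_le (norm_le_smoothNorm ε z)), smul_zero]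

/-- The integral over the hyperboloid of the wave operator of `h`. -/
theorem integral_box_smoothNorm {ε : ℝ} (hε : 0 < ε) {h : Spacetime → ℂ} (hh : ContDiff ℝ 2 h)
    {R : ℝ} (h0 : ∀ p : Spacetime, R < p.2 → h p = 0) :
    ∫ z, (smoothNorm ε z)⁻¹ • box h (z, smoothNorm ε z) =
      ∫ z, ((ε ^ 2 * (smoothNorm ε z)⁻¹ ^ 3) • dd timeDir h (z, smoothNorm ε z) +
        (3 * ε ^ 2 * (smoothNorm ε z)⁻¹ ^ 5) • (h (z, smoothNorm ε z) -
          smoothNorm ε z • fderiv ℝ h (z, smoothNorm ε z) timeDir)) := by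
  have hd0 : Differentiable ℝ h := hh.differentiable (by simp)
  have hd1 := fun v => differentiable_fderiv_dir hh v
  have hcont1 : ∀ v, Continuous fun p => fderiv ℝ h p v := fun v => (hd1 v).continuous
  have hcont2 : ∀ v w, Continuous fun p => fderiv ℝ (fun q => fderiv ℝ h q v) p w := fun v w =>
    (contDiff_fderiv_dir (k := 0) (contDiff_fderiv_dir (k := 1) hh v) w).continuous
  have hs0 : ∀ z, smoothNorm ε z ≠ 0 := fun z => (smoothNorm_pos hε z).ne'
  have hl1 : ∀ v, ∀ p : Spacetime, R < p.2 → fderiv ℝ h p v = 0 := fun v p hp => by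
    rw [fderiv_eq_zero_of_late h0 p hp]; rfl
  have hl2 : ∀ v w, ∀ p : Spacetime, R < p.2 → fderiv ℝ (fun q => fderiv ℝ h q v) p w = 0 :=
    fun v w p hp => by rw [fderiv_eq_zero_of_late (hl1 v) p hp]; rfl
  let S : Space → Spacetime := fun z => (z, smoothNorm ε z)
  have hS : Continuous S := by fun_prop
  have hsi : Continuous fun z => (smoothNorm ε z)⁻¹ :=
    (continuous_smoothNorm_right ε).inv₀ hs0
  let e : Fin 3 → Spacetime := fun i => (spaceDir i, 0)
  -- A field on the hyperboloid whose divergence is box h / s, with s the smoothed norm, up to terms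
  -- carrying a factor ε².
  let X : Fin 3 → Space → ℂ := fun i z =>
    -((smoothNorm ε z)⁻¹ • fderiv ℝ h (S z) (e i)) +
      (z i * (smoothNorm ε z)⁻¹ ^ 2) • fderiv ℝ h (S z) timeDir -
      (z i * (smoothNorm ε z)⁻¹ ^ 3) • h (S z)
  let X' : Fin 3 → Space → ℂ := fun i z =>
    -((smoothNorm ε z)⁻¹ • dd (e i) h (S z)) +
      ((smoothNorm ε z)⁻¹ ^ 2 - 3 * z i ^ 2 * (smoothNorm ε z)⁻¹ ^ 4) • fderiv ℝ h (S z) timeDir +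
      (z i ^ 2 * (smoothNorm ε z)⁻¹ ^ 3) • dd timeDir h (S z) -
      ((smoothNorm ε z)⁻¹ ^ 3 - 3 * z i ^ 2 * (smoothNorm ε z)⁻¹ ^ 5) • h (S z)
  have hX : ∀ i z, HasLineDerivAt ℝ (X i) (X' i z) z (spaceDir i) := by
    intro i z
    have a1 := hasLineDerivAt_comp_smoothNorm hε (hd1 (e i)) 0 z i
    have a2 := hasLineDerivAt_comp_smoothNorm hε (hd1 timeDir) 0 z i
    have a3 := hasLineDerivAt_comp_smoothNorm hε hd0 0 z i
    simp only [add_zero] at a1 a2 a3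
    have b1 := hasDerivAt_inv_smoothNorm z i hε
    have b2 := hasDerivAt_coord_mul_inv_pow z i hε 2
    have b3 := hasDerivAt_coord_mul_inv_pow z i hε 3
    have := ((b1.smul a1).neg.add (b2.smul a2)).sub (b3.smul a3)
    refine HasDerivAt.congr_deriv this ?_
    simp only [X', zero_smul, add_zero, S, e, dd]
    -- The mixed derivatives ∂_i∂_t h and ∂_t∂_i h enter with opposite signs and cancel by symmetry.
    rw [fderiv_dir_symm hh _ timeDir (spaceDir i, 0)]
    have hs := hs0 z
    simp only [Complex.real_smul]
    push_cast
    have hsC : (smoothNorm ε z : ℂ) ≠ 0 := by exact_mod_cast hs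
    field_simp
    ring
  have hlS : ∀ z : Space, R < ‖z‖ → R < (S z).2 := fun z hz => hz.trans_le (norm_le_smoothNorm ε z)
  have hint : ∀ i, Integrable (X' i) ∧ ∫ z, X' i z = 0 := by
    intro i
    have hc0 := hh.continuous
    have hc1 := hcont1 (e i)
    have hc2 := hcont1 timeDir
    have hc3 := hcont2 (e i) (e i)
    have hc4 := hcont2 timeDir timeDir
    have hzi : Continuous fun z : Space => z i := by fun_prop
    refine integral_lineDeriv_eq_zero (R := R) (hX i) ?_ ?_ ?_ ?_
    · have e1 := hc0.comp hS
      have e2 := hc1.comp hS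
      have e3 := hc2.comp hS
      exact (((hsi.smul e2).neg.add ((hzi.mul (hsi.pow 2)).smul e3)).sub
        ((hzi.mul (hsi.pow 3)).smul e1))
    · have e1 := hc0.comp hS
      have e3 := hc2.comp hS
      have e4 := hc3.comp hS
      have e5 := hc4.comp hS
      exact ((((hsi.smul e4).neg.add (((hsi.pow 2).sub ((continuous_const.mul (hzi.pow 2)).mul
        (hsi.pow 4))).smul e3)).add (((hzi.pow 2).mul (hsi.pow 3)).smul e5)).sub
        (((hsi.pow 3).sub ((continuous_const.mul (hzi.pow 2)).mul (hsi.pow 5))).smul e1))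
    · intro z hz
      simp [X, hl1 _ _ (hlS z hz), h0 _ (hlS z hz)]
    · intro z hz
      simp [X', dd, hl2 _ _ _ (hlS z hz), hl1 _ _ (hlS z hz), h0 _ (hlS z hz)]
  -- The relation |z|² = s² - ε² is the only source of the error terms: on the exact cone they would
  -- be absent.
  have hbox : ∀ z, (smoothNorm ε z)⁻¹ • box h (S z) -
      ((ε ^ 2 * (smoothNorm ε z)⁻¹ ^ 3) • dd timeDir h (S z) +
        (3 * ε ^ 2 * (smoothNorm ε z)⁻¹ ^ 5) • (h (S z) -
          smoothNorm ε z • fderiv ℝ h (S z) timeDir)) = ∑ i, X' i z := by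
    intro z
    have hsC : (smoothNorm ε z : ℂ) ≠ 0 := by exact_mod_cast hs0 z
    have hrel := sum_sq_eq ε z
    simp only [X', box, Fin.sum_univ_three, Complex.real_smul, e]
    push_cast
    generalize dd timeDir h (S z) = htt
    generalize fderiv ℝ h (S z) timeDir = ht
    generalize h (S z) = hv
    linear_combination (norm := (field_simp; ring))
      (3 / (smoothNorm ε z : ℂ) ^ 4 * ht - 1 / (smoothNorm ε z : ℂ) ^ 3 * htt -
        3 / (smoothNorm ε z : ℂ) ^ 5 * hv) * hrel
  have hzero : ∫ z, ((smoothNorm ε z)⁻¹ • box h (S z) -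
      ((ε ^ 2 * (smoothNorm ε z)⁻¹ ^ 3) • dd timeDir h (S z) +
        (3 * ε ^ 2 * (smoothNorm ε z)⁻¹ ^ 5) • (h (S z) -
          smoothNorm ε z • fderiv ℝ h (S z) timeDir))) = 0 := by
    simp_rw [hbox]
    rw [integral_finsetSum _ fun i _ => (hint i).1]
    exact Finset.sum_eq_zero fun i _ => (hint i).2
  have hcb : Continuous (box h) := by
    unfold box dd
    exact (hcont2 _ _).sub (continuous_finsetSum _ fun i _ => hcont2 _ _)
  have hlb : ∀ p : Spacetime, R < p.2 → box h p = 0 := by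
    intro p hp
    simp [box, dd, hl2 _ _ p hp]
  have hct := hcont1 timeDir
  rw [integral_sub (integrable_smul_smoothNorm hcb hlb hsi) ?_] at hzero
  · exact sub_eq_zero.1 hzero
  · refine (integrable_smul_smoothNorm (hcont2 _ _) (hl2 _ _)
      (continuous_const.mul (hsi.pow 3))).add ?_
    have := integrable_smul_smoothNorm (ε := ε) (F := fun p : Spacetime =>
      h p - p.2 • fderiv ℝ h p timeDir) (R := R) (hh.continuous.sub (continuous_snd.smul hct))
      (fun p hp => by simp [h0 p hp, hl1 _ p hp]) (continuous_const.mul (hsi.pow 5) :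
        Continuous fun z => 3 * ε ^ 2 * (smoothNorm ε z)⁻¹ ^ 5)
    exact this

/-- An explicit primitive of the radial density 3y²(1+y²)^{-5/2}. It rises from 0 to 1, so the
corresponding density on ℝ³ has mass 4π. -/
theorem hasDerivAt_cube_div (y : ℝ) :
    HasDerivAt (fun y : ℝ => (y / Real.sqrt (y ^ 2 + 1 ^ 2)) ^ 3)
      (y ^ 2 * (3 * (Real.sqrt (y ^ 2 + 1 ^ 2))⁻¹ ^ 5)) y := by
  have hs : 0 < Real.sqrt (y ^ 2 + 1 ^ 2) := Real.sqrt_pos.2 (by positivity)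
  have hsq : Real.sqrt (y ^ 2 + 1 ^ 2) ^ 2 = y ^ 2 + 1 ^ 2 := Real.sq_sqrt (by positivity)
  have h1 : HasDerivAt (fun y : ℝ => y ^ 2 + 1 ^ 2) (2 * y) y := by
    simpa using (hasDerivAt_pow 2 y).add_const ((1 : ℝ) ^ 2)
  have h2 := h1.sqrt (by positivity)
  have h3 := ((hasDerivAt_id y).div h2 hs.ne').pow 3
  refine h3.congr_deriv ?_
  simp only [Pi.div_apply, id, Nat.cast_ofNat, Nat.add_one_sub_one]
  set s := Real.sqrt (y ^ 2 + 1 ^ 2)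
  field_simp
  rw [hsq]
  ring

theorem tendsto_cube_div :
    Tendsto (fun y : ℝ => (y / Real.sqrt (y ^ 2 + 1 ^ 2)) ^ 3) atTop (𝓝 1) := by
  have h1 : Tendsto (fun y : ℝ => 1 / Real.sqrt (1 + (y⁻¹) ^ 2)) atTop (𝓝 (1 / Real.sqrt (1 + 0 ^ 2))) := by
    refine Tendsto.div tendsto_const_nhds ?_ (by simp)
    exact (Real.continuous_sqrt.tendsto _).comp
      (tendsto_const_nhds.add (tendsto_inv_atTop_zero.pow 2))
  have h2 := h1.pow 3
  norm_num at h2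
  refine h2.congr' ?_
  filter_upwards [eventually_gt_atTop 0] with y hy
  have : Real.sqrt (y ^ 2 + 1 ^ 2) = y * Real.sqrt (1 + (y ^ 2)⁻¹) := by
    rw [show y ^ 2 + 1 ^ 2 = y ^ 2 * (1 + (y ^ 2)⁻¹) by field_simp, Real.sqrt_mul (by positivity),
      Real.sqrt_sq hy.le]
  rw [this, div_mul_eq_div_div, div_self hy.ne']
  simp

theorem integrable_smoothNorm_one :
    Integrable fun w : Space => 3 * (smoothNorm 1 w)⁻¹ ^ 5 := by
  refine integrable_norm_iff (f := fun y => 3 * (Real.sqrt (y ^ 2 + 1 ^ 2))⁻¹ ^ 5).2 ?_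
  exact integrableOn_Ioi_deriv_of_nonneg' (fun y _ => hasDerivAt_cube_div y)
    (fun y _ => by positivity) tendsto_cube_div

theorem integral_smoothNorm_one :
    ∫ w : Space, 3 * (smoothNorm 1 w)⁻¹ ^ 5 = 4 * Real.pi := by
  unfold smoothNorm
  rw [integral_norm (f := fun y => 3 * (Real.sqrt (y ^ 2 + 1 ^ 2))⁻¹ ^ 5),
    integral_Ioi_of_hasDerivAt_of_tendsto' (fun y _ => hasDerivAt_cube_div y)
      (integrableOn_Ioi_deriv_of_nonneg' (fun y _ => hasDerivAt_cube_div y)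
        (fun y _ => by positivity) tendsto_cube_div) tendsto_cube_div]
  simp

theorem smoothNorm_smul {ε : ℝ} (hε : 0 < ε) (w : Space) :
    smoothNorm ε (ε • w) = ε * smoothNorm 1 w := by
  unfold smoothNorm
  rw [norm_smul, Real.norm_of_nonneg hε.le, show (ε * ‖w‖) ^ 2 + ε ^ 2 =
    ε ^ 2 * (‖w‖ ^ 2 + 1 ^ 2) by ring, Real.sqrt_mul (by positivity), Real.sqrt_sq hε.le]

/-- Under z = εw the smoothed norm scales by ε, and the powers ε² · ε⁻⁵ · ε³ cancel. The weights
therefore form an approximate identity of mass 4π concentrating at the vertex. -/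
theorem tendsto_integral_approx_identity {F : Spacetime → ℂ} {R : ℝ} (hF : Continuous F)
    (h0 : ∀ p : Spacetime, R < p.2 → F p = 0) :
    Tendsto (fun ε => ∫ z, (3 * ε ^ 2 * (smoothNorm ε z)⁻¹ ^ 5) • F (z, smoothNorm ε z)) (𝓝[>] 0)
      (𝓝 ((4 * Real.pi) • F 0)) := by
  obtain ⟨B, hB0, hB⟩ := exists_bound_of_late hF h0
  have hscale : ∀ ε : ℝ, 0 < ε →
      ∫ z, (3 * ε ^ 2 * (smoothNorm ε z)⁻¹ ^ 5) • F (z, smoothNorm ε z) =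
        ∫ w, (3 * (smoothNorm 1 w)⁻¹ ^ 5) • F (ε • w, ε * smoothNorm 1 w) := by
    intro ε hε
    have h1 := Measure.integral_comp_smul (volume : Measure Space)
      (fun z => (3 * ε ^ 2 * (smoothNorm ε z)⁻¹ ^ 5) • F (z, smoothNorm ε z)) ε
    simp only [finrank_euclideanSpace, Fintype.card_fin] at h1
    rw [abs_of_pos (by positivity)] at h1
    have h2 : ∫ z, (3 * ε ^ 2 * (smoothNorm ε z)⁻¹ ^ 5) • F (z, smoothNorm ε z) =
        (ε ^ 3) • ∫ w, (3 * ε ^ 2 * (smoothNorm ε (ε • w))⁻¹ ^ 5) •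
          F (ε • w, smoothNorm ε (ε • w)) := by
      rw [h1, smul_smul, mul_inv_cancel₀ (by positivity), one_smul]
    rw [h2, ← integral_smul]
    refine integral_congr_ae (Eventually.of_forall fun w => ?_)
    simp only
    rw [smoothNorm_smul hε, smul_smul]
    congr 1
    have := smoothNorm_pos one_pos w
    field_simp
  have hlim : Tendsto (fun ε : ℝ => ∫ w, (3 * (smoothNorm 1 w)⁻¹ ^ 5) •
      F (ε • w, ε * smoothNorm 1 w)) (𝓝[>] 0) (𝓝 (∫ w, (3 * (smoothNorm 1 w)⁻¹ ^ 5) • F 0)) := by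
    have hsi : Continuous fun w => (smoothNorm 1 w)⁻¹ :=
      (continuous_smoothNorm_right 1).inv₀ fun w => (smoothNorm_pos one_pos w).ne'
    refine tendsto_integral_filter_of_dominated_convergence
      (fun w => (3 * (smoothNorm 1 w)⁻¹ ^ 5) * B) ?_ ?_ (integrable_smoothNorm_one.mul_const B) ?_
    · exact Eventually.of_forall fun ε => (by fun_prop : Continuous _).aestronglyMeasurable
    · filter_upwards [self_mem_nhdsWithin] with ε hε
      have hε' : 0 < ε := hε
      refine Eventually.of_forall fun w => ?_
      have hw := smoothNorm_pos one_pos w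
      rw [norm_smul, Real.norm_of_nonneg (by positivity)]
      refine mul_le_mul_of_nonneg_left (hB _ ?_) (by positivity)
      rw [norm_smul, Real.norm_of_nonneg hε'.le]
      exact mul_le_mul_of_nonneg_left (norm_le_smoothNorm 1 w) hε'.le
    · refine Eventually.of_forall fun w => Tendsto.const_smul ?_ _
      have hc : Continuous fun ε : ℝ => F (ε • w, ε * smoothNorm 1 w) := by fun_prop
      have h1 : Tendsto (fun ε : ℝ => F (ε • w, ε * smoothNorm 1 w)) (𝓝 0) (𝓝 (F 0)) := by
        have h2 := hc.tendsto 0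
        simp only [zero_smul, zero_mul] at h2
        exact h2
      exact tendsto_nhdsWithin_of_tendsto_nhds h1
  rw [integral_smul_const, integral_smoothNorm_one] at hlim
  refine hlim.congr' ?_
  filter_upwards [self_mem_nhdsWithin] with ε hε
  exact (hscale ε hε).symm

theorem inv_smoothNorm_mul_norm_le {ε : ℝ} (hε : 0 < ε) (z : Space) :
    (smoothNorm ε z)⁻¹ * ‖z‖ ≤ 1 := by
  rw [inv_mul_le_iff₀ (smoothNorm_pos hε z), mul_one]
  exact norm_le_smoothNorm ε z

theorem continuous_inv_smoothNorm {ε : ℝ} (hε : 0 < ε) :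
    Continuous fun z => (smoothNorm ε z)⁻¹ :=
  (continuous_smoothNorm_right ε).inv₀ fun z => (smoothNorm_pos hε z).ne'

/-- `δ(t - |x|) / (4π|x|)` is a fundamental solution of the wave operator. -/
theorem integral_box_cone {h : Spacetime → ℂ} (hh : ContDiff ℝ 2 h)
    {R : ℝ} (h0 : ∀ p : Spacetime, R < p.2 → h p = 0) :
    ∫ z : Space, (4 * Real.pi * ‖z‖)⁻¹ • box h (z, ‖z‖) = h 0 := by
  have hd1 := fun v => differentiable_fderiv_dir hh v
  have hcont2 : ∀ v w, Continuous fun p => fderiv ℝ (fun q => fderiv ℝ h q v) p w := fun v w =>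
    (contDiff_fderiv_dir (k := 0) (contDiff_fderiv_dir (k := 1) hh v) w).continuous
  have hl1 : ∀ v, ∀ p : Spacetime, R < p.2 → fderiv ℝ h p v = 0 := fun v p hp => by
    rw [fderiv_eq_zero_of_late h0 p hp]; rfl
  have hl2 : ∀ v w, ∀ p : Spacetime, R < p.2 → fderiv ℝ (fun q => fderiv ℝ h q v) p w = 0 :=
    fun v w p hp => by rw [fderiv_eq_zero_of_late (hl1 v) p hp]; rfl
  have hcb : Continuous (box h) := by
    unfold box dd
    exact (hcont2 _ _).sub (continuous_finsetSum _ fun i _ => hcont2 _ _)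
  have hlb : ∀ p : Spacetime, R < p.2 → box h p = 0 := by
    intro p hp
    simp [box, dd, hl2 _ _ p hp]
  have hlim1 := tendsto_integral_smoothNorm (C := 1) hcb hlb
    (m := fun ε z => (smoothNorm ε z)⁻¹) (m₀ := fun z => ‖z‖⁻¹)
    (fun ε hε => continuous_inv_smoothNorm hε)
    (fun ε hε z => by
      rw [abs_of_pos (inv_pos.2 (smoothNorm_pos hε z))]
      linarith [inv_smoothNorm_mul_norm_le hε z, norm_nonneg z])
    (fun z hz => (tendsto_smoothNorm z).inv₀ (norm_ne_zero_iff.2 hz))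
  -- The weight ε²/s³ is at most 1/s and tends to zero off the vertex, so the ∂_t²h error
  -- disappears.
  have hlim2 := tendsto_integral_smoothNorm (C := 1) (hcont2 timeDir timeDir) (hl2 _ _)
    (m := fun ε z => ε ^ 2 * (smoothNorm ε z)⁻¹ ^ 3) (m₀ := fun z => 0)
    (fun ε hε => continuous_const.mul ((continuous_inv_smoothNorm hε).pow 3))
    (fun ε hε z => by
      have hs := smoothNorm_pos hε z
      rw [abs_of_pos (by positivity)]
      have h1 : ε ^ 2 * (smoothNorm ε z)⁻¹ ^ 2 ≤ 1 := by
        rw [inv_pow, mul_inv_le_iff₀ (by positivity), one_mul]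
        exact pow_le_pow_left₀ hε.le (le_smoothNorm ε z) 2
      have h2 := inv_smoothNorm_mul_norm_le hε z
      have h3 : ε ^ 2 * (smoothNorm ε z)⁻¹ ^ 3 * ‖z‖ =
        (ε ^ 2 * (smoothNorm ε z)⁻¹ ^ 2) * ((smoothNorm ε z)⁻¹ * ‖z‖) := by ring
      rw [h3]
      have := mul_le_mul h1 h2 (by positivity) zero_le_one
      linarith [norm_nonneg z])
    (fun z hz => by
      have h1 : Tendsto (fun ε : ℝ => ε ^ 2) (𝓝[>] 0) (𝓝 (0 ^ 2)) :=
        tendsto_nhdsWithin_of_tendsto_nhds ((continuous_pow 2).tendsto 0)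
      have := h1.mul (((tendsto_smoothNorm z).inv₀ (norm_ne_zero_iff.2 hz)).pow 3)
      simpa using this)
  -- The other error is an approximate identity acting on h - t ∂_t h, whose value at the vertex is
  -- h(0). It produces 4π h(0).
  have hck : Continuous fun p : Spacetime => h p - p.2 • fderiv ℝ h p timeDir :=
    hh.continuous.sub (continuous_snd.smul (hd1 timeDir).continuous)
  have hlk : ∀ p : Spacetime, R < p.2 → h p - p.2 • fderiv ℝ h p timeDir = 0 := fun p hp => by
    simp [h0 p hp, hl1 _ p hp]
  have hlim3 := tendsto_integral_approx_identity hck hlk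
  have hlim4 := hlim2.add hlim3
  have huniq := tendsto_nhds_unique hlim1 (hlim4.congr' ?_)
  · simp_rw [mul_inv, mul_smul]
    rw [integral_smul, integral_smul, huniq]
    simp
    field_simp
  · filter_upwards [self_mem_nhdsWithin] with ε hε
    have hsi := continuous_inv_smoothNorm (hε : 0 < ε)
    rw [integral_box_smoothNorm hε hh h0]
    exact (integral_add (integrable_smul_smoothNorm (hcont2 _ _) (hl2 _ _)
      (continuous_const.mul (hsi.pow 3))) (integrable_smul_smoothNorm hck hlk
      (continuous_const.mul (hsi.pow 5) :
        Continuous fun z => 3 * ε ^ 2 * (smoothNorm ε z)⁻¹ ^ 5))).symm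

/-! ### Integration by parts and Green's identity inside the light cone -/

theorem measurable_heaviside : Measurable heaviside :=
  Measurable.ite measurableSet_Ioi measurable_const measurable_const

theorem norm_heaviside_le (s : ℝ) : ‖heaviside s‖ ≤ 1 := by
  unfold heaviside
  split_ifs <;> simp

theorem heaviside_smul_eq_indicator {E : Type} [NormedAddCommGroup E] [NormedSpace ℝ E] (c : ℝ)
    (f : ℝ → E) : (fun t => heaviside (t - c) • f t) = (Ioi c).indicator f := by
  ext t
  by_cases h : c < t
  · simp [heaviside, h]
  · simp [heaviside, h]

theorem integrable_heaviside_smul {X : Type} [MeasurableSpace X] {μ : Measure X} {E : Type}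
    [NormedAddCommGroup E] [NormedSpace ℝ E] {f : X → E} (hf : Integrable f μ) {c : X → ℝ}
    (hc : Measurable c) : Integrable (fun p => heaviside (c p) • f p) μ := by
  refine hf.mono (((measurable_heaviside.comp hc).aestronglyMeasurable).smul hf.1)
    (Eventually.of_forall fun p => ?_)
  rw [norm_smul]
  exact mul_le_of_le_one_left (norm_nonneg _) (norm_heaviside_le _)

theorem exists_late_of_hasCompactSupport {F : Spacetime → ℂ} (hF : HasCompactSupport F) :
    ∃ R, ∀ p : Spacetime, R < p.2 → F p = 0 := by
  obtain ⟨R, hR⟩ := hF.isCompact.isBounded.subset_closedBall 0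
  refine ⟨R, fun p hp => ?_⟩
  by_contra hc
  have h1 := hR (subset_tsupport F hc)
  rw [mem_closedBall_zero_iff] at h1
  have h2 := norm_snd_le p
  rw [Real.norm_eq_abs] at h2
  linarith [le_abs_self p.2]

/-- The shear `(z, u) ↦ (z, √(|z|² + ε²) + u)`. -/
def shear (ε : ℝ) : Spacetime ≃ₜ Spacetime where
  toFun p := (p.1, smoothNorm ε p.1 + p.2)
  invFun p := (p.1, p.2 - smoothNorm ε p.1)
  left_inv p := by simp
  right_inv p := by simp
  continuous_toFun := by fun_prop
  continuous_invFun := by fun_prop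

theorem hasCompactSupport_slice {F : Spacetime → ℂ} (hF : HasCompactSupport F) (z : Space) :
    HasCompactSupport fun t => F (z, t) := by
  obtain ⟨R, hR⟩ := hF.isCompact.isBounded.subset_closedBall 0
  refine HasCompactSupport.intro (isCompact_closedBall (0 : ℝ) R) fun t ht => ?_
  by_contra hc
  have h1 := hR (subset_tsupport F hc)
  rw [mem_closedBall_zero_iff] at h1 ht
  exact ht ((norm_snd_le ((z, t) : Spacetime)).trans h1)

/-- Only integration in t is involved, so smoothness of the boundary plays no role and ε = 0, the
cone itself, is included. -/
theorem integral_heaviside_mul_fderiv_time {ε : ℝ} {F : Spacetime → ℂ} (hF : ContDiff ℝ 1 F)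
    (hc : HasCompactSupport F) :
    ∫ p : Spacetime, heaviside (p.2 - smoothNorm ε p.1) • fderiv ℝ F p timeDir =
      -∫ z, F (z, smoothNorm ε z) := by
  have hcont : Continuous fun p => fderiv ℝ F p timeDir :=
    (contDiff_fderiv_dir (k := 0) hF timeDir).continuous
  have hint : Integrable (fun p => fderiv ℝ F p timeDir) :=
    hcont.integrable_of_hasCompactSupport (hc.fderiv_apply ℝ timeDir)
  rw [Measure.volume_eq_prod, integral_prod _ (integrable_heaviside_smul hint
    (by fun_prop : Measurable fun p : Spacetime => p.2 - smoothNorm ε p.1)), ← integral_neg]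
  refine integral_congr_ae (Eventually.of_forall fun z => ?_)
  simp only
  rw [heaviside_smul_eq_indicator (smoothNorm ε z) (fun t => fderiv ℝ F (z, t) timeDir),
    integral_indicator measurableSet_Ioi]
  have hd : ∀ t, HasDerivAt (fun t => F (z, t)) (fderiv ℝ F (z, t) timeDir) t := fun t =>
    ((hF.differentiable (by simp)) (z, t)).hasFDerivAt.comp_hasDerivAt t
      ((hasDerivAt_const t z).prodMk (hasDerivAt_id t))
  have h1 : ContDiff ℝ 1 fun t => F (z, t) := hF.comp (by fun_prop)
  have h2 := hasCompactSupport_slice hc z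
  have := h2.integral_Ioi_deriv_eq h1 (smoothNorm ε z)
  rw [← this]
  refine setIntegral_congr_fun measurableSet_Ioi fun t _ => ?_
  exact (hd t).deriv.symm

/-- In the sheared coordinate u = t - s the region is u > 0. On each slice the total derivative in
direction i integrates to zero, which trades ∂_iF for -(z_i/s)∂_tF. Integrating the latter over u >
0 leaves the boundary term. -/
theorem integral_heaviside_mul_fderiv_space {ε : ℝ} (hε : 0 < ε) {F : Spacetime → ℂ}
    (hF : ContDiff ℝ 1 F) (hc : HasCompactSupport F) (i : Fin 3) :
    ∫ p : Spacetime, heaviside (p.2 - smoothNorm ε p.1) • fderiv ℝ F p (spaceDir i, 0) =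
      ∫ z : Space, (z i * (smoothNorm ε z)⁻¹) • F (z, smoothNorm ε z) := by
  have hcont : ∀ v, Continuous fun p => fderiv ℝ F p v := fun v =>
    (contDiff_fderiv_dir (k := 0) hF v).continuous
  have hcs : ∀ v, HasCompactSupport fun p => fderiv ℝ F p v := fun v => hc.fderiv_apply ℝ v
  have hd : Differentiable ℝ F := hF.differentiable (by simp)
  have hsi := continuous_inv_smoothNorm hε
  have hzi : Continuous fun z : Space => z i := by fun_prop
  have hshear : ∀ v, Integrable (fun p : Spacetime =>
      fderiv ℝ F (p.1, smoothNorm ε p.1 + p.2) v) (volume.prod volume) := fun v =>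
    ((hcont v).comp (shear ε).continuous).integrable_of_hasCompactSupport
      ((hcs v).comp_homeomorph (shear ε))
  have hmul : Integrable (fun p : Spacetime => (p.1 i * (smoothNorm ε p.1)⁻¹) •
      fderiv ℝ F (p.1, smoothNorm ε p.1 + p.2) timeDir) (volume.prod volume) := by
    have e1 := (hcont timeDir).comp (shear ε).continuous
    have e2 : Continuous fun p : Spacetime => p.1 i * (smoothNorm ε p.1)⁻¹ :=
      (hzi.comp continuous_fst).mul (hsi.comp continuous_fst)
    exact (e2.smul e1).integrable_of_hasCompactSupport
      (((hcs timeDir).comp_homeomorph (shear ε)).smul_left)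
  have deriv_eq : ∫ p : Spacetime, heaviside (p.2 - smoothNorm ε p.1) • fderiv ℝ F p (spaceDir i, 0) =
      ∫ z : Space, ∫ u : ℝ, heaviside u • fderiv ℝ F (z, smoothNorm ε z + u) (spaceDir i, 0) := by
    rw [Measure.volume_eq_prod, integral_prod _ (integrable_heaviside_smul
      ((hcont _).integrable_of_hasCompactSupport (hcs _))
      (by fun_prop : Measurable fun p : Spacetime => p.2 - smoothNorm ε p.1))]
    refine integral_congr_ae (Eventually.of_forall fun z => ?_)
    simp only
    rw [← integral_add_left_eq_self (fun t => heaviside (t - smoothNorm ε z) •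
      fderiv ℝ F (z, t) (spaceDir i, 0)) (smoothNorm ε z)]
    simp
  have slice_eq : ∀ u : ℝ, ∫ z : Space, heaviside u •
      fderiv ℝ F (z, smoothNorm ε z + u) (spaceDir i, 0) =
      -∫ z : Space, heaviside u • ((z i * (smoothNorm ε z)⁻¹) •
        fderiv ℝ F (z, smoothNorm ε z + u) timeDir) := by
    intro u
    rw [integral_smul, integral_smul, ← smul_neg]
    congr 1
    obtain ⟨R, hR⟩ := hc.isCompact.isBounded.subset_closedBall 0
    have hout : ∀ (z : Space) (t : ℝ), R < ‖z‖ → ((z, t) : Spacetime) ∉ tsupport F := by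
      intro z t hp hc
      have := hR hc
      rw [mem_closedBall_zero_iff] at this
      exact absurd ((norm_fst_le ((z, t) : Spacetime)).trans this) (not_le.2 hp)
    have hslice : Continuous fun z : Space => ((z, smoothNorm ε z + u) : Spacetime) := by fun_prop
    have hc1 := (hcont (spaceDir i, 0)).comp hslice
    have hc2 := (hcont timeDir).comp hslice
    have hzero : ∀ v, ∀ z : Space, R < ‖z‖ → fderiv ℝ F (z, smoothNorm ε z + u) v = 0 := by
      intro v z hz
      have : (z, smoothNorm ε z + u) ∉ tsupport (fderiv ℝ F) :=
        fun h => hout z _ hz (tsupport_fderiv_subset ℝ h)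
      rw [image_eq_zero_of_notMem_tsupport this]
      rfl
    have hzero' : ∀ z : Space, R < ‖z‖ → F (z, smoothNorm ε z + u) = 0 := fun z hz => 
      image_eq_zero_of_notMem_tsupport (hout z (smoothNorm ε z + u) hz)
    have key := integral_lineDeriv_eq_zero (R := R)
      (fun z => hasLineDerivAt_comp_smoothNorm hε hd u z i)
      (hF.continuous.comp hslice) (hc1.add ((hzi.div (continuous_smoothNorm_right ε)
        fun z => (smoothNorm_pos hε z).ne').smul hc2))
      hzero'
      (fun z hz => by simp [hzero _ z hz])
    have hi1 : Integrable fun z : Space => fderiv ℝ F (z, smoothNorm ε z + u) (spaceDir i, 0) :=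
      hc1.integrable_of_hasCompactSupport (HasCompactSupport.intro (isCompact_closedBall 0 R)
        fun z hz => hzero _ z (by simpa using hz))
    have hi2 : Integrable fun z : Space => (z i * (smoothNorm ε z)⁻¹) •
        fderiv ℝ F (z, smoothNorm ε z + u) timeDir :=
      ((hzi.mul hsi).smul hc2).integrable_of_hasCompactSupport (HasCompactSupport.intro
        (isCompact_closedBall 0 R) fun z hz => by
          have := hzero timeDir z (by simpa using hz)
          simp [this])
    have h2 := key.2
    simp_rw [div_eq_mul_inv] at h2
    rw [integral_add hi1 hi2] at h2
    exact eq_neg_of_add_eq_zero_left h2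
  rw [deriv_eq, integral_integral_swap (f := fun (z : Space) (u : ℝ) =>
    heaviside u • fderiv ℝ F (z, smoothNorm ε z + u) (spaceDir i, 0))
    (integrable_heaviside_smul (hshear _) measurable_snd)]
  simp_rw [slice_eq]
  rw [integral_neg, ← integral_integral_swap (f := fun (z : Space) (u : ℝ) =>
    heaviside u • ((z i * (smoothNorm ε z)⁻¹) • fderiv ℝ F (z, smoothNorm ε z + u) timeDir))
    (integrable_heaviside_smul hmul measurable_snd), ← integral_neg]
  refine integral_congr_ae (Eventually.of_forall fun z => ?_)
  simp only
  simp_rw [smul_comm (heaviside _)]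
  rw [integral_smul, ← smul_neg]
  congr 1
  have h1 : ContDiff ℝ 1 fun t => F (z, smoothNorm ε z + t) := hF.comp (by fun_prop)
  have h2 : HasCompactSupport fun t => F (z, smoothNorm ε z + t) := by
    exact (hasCompactSupport_slice hc z).comp_homeomorph (Homeomorph.addLeft (smoothNorm ε z))
  have h3 := h2.integral_Ioi_deriv_eq h1 0
  have h4 := heaviside_smul_eq_indicator 0
    (fun t => fderiv ℝ F (z, smoothNorm ε z + t) timeDir)
  simp only [sub_zero] at h4
  rw [h4, integral_indicator measurableSet_Ioi]
  rw [add_zero] at h3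
  rw [← neg_eq_iff_eq_neg.2 h3]
  refine congrArg Neg.neg ?_
  refine setIntegral_congr_fun measurableSet_Ioi fun t _ => ?_
  have : HasDerivAt (fun t => F (z, smoothNorm ε z + t))
      (fderiv ℝ F (z, smoothNorm ε z + t) timeDir) t :=
    (hd (z, smoothNorm ε z + t)).hasFDerivAt.comp_hasDerivAt t
      ((hasDerivAt_const t z).prodMk ((hasDerivAt_id t).const_add _))
  exact this.deriv.symm

/-- Since s ≥ |z| and `heaviside` vanishes at 0, the indicators converge at every point, even on the
cone: where the limit is 0 they are already 0. -/
theorem tendsto_integral_heaviside {G : Spacetime → ℂ} (hG : Integrable G) :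
    Tendsto (fun ε => ∫ p : Spacetime, heaviside (p.2 - smoothNorm ε p.1) • G p) (𝓝[>] 0)
      (𝓝 (∫ p : Spacetime, heaviside (p.2 - ‖p.1‖) • G p)) := by
  refine tendsto_integral_filter_of_dominated_convergence (fun p => ‖G p‖) ?_ ?_ hG.norm ?_
  · exact Eventually.of_forall fun ε => (integrable_heaviside_smul hG (by fun_prop)).1
  · refine Eventually.of_forall fun ε => Eventually.of_forall fun p => ?_
    rw [norm_smul]
    exact mul_le_of_le_one_left (norm_nonneg _) (norm_heaviside_le _)
  · refine Eventually.of_forall fun p => Tendsto.smul_const ?_ _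
    refine tendsto_const_nhds.congr' ?_
    by_cases h : ‖p.1‖ < p.2
    · filter_upwards [(tendsto_smoothNorm p.1).eventually (gt_mem_nhds h)] with ε hε
      simp [heaviside, h, hε]
    · refine Eventually.of_forall fun ε => ?_
      have : ¬ smoothNorm ε p.1 < p.2 := fun hc => h ((norm_le_smoothNorm ε p.1).trans_lt hc)
      simp [heaviside, h, this]

theorem integral_heaviside_cone_time {F : Spacetime → ℂ} (hF : ContDiff ℝ 1 F)
    (hc : HasCompactSupport F) :
    ∫ p : Spacetime, heaviside (p.2 - ‖p.1‖) • fderiv ℝ F p timeDir = -∫ z : Space, F (z, ‖z‖) := by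
  have := integral_heaviside_mul_fderiv_time (ε := 0) hF hc
  simpa only [smoothNorm_zero] using this

theorem integral_heaviside_cone_space {F : Spacetime → ℂ} (hF : ContDiff ℝ 1 F)
    (hc : HasCompactSupport F) (i : Fin 3) :
    ∫ p : Spacetime, heaviside (p.2 - ‖p.1‖) • fderiv ℝ F p (spaceDir i, 0) =
      ∫ z : Space, (z i * ‖z‖⁻¹) • F (z, ‖z‖) := by
  have hcont : Continuous fun p => fderiv ℝ F p (spaceDir i, 0) :=
    (contDiff_fderiv_dir (k := 0) hF _).continuous
  have h1 := tendsto_integral_heaviside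
    (hcont.integrable_of_hasCompactSupport (hc.fderiv_apply ℝ (spaceDir i, 0)))
  obtain ⟨R, hR⟩ := exists_late_of_hasCompactSupport hc
  have h2 := tendsto_integral_smoothNorm (C := 1) hF.continuous hR
    (m := fun ε z => z i * (smoothNorm ε z)⁻¹) (m₀ := fun z => z i * ‖z‖⁻¹)
    (fun ε hε => (by fun_prop : Continuous fun z : Space => z i).mul (continuous_inv_smoothNorm hε))
    (fun ε hε z => by
      have hs := smoothNorm_pos hε z
      rw [abs_mul, abs_of_pos (inv_pos.2 hs), one_mul]
      have h3 : |z i| * (smoothNorm ε z)⁻¹ ≤ 1 := by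
        rw [mul_inv_le_iff₀ hs, one_mul]
        exact (abs_apply_le_norm z i).trans (norm_le_smoothNorm ε z)
      nlinarith [norm_nonneg z])
    (fun z hz => ((tendsto_smoothNorm z).inv₀ (norm_ne_zero_iff.2 hz)).const_mul _)
  refine tendsto_nhds_unique h1 (h2.congr' ?_)
  filter_upwards [self_mem_nhdsWithin] with ε hε
  exact (integral_heaviside_mul_fderiv_space hε hF hc i).symm

theorem integrable_cone {F : Spacetime → ℂ} {R C : ℝ} (hF : Continuous F)
    (h0 : ∀ p : Spacetime, R < p.2 → F p = 0) {m : Space → ℝ} (hm : Measurable m)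
    (hC : ∀ z, |m z| * ‖z‖ ≤ C * (1 + ‖z‖)) : Integrable fun z => m z • F (z, ‖z‖) := by
  obtain ⟨B, hB0, hB⟩ := exists_bound_of_late hF h0
  have hC0 : 0 ≤ C := by
    have := hC 0
    simpa using this
  refine ((integrable_ker one_pos).const_mul
    (B * C * (1 + |R|) * (4 * Real.pi) * Real.exp |R|)).mono'
    (hm.aestronglyMeasurable.smul (by fun_prop : Continuous _).aestronglyMeasurable) ?_
  filter_upwards [Measure.ae_ne volume (0 : Space)] with z hz
  have hz' : 0 < ‖z‖ := norm_pos_iff.2 hz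
  have hk := ker_nonneg 1 z
  by_cases h : R < ‖z‖
  · rw [h0 _ h]
    simp only [smul_zero, norm_zero]
    positivity
  · have hzR : ‖z‖ ≤ |R| := (not_lt.1 h).trans (le_abs_self R)
    rw [norm_smul, Real.norm_eq_abs]
    have h1 : |m z| ≤ C * (1 + |R|) / ‖z‖ := by
      rw [le_div_iff₀ hz']
      exact (hC z).trans (by gcongr)
    have h2 : 1 / ‖z‖ ≤ 4 * Real.pi * Real.exp |R| * ker 1 z := by
      unfold ker
      rw [one_mul, Real.exp_neg]
      have : Real.exp ‖z‖ ≤ Real.exp |R| := Real.exp_le_exp.2 hzR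
      have h3 := Real.exp_pos ‖z‖
      rw [div_le_iff₀ hz']
      field_simp
      exact this
    calc |m z| * ‖F (z, ‖z‖)‖ ≤ (C * (1 + |R|) / ‖z‖) * B :=
          mul_le_mul h1 (hB _ le_rfl) (norm_nonneg _) (by positivity)
      _ = B * C * (1 + |R|) * (1 / ‖z‖) := by ring
      _ ≤ B * C * (1 + |R|) * (4 * Real.pi * Real.exp |R| * ker 1 z) := by gcongr
      _ = _ := by ring

theorem abs_coord_div_norm_le (z : Space) (i : Fin 3) : |z i * ‖z‖⁻¹| * ‖z‖ ≤ 1 * (1 + ‖z‖) := by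
  have h1 : |z i * ‖z‖⁻¹| ≤ 1 := by
    rw [abs_mul, abs_inv, abs_norm, ← div_eq_mul_inv]
    exact div_le_one_of_le₀ (abs_apply_le_norm z i) (norm_nonneg _)
  nlinarith [norm_nonneg z]

theorem abs_inv_norm_le (z : Space) : |‖z‖⁻¹| * ‖z‖ ≤ 1 * (1 + ‖z‖) := by
  rw [abs_inv, abs_norm]
  by_cases h : ‖z‖ = 0
  · simp [h]
  · rw [inv_mul_cancel₀ h]
    linarith [norm_nonneg z]

theorem measurable_coord_div_norm (i : Fin 3) : Measurable fun z : Space => z i * ‖z‖⁻¹ :=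
  (by fun_prop : Continuous fun z : Space => z i).measurable.mul measurable_norm.inv

/-- The integral of the divergence of the vector field `z ↦ (z / |z|) Φ(z, |z|)` vanishes. -/
theorem integral_radial_div {F : Spacetime → ℂ} (hF : ContDiff ℝ 1 F) {R : ℝ}
    (h0 : ∀ p : Spacetime, R < p.2 → F p = 0) :
    (∫ z : Space, fderiv ℝ F (z, ‖z‖) timeDir) +
      (∑ i, ∫ z : Space, (z i * ‖z‖⁻¹) • fderiv ℝ F (z, ‖z‖) (spaceDir i, 0)) +
      ∫ z : Space, ‖z‖⁻¹ • (2 * F (z, ‖z‖)) = 0 := by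
  have hd : Differentiable ℝ F := hF.differentiable (by simp)
  have hcont : ∀ v, Continuous fun p => fderiv ℝ F p v := fun v =>
    (contDiff_fderiv_dir (k := 0) hF v).continuous
  have hl1 : ∀ v, ∀ p : Spacetime, R < p.2 → fderiv ℝ F p v = 0 := fun v p hp => by
    rw [fderiv_eq_zero_of_late h0 p hp]; rfl
  have hzi : ∀ i, Continuous fun z : Space => z i := fun i => by fun_prop
  have hlim1 := tendsto_integral_smoothNorm (C := 1) (hcont timeDir) (hl1 timeDir)
    (m := fun ε z => 1 - ε ^ 2 * (smoothNorm ε z)⁻¹ ^ 2) (m₀ := fun z => 1)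
    (fun ε hε => continuous_const.sub
      (continuous_const.mul ((continuous_inv_smoothNorm hε).pow 2)))
    (fun ε hε z => by
      have hs := smoothNorm_pos hε z
      have h1 : ε ^ 2 * (smoothNorm ε z)⁻¹ ^ 2 ≤ 1 := by
        rw [inv_pow, mul_inv_le_iff₀ (by positivity), one_mul]
        exact pow_le_pow_left₀ hε.le (le_smoothNorm ε z) 2
      have h2 : 0 ≤ ε ^ 2 * (smoothNorm ε z)⁻¹ ^ 2 := by positivity
      rw [abs_of_nonneg (by linarith)]
      nlinarith [norm_nonneg z])
    (fun z hz => by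
      have h1 : Tendsto (fun ε : ℝ => ε ^ 2) (𝓝[>] 0) (𝓝 (0 ^ 2)) :=
        tendsto_nhdsWithin_of_tendsto_nhds ((continuous_pow 2).tendsto 0)
      have := (h1.mul (((tendsto_smoothNorm z).inv₀ (norm_ne_zero_iff.2 hz)).pow 2)).const_sub 1
      simpa using this)
  have hlim2 := fun i : Fin 3 => tendsto_integral_smoothNorm (C := 1) (hcont (spaceDir i, 0))
    (hl1 (spaceDir i, 0))
    (m := fun ε z => z i * (smoothNorm ε z)⁻¹) (m₀ := fun z => z i * ‖z‖⁻¹)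
    (fun ε hε => (hzi i).mul (continuous_inv_smoothNorm hε))
    (fun ε hε z => by
      have hs := smoothNorm_pos hε z
      rw [abs_mul, abs_of_pos (inv_pos.2 hs), one_mul]
      have h3 : |z i| * (smoothNorm ε z)⁻¹ ≤ 1 := by
        rw [mul_inv_le_iff₀ hs, one_mul]
        exact (abs_apply_le_norm z i).trans (norm_le_smoothNorm ε z)
      nlinarith [norm_nonneg z])
    (fun z hz => ((tendsto_smoothNorm z).inv₀ (norm_ne_zero_iff.2 hz)).const_mul _)
  have hlim3 := tendsto_integral_smoothNorm (C := 3) hF.continuous h0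
    (m := fun ε z => 2 * (smoothNorm ε z)⁻¹ + ε ^ 2 * (smoothNorm ε z)⁻¹ ^ 3)
    (m₀ := fun z => 2 * ‖z‖⁻¹)
    (fun ε hε => (continuous_const.mul (continuous_inv_smoothNorm hε)).add
      (continuous_const.mul ((continuous_inv_smoothNorm hε).pow 3)))
    (fun ε hε z => by
      have hs := smoothNorm_pos hε z
      rw [abs_of_pos (by positivity)]
      have h1 : ε ^ 2 * (smoothNorm ε z)⁻¹ ^ 2 ≤ 1 := by
        rw [inv_pow, mul_inv_le_iff₀ (by positivity), one_mul]
        exact pow_le_pow_left₀ hε.le (le_smoothNorm ε z) 2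
      have h2 := inv_smoothNorm_mul_norm_le hε z
      have h3 : (2 * (smoothNorm ε z)⁻¹ + ε ^ 2 * (smoothNorm ε z)⁻¹ ^ 3) * ‖z‖ =
        2 * ((smoothNorm ε z)⁻¹ * ‖z‖) +
          (ε ^ 2 * (smoothNorm ε z)⁻¹ ^ 2) * ((smoothNorm ε z)⁻¹ * ‖z‖) := by ring
      rw [h3]
      have := mul_le_mul h1 h2 (by positivity) zero_le_one
      linarith [norm_nonneg z])
    (fun z hz => by
      have h1 : Tendsto (fun ε : ℝ => ε ^ 2) (𝓝[>] 0) (𝓝 (0 ^ 2)) :=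
        tendsto_nhdsWithin_of_tendsto_nhds ((continuous_pow 2).tendsto 0)
      have h2 := (tendsto_smoothNorm z).inv₀ (norm_ne_zero_iff.2 hz)
      have := (h2.const_mul 2).add (h1.mul (h2.pow 3))
      simpa using this)
  have hlim := (hlim1.add (tendsto_finsetSum Finset.univ fun i _ => hlim2 i)).add hlim3
  have hzero : ∀ ε, 0 < ε →
      (∫ z, (1 - ε ^ 2 * (smoothNorm ε z)⁻¹ ^ 2) • fderiv ℝ F (z, smoothNorm ε z) timeDir) +
      (∑ i, ∫ z : Space, (z i * (smoothNorm ε z)⁻¹) •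
        fderiv ℝ F (z, smoothNorm ε z) (spaceDir i, 0)) +
      ∫ z, (2 * (smoothNorm ε z)⁻¹ + ε ^ 2 * (smoothNorm ε z)⁻¹ ^ 3) • F (z, smoothNorm ε z)
        = 0 := by
    intro ε hε
    have hsi := continuous_inv_smoothNorm hε
    have hs0 : ∀ z, smoothNorm ε z ≠ 0 := fun z => (smoothNorm_pos hε z).ne'
    let S : Space → Spacetime := fun z => (z, smoothNorm ε z)
    have hS : Continuous S := by fun_prop
    -- The summands of the divergence of the smoothed radial field z ↦ (z/s) F(z, s).
    let X' : Fin 3 → Space → ℂ := fun i z =>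
      (z i * (smoothNorm ε z)⁻¹) • fderiv ℝ F (S z) (spaceDir i, 0) +
      (z i ^ 2 * (smoothNorm ε z)⁻¹ ^ 2) • fderiv ℝ F (S z) timeDir +
      ((smoothNorm ε z)⁻¹ - z i ^ 2 * (smoothNorm ε z)⁻¹ ^ 3) • F (S z)
    have hX : ∀ i z, HasLineDerivAt ℝ (fun z => (z i * (smoothNorm ε z)⁻¹) • F (S z)) (X' i z) z
        (spaceDir i) := by
      intro i z
      have a3 := hasLineDerivAt_comp_smoothNorm hε hd 0 z i
      simp only [add_zero] at a3
      have b2 := hasDerivAt_coord_mul_inv_pow z i hε 1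
      simp only [pow_one] at b2
      refine HasDerivAt.congr_deriv (b2.smul a3) ?_
      simp only [X', zero_smul, add_zero, S]
      have hsC : (smoothNorm ε z : ℂ) ≠ 0 := by exact_mod_cast hs0 z
      simp only [Complex.real_smul]
      push_cast
      field_simp
    have hlS : ∀ z : Space, R < ‖z‖ → R < (S z).2 :=
      fun z hz => hz.trans_le (norm_le_smoothNorm ε z)
    have e1 := hF.continuous.comp hS
    have hint : ∀ i, Integrable (X' i) ∧ ∫ z, X' i z = 0 := by
      intro i
      have e2 := (hcont (spaceDir i, 0)).comp hS
      have e3 := (hcont timeDir).comp hS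
      refine integral_lineDeriv_eq_zero (R := R) (hX i) (((hzi i).mul hsi).smul e1) ?_ ?_ ?_
      · exact ((((hzi i).mul hsi).smul e2).add ((((hzi i).pow 2).mul (hsi.pow 2)).smul e3)).add
          ((hsi.sub (((hzi i).pow 2).mul (hsi.pow 3))).smul e1)
      · intro z hz
        rw [h0 _ (hlS z hz), smul_zero]
      · intro z hz
        simp only [X', hl1 _ _ (hlS z hz), h0 _ (hlS z hz), smul_zero, add_zero]
    have i1 := integrable_smul_smoothNorm (ε := ε) (hcont timeDir) (hl1 timeDir)
      (m := fun z => 1 - ε ^ 2 * (smoothNorm ε z)⁻¹ ^ 2)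
      (continuous_const.sub (continuous_const.mul (hsi.pow 2)))
    have i2 := fun i : Fin 3 => integrable_smul_smoothNorm (ε := ε) (hcont (spaceDir i, 0))
      (hl1 (spaceDir i, 0)) (m := fun z => z i * (smoothNorm ε z)⁻¹) ((hzi i).mul hsi)
    have i3 := integrable_smul_smoothNorm (ε := ε) hF.continuous h0
      (m := fun z => 2 * (smoothNorm ε z)⁻¹ + ε ^ 2 * (smoothNorm ε z)⁻¹ ^ 3)
      ((continuous_const.mul hsi).add (continuous_const.mul (hsi.pow 3)))
    have i12 : Integrable fun z : Space =>
        (1 - ε ^ 2 * (smoothNorm ε z)⁻¹ ^ 2) • fderiv ℝ F (z, smoothNorm ε z) timeDir +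
        ∑ i : Fin 3, (z i * (smoothNorm ε z)⁻¹) • fderiv ℝ F (z, smoothNorm ε z) (spaceDir i, 0) :=
      i1.add (integrable_finsetSum _ fun i _ => i2 i)
    rw [← integral_finsetSum _ fun i _ => i2 i,
      ← integral_add i1 (integrable_finsetSum _ fun i _ => i2 i), ← integral_add i12 i3]
    have hsum : ∑ i, ∫ z, X' i z = 0 := Finset.sum_eq_zero fun i _ => (hint i).2
    rw [← integral_finsetSum _ fun i _ => (hint i).1] at hsum
    rw [← hsum]
    refine integral_congr_ae (Eventually.of_forall fun z => ?_)
    have hsC : (smoothNorm ε z : ℂ) ≠ 0 := by exact_mod_cast hs0 z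
    have hrel := sum_sq_eq ε z
    simp only [X', Fin.sum_univ_three, Complex.real_smul, S]
    push_cast
    generalize fderiv ℝ F (z, smoothNorm ε z) timeDir = ht
    generalize F (z, smoothNorm ε z) = hv
    linear_combination (norm := (field_simp; ring))
      (-1 / (smoothNorm ε z : ℂ) ^ 2 * ht + 1 / (smoothNorm ε z : ℂ) ^ 3 * hv) * hrel
  have hlim0 := tendsto_nhds_unique hlim (tendsto_const_nhds.congr' (by
    filter_upwards [self_mem_nhdsWithin] with ε hε
    exact (hzero ε hε).symm))
  simp only [one_smul] at hlim0
  rw [← hlim0]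
  congr 1
  refine integral_congr_ae (Eventually.of_forall fun z => ?_)
  simp only [Complex.real_smul]
  push_cast
  ring

/-- Green's identity for the wave operator inside the light cone. -/
theorem integral_green_cone {v φ : Spacetime → ℂ} (hv : ContDiff ℝ 2 v) (hφ : ContDiff ℝ 2 φ)
    (hc : HasCompactSupport φ) :
    ∫ p : Spacetime, heaviside (p.2 - ‖p.1‖) • (v p * box φ p - φ p * box v p) =
      ∫ z : Space, 2 * φ (z, ‖z‖) * (fderiv ℝ v (z, ‖z‖) timeDir +
        (∑ i, (z i * ‖z‖⁻¹) • fderiv ℝ v (z, ‖z‖) (spaceDir i, 0)) + ‖z‖⁻¹ • v (z, ‖z‖)) := by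
  have hvd : Differentiable ℝ v := hv.differentiable (by simp)
  have hφd : Differentiable ℝ φ := hφ.differentiable (by simp)
  have hv1 : ∀ w, ContDiff ℝ 1 fun p => fderiv ℝ v p w := fun w =>
    contDiff_fderiv_dir (k := 1) hv w
  have hφ1 : ∀ w, ContDiff ℝ 1 fun p => fderiv ℝ φ p w := fun w =>
    contDiff_fderiv_dir (k := 1) hφ w
  -- The Green flux: the derivative of G w in direction w is v ∂_w²φ - φ ∂_w²v.
  let G : Spacetime → Spacetime → ℂ := fun w p => v p * fderiv ℝ φ p w - φ p * fderiv ℝ v p w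
  have hG : ∀ w, ContDiff ℝ 1 (G w) := fun w =>
    ((hv.of_le (by norm_num)).mul (hφ1 w)).sub ((hφ.of_le (by norm_num)).mul (hv1 w))
  have hGc : ∀ w, HasCompactSupport (G w) := fun w =>
    (hc.fderiv_apply ℝ w).mul_left.sub hc.mul_right
  have hGd : ∀ w p, fderiv ℝ (G w) p w = v p * dd w φ p - φ p * dd w v p := by
    intro w p
    have a1 := (hv1 w).differentiable (by simp)
    have a2 := (hφ1 w).differentiable (by simp)
    simp only [G]
    rw [fderiv_fun_sub (by fun_prop) (by fun_prop), _root_.sub_apply,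
      fderiv_mul_dir hvd a2, fderiv_mul_dir hφd a1]
    simp only [dd]
    ring
  have hGcont : ∀ w, Continuous fun p => fderiv ℝ (G w) p w := fun w =>
    (contDiff_fderiv_dir (k := 0) (hG w) w).continuous
  have hGi : ∀ w, Integrable fun p : Spacetime => heaviside (p.2 - ‖p.1‖) • fderiv ℝ (G w) p w :=
    fun w => integrable_heaviside_smul ((hGcont w).integrable_of_hasCompactSupport
      ((hGc w).fderiv_apply ℝ w)) (by fun_prop)
  have hlhs : ∫ p : Spacetime, heaviside (p.2 - ‖p.1‖) • (v p * box φ p - φ p * box v p) =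
      (-∫ z : Space, G timeDir (z, ‖z‖)) -
        ∑ i, ∫ z : Space, (z i * ‖z‖⁻¹) • G (spaceDir i, 0) (z, ‖z‖) := by
    rw [← integral_heaviside_cone_time (hG _) (hGc _)]
    simp_rw [← integral_heaviside_cone_space (hG _) (hGc _)]
    rw [← integral_finsetSum _ fun i _ => hGi _, ← integral_sub (hGi _)
      (integrable_finsetSum _ fun i _ => hGi _)]
    refine integral_congr_ae (Eventually.of_forall fun p => ?_)
    simp only [hGd, box, ← Finset.smul_sum, ← smul_sub, Finset.sum_sub_distrib, mul_sub,
      Finset.mul_sum]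
    congr 1
    ring
  obtain ⟨R, hR⟩ := exists_late_of_hasCompactSupport hc
  have hR1 : ∀ w (p : Spacetime), R < p.2 → fderiv ℝ φ p w = 0 := fun w p hp => by
    rw [fderiv_eq_zero_of_late hR p hp]; rfl
  have hprod : ContDiff ℝ 1 fun p => v p * φ p :=
    (hv.of_le (by norm_num)).mul (hφ.of_le (by norm_num))
  have hprod0 : ∀ p : Spacetime, R < p.2 → v p * φ p = 0 := fun p hp => by rw [hR p hp, mul_zero]
  have hprodc : ∀ w, Continuous fun p => fderiv ℝ (fun p => v p * φ p) p w := fun w =>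
    (contDiff_fderiv_dir (k := 0) hprod w).continuous
  have hprodl : ∀ w (p : Spacetime), R < p.2 → fderiv ℝ (fun p => v p * φ p) p w = 0 :=
    fun w p hp => by rw [fderiv_eq_zero_of_late hprod0 p hp]; rfl
  have hGl : ∀ w (p : Spacetime), R < p.2 → G w p = 0 := fun w p hp => by
    simp only [G, hR p hp, hR1 w p hp, mul_zero, zero_mul, sub_zero]
  have hone : ∀ z : Space, |(1 : ℝ)| * ‖z‖ ≤ 1 * (1 + ‖z‖) := fun z => by simp
  have j1 := integrable_cone (hG timeDir).continuous (hGl _) measurable_const hone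
  have j2 := fun i : Fin 3 => integrable_cone (hG (spaceDir i, 0)).continuous (hGl _)
    (measurable_coord_div_norm i) (fun z => abs_coord_div_norm_le z i)
  have j3 := integrable_cone (hprodc timeDir) (hprodl _) measurable_const hone
  have j4 := fun i : Fin 3 => integrable_cone (hprodc (spaceDir i, 0)) (hprodl _)
    (measurable_coord_div_norm i) (fun z => abs_coord_div_norm_le z i)
  simp only [one_smul] at j1 j3
  have j1n : Integrable fun z : Space => -G timeDir (z, ‖z‖) := j1.neg
  have j5 := integrable_cone (m := fun z => ‖z‖⁻¹) (F := fun p => 2 * (v p * φ p)) (R := R)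
    (continuous_const.mul hprod.continuous)
    (fun p hp => by rw [hprod0 p hp, mul_zero]) measurable_norm.inv abs_inv_norm_le
  -- The flux through the cone differentiates φ only along the cone. Adding the vanishing divergence
  -- integral for vφ removes these derivatives and doubles those of v.
  have hrad := integral_radial_div hprod hprod0
  have hcomb : ∫ p : Spacetime, heaviside (p.2 - ‖p.1‖) • (v p * box φ p - φ p * box v p) =
      ((-∫ z : Space, G timeDir (z, ‖z‖)) -
        ∑ i, ∫ z : Space, (z i * ‖z‖⁻¹) • G (spaceDir i, 0) (z, ‖z‖)) +
      ((∫ z : Space, fderiv ℝ (fun p => v p * φ p) (z, ‖z‖) timeDir) +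
      (∑ i, ∫ z : Space, (z i * ‖z‖⁻¹) • fderiv ℝ (fun p => v p * φ p) (z, ‖z‖) (spaceDir i, 0)) +
      ∫ z : Space, ‖z‖⁻¹ • (2 * (v (z, ‖z‖) * φ (z, ‖z‖)))) := by
    rw [hlhs, hrad, add_zero]
  have k2 := integrable_finsetSum Finset.univ fun i _ => j2 i
  have k4 := integrable_finsetSum Finset.univ fun i _ => j4 i
  have j12 : Integrable fun z : Space => -G timeDir (z, ‖z‖) -
      ∑ i, (z i * ‖z‖⁻¹) • G (spaceDir i, 0) (z, ‖z‖) := j1n.sub k2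
  have j34 : Integrable fun z : Space => fderiv ℝ (fun p => v p * φ p) (z, ‖z‖) timeDir +
      ∑ i, (z i * ‖z‖⁻¹) • fderiv ℝ (fun p => v p * φ p) (z, ‖z‖) (spaceDir i, 0) := j3.add k4
  have j345 : Integrable fun z : Space => fderiv ℝ (fun p => v p * φ p) (z, ‖z‖) timeDir +
      ∑ i, (z i * ‖z‖⁻¹) • fderiv ℝ (fun p => v p * φ p) (z, ‖z‖) (spaceDir i, 0) +
      ‖z‖⁻¹ • (2 * (v (z, ‖z‖) * φ (z, ‖z‖))) := j34.add j5
  rw [hcomb, ← integral_neg, ← integral_finsetSum _ fun i _ => j2 i,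
    ← integral_finsetSum _ fun i _ => j4 i, ← integral_sub j1n k2, ← integral_add j3 k4,
    ← integral_add j34 j5, ← integral_add j12 j345]
  refine integral_congr_ae (Eventually.of_forall fun z => ?_)
  simp only [G, fderiv_mul_dir hvd hφd,
    Fin.sum_univ_three, Complex.real_smul]
  ring

/-! ### Radial means and their transport equation -/

/-- The radial mean `x ↦ ∫₀¹ s^m f(s x) ds`. -/
def radial (m : ℕ) (f : Space → ℂ) : Space → ℂ :=
  avg (volume.restrict (Ioc (0 : ℝ) 1)) (fun s => s ^ m)
    (fun s => (projIcc (0 : ℝ) 1 zero_le_one s : ℝ)) (fun _ => 0) f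

/-- The dilation factor is clamped to [0,1] because `BddC.avg` asks for |α| ≤ 1 at every parameter,
not only on the interval of integration. -/
theorem abs_projIcc_le (s : ℝ) : |((projIcc (0 : ℝ) 1 zero_le_one s : Icc (0 : ℝ) 1) : ℝ)| ≤ 1 := by
  have h := (projIcc (0 : ℝ) 1 zero_le_one s).2
  rw [abs_of_nonneg h.1]
  exact h.2

theorem aestronglyMeasurable_projIcc : AEStronglyMeasurable
    (fun s => ((projIcc (0 : ℝ) 1 zero_le_one s : Icc (0 : ℝ) 1) : ℝ))
    (volume.restrict (Ioc (0 : ℝ) 1)) :=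
  (continuous_subtype_val.comp continuous_projIcc).aestronglyMeasurable

theorem integrable_pow_Ioc (m : ℕ) :
    Integrable (fun s : ℝ => s ^ m) (volume.restrict (Ioc (0 : ℝ) 1)) :=
  ((continuous_pow m).integrableOn_Icc).mono_set Ioc_subset_Icc_self

theorem integral_projIcc (w : ℝ → ℝ → ℂ) :
    ∫ s in Ioc (0 : ℝ) 1, w s (projIcc (0 : ℝ) 1 zero_le_one s : Icc (0 : ℝ) 1) =
      ∫ s in (0 : ℝ)..1, w s s := by
  rw [intervalIntegral.integral_of_le zero_le_one]
  refine setIntegral_congr_fun measurableSet_Ioc fun s hs => ?_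
  simp only [projIcc_of_mem zero_le_one (Ioc_subset_Icc_self hs)]

theorem BddC.radial {k : ℕ} {A : ℝ} {f : Space → ℂ} (hf : BddC k A f) (m : ℕ) :
    BddC k A (radial m f) := by
  refine (hf.avg (integrable_pow_Ioc m) aestronglyMeasurable_projIcc abs_projIcc_le
    aestronglyMeasurable_const).mono le_rfl (mul_le_of_le_one_right hf.nonneg ?_)
  have h1 : ∫ s in Ioc (0 : ℝ) 1, ‖s ^ m‖ ≤ ∫ _s in Ioc (0 : ℝ) 1, (1 : ℝ) := by
    refine setIntegral_mono_on (integrable_pow_Ioc m).norm (integrable_const 1)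
      measurableSet_Ioc fun s hs => ?_
    rw [norm_pow, Real.norm_of_nonneg hs.1.le]
    exact pow_le_one₀ hs.1.le hs.2
  simpa using h1

theorem radial_sub {A B : ℝ} {f g : Space → ℂ} (hf : BddC 0 A f) (hg : BddC 0 B g) (m : ℕ)
    (x : Space) : radial m (fun x => f x - g x) x = radial m f x - radial m g x :=
  avg_sub (integrable_pow_Ioc m) aestronglyMeasurable_projIcc aestronglyMeasurable_const hf hg x

/-- The transport equation solved by the radial means. -/
theorem radial_transport {A : ℝ} {f : Space → ℂ} (hf : BddC 1 A f) (m : ℕ) (x : Space) :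
    (m + 1) * radial m f x + fderiv ℝ (radial m f) x x = f x := by
  have hd : Differentiable ℝ f := hf.1.differentiable (by simp)
  have hc : Continuous fun y => fderiv ℝ f y x :=
    (contDiff_fderiv_dir (k := 0) hf.1 x).continuous
  have e1 : radial m f x = ∫ s in (0 : ℝ)..1, s ^ m • f (s • x) := by
    rw [← integral_projIcc fun s α => s ^ m • f (α • x)]
    simp [radial, avg]
  have e2 : fderiv ℝ (radial m f) x x = ∫ s in (0 : ℝ)..1, (s ^ m * s) • fderiv ℝ f (s • x) x := by
    rw [← integral_projIcc fun s α => (s ^ m * α) • fderiv ℝ f (α • x) x]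
    unfold radial
    rw [fderiv_avg_apply (integrable_pow_Ioc m) aestronglyMeasurable_projIcc abs_projIcc_le
      aestronglyMeasurable_const hf]
    simp [avg]
  have hc1 : Continuous fun s : ℝ => s ^ m • f (s • x) :=
    (continuous_pow m).smul (hd.continuous.comp (by fun_prop))
  have hc2 : Continuous fun s : ℝ => (s ^ m * s) • fderiv ℝ f (s • x) x :=
    ((continuous_pow m).mul continuous_id).smul (hc.comp (by fun_prop))
  -- The transport equation is the fundamental theorem of calculus for s ↦ s^{m+1} f(sx) on [0,1].
  have hder : ∀ s ∈ uIcc (0 : ℝ) 1, HasDerivAt (fun s : ℝ => s ^ (m + 1) • f (s • x))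
      ((m + 1 : ℂ) * (s ^ m • f (s • x)) + (s ^ m * s) • fderiv ℝ f (s • x) x) s := by
    intro s _
    have h1 : HasDerivAt (fun s : ℝ => f (s • x)) (fderiv ℝ f (s • x) x) s := by
      have h2 : HasDerivAt (fun s : ℝ => s • x) x s := by
        simpa using (hasDerivAt_id s).smul_const x
      exact (hd (s • x)).hasFDerivAt.comp_hasDerivAt s h2
    refine ((hasDerivAt_pow (m + 1) s).smul h1).congr_deriv ?_
    simp only [Complex.real_smul, Nat.add_sub_cancel]
    push_cast
    ring
  have := intervalIntegral.integral_eq_sub_of_hasDerivAt hder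
    (((continuous_const.mul hc1).add hc2).intervalIntegrable _ _)
  have hc3 : Continuous fun s : ℝ => (m + 1 : ℂ) * (s ^ m • f (s • x)) := continuous_const.mul hc1
  rw [intervalIntegral.integral_add (hc3.intervalIntegrable _ _)
    (hc2.intervalIntegrable _ _), intervalIntegral.integral_const_mul, ← e1, ← e2] at this
  simpa using this

theorem sum_coord_smul (x : Space) : ∑ i, x i • spaceDir i = x := by
  ext j
  simp [spaceDir, Fin.sum_univ_three]
  fin_cases j <;> simp

theorem sum_coord_mul_fderiv (f : Space → ℂ) (x : Space) :
    ∑ i, (x i : ℂ) * fderiv ℝ f x (spaceDir i) = fderiv ℝ f x x := by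
  conv_rhs => rw [← sum_coord_smul x]
  simp only [map_sum, map_smul, Complex.real_smul]
  rw [sum_coord_smul]

theorem fderiv_comp_fst {f : Space → ℂ} (hf : Differentiable ℝ f) (p v : Spacetime) :
    fderiv ℝ (fun p : Spacetime => f p.1) p v = fderiv ℝ f p.1 v.1 := by
  have h : HasFDerivAt (fun p : Spacetime => f p.1) _ p :=
    (hf p.1).hasFDerivAt.comp p (hasFDerivAt_fst (p := p) (𝕜 := ℝ))
  rw [h.fderiv]
  rfl

theorem dd_comp_fst {f : Space → ℂ} (hf : ContDiff ℝ 2 f) (p v : Spacetime) :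
    dd v (fun p : Spacetime => f p.1) p = dd v.1 f p.1 := by
  unfold dd
  simp_rw [fderiv_comp_fst (hf.differentiable (by simp))]
  exact fderiv_comp_fst (differentiable_fderiv_dir hf v.1) p v

theorem box_mul_fst {f : Space → ℂ} {g : Spacetime → ℂ} (hf : ContDiff ℝ 2 f)
    (hg : ContDiff ℝ 2 g) (p : Spacetime) :
    box (fun p => f p.1 * g p) p = f p.1 * box g p
      - 2 * ∑ i, fderiv ℝ f p.1 (spaceDir i) * fderiv ℝ g p (spaceDir i, 0)
      - lap f p.1 * g p := by
  have h1 : ContDiff ℝ 2 fun p : Spacetime => f p.1 := hf.comp contDiff_fst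
  have h0 : dd (0 : Space) f p.1 = 0 := by simp [dd]
  simp only [box, lap, dd_mul h1 hg, dd_comp_fst hf,
    fderiv_comp_fst (hf.differentiable (by simp)), Fin.sum_univ_three, timeDir, h0, map_zero]
  ring

/-! ### The Lorentz form and the progressing wave -/

/-- The Lorentz form `t² - |x|²`. -/
def lorentz (p : Spacetime) : ℂ := ((p.2 ^ 2 - ‖p.1‖ ^ 2 : ℝ) : ℂ)

theorem contDiff_lorentz {k : WithTop ℕ∞} : ContDiff ℝ k lorentz :=
  Complex.ofRealCLM.contDiff.comp ((contDiff_snd.pow 2).sub (contDiff_fst.norm_sq ℝ))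

theorem fderiv_lorentz (p v : Spacetime) :
    fderiv ℝ lorentz p v = ((2 * (p.2 * v.2 - inner ℝ p.1 v.1) : ℝ) : ℂ) := by
  have h1 := (hasFDerivAt_snd (p := p) (𝕜 := ℝ) (E := Space) (F := ℝ)).pow 2
  have h2 := (hasFDerivAt_fst (p := p) (𝕜 := ℝ) (E := Space) (F := ℝ)).norm_sq
  have h3 := Complex.ofRealCLM.hasFDerivAt.comp p (h1.sub h2)
  have h4 : HasFDerivAt lorentz _ p := h3
  rw [h4.fderiv]
  simp
  ring

theorem dd_lorentz (p v : Spacetime) :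
    dd v lorentz p = ((2 * (v.2 ^ 2 - ‖v.1‖ ^ 2) : ℝ) : ℂ) := by
  unfold dd
  simp_rw [fderiv_lorentz]
  have h1 : HasFDerivAt (fun q : Spacetime => q.2 * v.2 - inner ℝ q.1 v.1)
      (v.2 • ContinuousLinearMap.snd ℝ Space ℝ -
        (innerSL ℝ v.1).comp (ContinuousLinearMap.fst ℝ Space ℝ)) p := by
    refine (hasFDerivAt_snd.mul_const v.2).sub ?_
    have := ((innerSL ℝ v.1).comp (ContinuousLinearMap.fst ℝ Space ℝ)).hasFDerivAt (x := p)
    refine this.congr_of_eventuallyEq (Eventually.of_forall fun q => ?_)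
    simp [real_inner_comm]
  have h2 := Complex.ofRealCLM.hasFDerivAt.comp p (h1.const_mul 2)
  have h3 : HasFDerivAt (fun q : Spacetime =>
    ((2 * (q.2 * v.2 - inner ℝ q.1 v.1) : ℝ) : ℂ)) _ p := h2
  rw [h3.fderiv]
  simp
  ring

theorem inner_spaceDir (x : Space) (i : Fin 3) : inner ℝ x (spaceDir i) = x i := by
  simp [spaceDir, EuclideanSpace.inner_single_right]

theorem box_lorentz (p : Spacetime) : box lorentz p = 8 := by
  simp [box, dd_lorentz, timeDir, norm_spaceDir]
  norm_num

theorem lorentz_eq_sum (p : Spacetime) : lorentz p = (p.2 : ℂ) ^ 2 - ∑ i, (p.1 i : ℂ) ^ 2 := by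
  simp [lorentz, norm_sq_eq_sum, Fin.sum_univ_three]

theorem box_lorentz_sq (p : Spacetime) :
    box (fun p => lorentz p * lorentz p) p = 24 * lorentz p := by
  have h := fun v => dd_mul (contDiff_lorentz (k := 2)) contDiff_lorentz v p
  simp only [box, h, dd_lorentz, fderiv_lorentz, timeDir, norm_spaceDir, inner_spaceDir,
    Fin.sum_univ_three]
  simp only [lorentz_eq_sum, Fin.sum_univ_three]
  simp
  ring

section Ansatz

/-- The progressing wave `b₀ + b₁ σ + b₂ σ² / 2` with `σ = t² - |x|²`. -/
def ansatz (b₀ b₁ b₂ : Space → ℂ) (p : Spacetime) : ℂ :=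
  b₀ p.1 + b₁ p.1 * lorentz p + b₂ p.1 * (lorentz p * lorentz p * (1 / 2))

variable {q b₀ b₁ b₂ : Space → ℂ}

theorem contDiff_ansatz (h₀ : ContDiff ℝ 2 b₀) (h₁ : ContDiff ℝ 2 b₁) (h₂ : ContDiff ℝ 2 b₂) :
    ContDiff ℝ 2 (ansatz b₀ b₁ b₂) :=
  ((h₀.comp contDiff_fst).add ((h₁.comp contDiff_fst).mul contDiff_lorentz)).add
    ((h₂.comp contDiff_fst).mul ((contDiff_lorentz.mul contDiff_lorentz).mul contDiff_const))

/-- Sorted by powers of σ, the terms without σ cancel by `ht₁` and those linear in σ by `ht₂`. Only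
the σ² term survives. -/
theorem box_ansatz (h₀ : ContDiff ℝ 2 b₀) (h₁ : ContDiff ℝ 2 b₁) (h₂ : ContDiff ℝ 2 b₂)
    (ht₁ : ∀ x, 8 * b₁ x + 4 * fderiv ℝ b₁ x x = lap b₀ x + q x * b₀ x)
    (ht₂ : ∀ x, 12 * b₂ x + 4 * fderiv ℝ b₂ x x = lap b₁ x + q x * b₁ x) (p : Spacetime) :
    box (ansatz b₀ b₁ b₂) p = q p.1 * ansatz b₀ b₁ b₂ p -
      lorentz p ^ 2 / 2 * (lap b₂ p.1 + q p.1 * b₂ p.1) := by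
  have c0 : ContDiff ℝ 2 fun _ : Spacetime => (1 : ℂ) := contDiff_const
  have cl : ContDiff ℝ 2 lorentz := contDiff_lorentz
  have cl2 : ContDiff ℝ 2 fun p => lorentz p * lorentz p := cl.mul cl
  have chalf : ContDiff ℝ 2 fun _ : Spacetime => (1 / 2 : ℂ) := contDiff_const
  have e0 : box (fun p => b₀ p.1) p = -lap b₀ p.1 := by
    have := box_mul_fst h₀ c0 p
    simp only [mul_one] at this
    rw [this]
    simp [box, dd]
  have hh : box (fun p => lorentz p * lorentz p * (1 / 2)) p = 12 * lorentz p := by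
    have hz : ∀ v p, dd v (fun _ : Spacetime => (1 / 2 : ℂ)) p = 0 := fun v p => by simp [dd]
    have : box (fun p => lorentz p * lorentz p * (1 / 2)) p =
        1 / 2 * box (fun p => lorentz p * lorentz p) p := by
      simp only [box, dd_mul cl2 chalf, hz, fderiv_fun_const, Pi.zero_apply, zero_apply,
        Fin.sum_univ_three]
      ring
    rw [this, box_lorentz_sq]
    ring
  have hf : ∀ v, fderiv ℝ (fun p => lorentz p * lorentz p * (1 / 2)) p v =
      lorentz p * fderiv ℝ lorentz p v := by
    intro v
    have hd : Differentiable ℝ lorentz := cl.differentiable (by simp)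
    rw [fderiv_mul_dir (cl2.differentiable (by simp)) (chalf.differentiable (by simp)),
      fderiv_mul_dir hd hd]
    simp
    ring
  have s1 : ∀ f : Space → ℂ, ∑ i, fderiv ℝ f p.1 (spaceDir i) *
      fderiv ℝ lorentz p (spaceDir i, 0) = -2 * fderiv ℝ f p.1 p.1 := by
    intro f
    rw [← sum_coord_mul_fderiv]
    simp only [fderiv_lorentz, inner_spaceDir, Fin.sum_univ_three]
    push_cast
    ring
  have s2 : ∑ i, fderiv ℝ b₂ p.1 (spaceDir i) *
      (lorentz p * fderiv ℝ lorentz p (spaceDir i, 0)) =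
      lorentz p * (-2 * fderiv ℝ b₂ p.1 p.1) := by
    rw [← s1, Finset.mul_sum]
    exact Finset.sum_congr rfl fun i _ => by ring
  have c01 : ContDiff ℝ 2 fun p : Spacetime => b₀ p.1 := h₀.comp contDiff_fst
  have c11 : ContDiff ℝ 2 fun p : Spacetime => b₁ p.1 * lorentz p := (h₁.comp contDiff_fst).mul cl
  have c21 : ContDiff ℝ 2 fun p : Spacetime => b₂ p.1 * (lorentz p * lorentz p * (1 / 2)) :=
    (h₂.comp contDiff_fst).mul (cl2.mul chalf)
  have : box (ansatz b₀ b₁ b₂) p = box (fun p => b₀ p.1) p +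
      box (fun p => b₁ p.1 * lorentz p) p +
      box (fun p => b₂ p.1 * (lorentz p * lorentz p * (1 / 2))) p := by
    rw [← box_add c01 c11, ← box_add (c01.add c11) c21]
    rfl
  rw [this, e0, box_mul_fst h₁ cl, box_mul_fst h₂ (cl2.mul chalf), hh, box_lorentz]
  simp_rw [hf]
  rw [s1, s2]
  unfold ansatz
  linear_combination ht₁ p.1 + lorentz p * ht₂ p.1

/-- As σ = 0 on the cone, b₂ does not contribute to first derivatives there and b₁ contributes only
through dσ. -/
theorem fderiv_ansatz_cone (h₀ : ContDiff ℝ 2 b₀) (h₁ : ContDiff ℝ 2 b₁) (h₂ : ContDiff ℝ 2 b₂)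
    (z : Space) (v : Spacetime) :
    fderiv ℝ (ansatz b₀ b₁ b₂) (z, ‖z‖) v =
      fderiv ℝ b₀ z v.1 + b₁ z * ((2 * (‖z‖ * v.2 - inner ℝ z v.1) : ℝ) : ℂ) := by
  have cl : ContDiff ℝ 2 lorentz := contDiff_lorentz
  have hd : Differentiable ℝ lorentz := cl.differentiable (by simp)
  have d0 := h₀.differentiable (by simp)
  have d1 := h₁.differentiable (by simp)
  have d2 := h₂.differentiable (by simp)
  have dl : Differentiable ℝ fun p => lorentz p * lorentz p := hd.mul hd
  have dl2 : Differentiable ℝ fun p => lorentz p * lorentz p * (1 / 2) :=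
    (hd.mul hd).mul (differentiable_const _)
  have f0 : Differentiable ℝ fun p : Spacetime => b₀ p.1 := d0.comp differentiable_fst
  have f1 : Differentiable ℝ fun p : Spacetime => b₁ p.1 := d1.comp differentiable_fst
  have f2 : Differentiable ℝ fun p : Spacetime => b₂ p.1 := d2.comp differentiable_fst
  have hz : lorentz (z, ‖z‖) = 0 := by simp [lorentz]
  have : fderiv ℝ (ansatz b₀ b₁ b₂) (z, ‖z‖) v =
      fderiv ℝ (fun p : Spacetime => b₀ p.1) (z, ‖z‖) v +
      fderiv ℝ (fun p => b₁ p.1 * lorentz p) (z, ‖z‖) v +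
      fderiv ℝ (fun p => b₂ p.1 * (lorentz p * lorentz p * (1 / 2))) (z, ‖z‖) v := by
    have f1l : Differentiable ℝ fun p => b₁ p.1 * lorentz p := f1.mul hd
    have f01 : Differentiable ℝ fun p => b₀ p.1 + b₁ p.1 * lorentz p := f0.add f1l
    have f2l : Differentiable ℝ fun p => b₂ p.1 * (lorentz p * lorentz p * (1 / 2)) := f2.mul dl2
    rw [← add_apply, ← add_apply, ← fderiv_fun_add (f0 _) (f1l _), ← fderiv_fun_add (f01 _) (f2l _)]
    rfl
  rw [this, fderiv_mul_dir f1 hd, fderiv_mul_dir f2 dl2,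
    fderiv_mul_dir dl (differentiable_const _), fderiv_mul_dir hd hd, hz,
    fderiv_comp_fst d0, fderiv_lorentz]
  simp

/-- The jump condition: the Green boundary term of the progressing wave. -/
theorem ansatz_cone (h₀ : ContDiff ℝ 2 b₀) (h₁ : ContDiff ℝ 2 b₁) (h₂ : ContDiff ℝ 2 b₂)
    (ht₀ : ∀ x, b₀ x + fderiv ℝ b₀ x x = q x / (8 * Real.pi)) {z : Space} (hz : z ≠ 0) :
    fderiv ℝ (ansatz b₀ b₁ b₂) (z, ‖z‖) timeDir +
        (∑ i, (z i * ‖z‖⁻¹) • fderiv ℝ (ansatz b₀ b₁ b₂) (z, ‖z‖) (spaceDir i, 0)) +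
        ‖z‖⁻¹ • ansatz b₀ b₁ b₂ (z, ‖z‖) = q z / (8 * Real.pi * ‖z‖) := by
  have hn : (‖z‖ : ℂ) ≠ 0 := by exact_mod_cast norm_ne_zero_iff.2 hz
  -- The direction (z/|z|, 1) is tangent to the cone and σ is constant along it. The term -2|z|b₁
  -- found here is thus cancelled by the time derivative, so the jump condition involves b₀ alone.
  have e1 : ∑ i, (z i * ‖z‖⁻¹) • fderiv ℝ (ansatz b₀ b₁ b₂) (z, ‖z‖) (spaceDir i, 0) =
      (‖z‖ : ℂ)⁻¹ * fderiv ℝ b₀ z z - 2 * ‖z‖ * b₁ z := by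
    have h2 : (∑ i, (z i : ℂ) ^ 2) = (‖z‖ : ℂ) ^ 2 := by
      have := congrArg (fun x : ℝ => (x : ℂ)) (norm_sq_eq_sum z)
      simp only [Fin.sum_univ_three] at this ⊢
      push_cast at this
      exact this.symm
    rw [← sum_coord_mul_fderiv]
    simp only [fderiv_ansatz_cone h₀ h₁ h₂, inner_spaceDir, Complex.real_smul,
      Fin.sum_univ_three] at h2 ⊢
    push_cast
    field_simp
    linear_combination (-2 * b₁ z) * h2
  rw [e1, fderiv_ansatz_cone h₀ h₁ h₂]
  have hz0 : lorentz (z, ‖z‖) = 0 := by simp [lorentz]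
  simp only [timeDir, map_zero, ansatz, hz0, inner_zero_right, Complex.real_smul]
  push_cast
  have := ht₀ z
  have hpi : (Real.pi : ℂ) ≠ 0 := by exact_mod_cast Real.pi_ne_zero
  field_simp at this ⊢
  linear_combination 2 * this

end Ansatz

/-! ### Calculus of maps that are bounded and Lipschitz in the potential -/

section Lip

variable {V W : Type} [NormedAddCommGroup V] [NormedSpace ℝ V]
  [NormedAddCommGroup W] [NormedSpace ℝ W]

/-- `Φ` maps the ball of radius `M` of the space of `C⁷` functions, boundedly and Lipschitz
continuously, to the space of `C^k` functions. -/
def IsLip (M : ℝ) (k : ℕ) (Φ : (Space → ℂ) → V → ℂ) : Prop :=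
  ∃ K, 0 ≤ K ∧ ∀ ⦃q q' : Space → ℂ⦄ ⦃D : ℝ⦄, BddC 7 M q → BddC 7 M q' →
    BddC 7 D (fun x => q x - q' x) →
    BddC k K (Φ q) ∧ BddC k (K * D) (fun p => Φ q p - Φ q' p)

variable {M : ℝ} {k l : ℕ} {Φ Ψ : (Space → ℂ) → V → ℂ}

theorem IsLip.bddC (h : IsLip M k Φ) : ∃ K, ∀ q, BddC 7 M q → BddC k K (Φ q) := by
  obtain ⟨K, _, h⟩ := h
  refine ⟨K, fun q hq => (h hq hq (D := 0) ?_).1⟩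
  simpa using bddC_zero_fun (V := Space) (E := ℂ) (k := 7) le_rfl

theorem IsLip.mono (h : IsLip M k Φ) (hl : l ≤ k) : IsLip M l Φ := by
  obtain ⟨K, hK, h⟩ := h
  exact ⟨K, hK, fun q q' D h1 h2 h3 =>
    ⟨(h h1 h2 h3).1.mono hl le_rfl, (h h1 h2 h3).2.mono hl le_rfl⟩⟩

theorem isLip_id (hk : k ≤ 7) : IsLip M k fun q => q :=
  -- The constant must be at least M for the bound and at least 1 for the Lipschitz estimate.
  ⟨|M| + 1, by positivity, fun q q' D h1 _ h3 =>
    ⟨h1.mono hk (by linarith [le_abs_self M]), h3.mono hk (by nlinarith [h3.nonneg, abs_nonneg M])⟩⟩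

theorem isLip_const {B : ℝ} {m : V → ℂ} (hm : BddC k B m) : IsLip M k fun _ => m :=
  ⟨B, hm.nonneg, fun q q' D _ _ h3 => ⟨hm, by
    simpa using bddC_zero_fun (V := V) (E := ℂ) (k := k) (mul_nonneg hm.nonneg h3.nonneg)⟩⟩

theorem IsLip.add (hΦ : IsLip M k Φ) (hΨ : IsLip M k Ψ) :
    IsLip M k fun q p => Φ q p + Ψ q p := by
  obtain ⟨K, hK, h⟩ := hΦ
  obtain ⟨L, hL, h'⟩ := hΨ
  refine ⟨K + L, by positivity, fun q q' D h1 h2 h3 =>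
    ⟨(h h1 h2 h3).1.add (h' h1 h2 h3).1, ?_⟩⟩
  rw [add_mul]
  exact ((h h1 h2 h3).2.add (h' h1 h2 h3).2).congr fun p => by ring

theorem IsLip.mul (hΦ : IsLip M k Φ) (hΨ : IsLip M k Ψ) :
    IsLip M k fun q p => Φ q p * Ψ q p := by
  obtain ⟨K, hK, h⟩ := hΦ
  obtain ⟨L, hL, h'⟩ := hΨ
  refine ⟨2 * (2 ^ k * K * L), by positivity, fun q q' D h1 h2 h3 => ⟨?_, ?_⟩⟩
  · refine ((h h1 h2 h3).1.mul (h' h1 h2 h3).1).mono le_rfl ?_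
    have : 0 ≤ 2 ^ k * K * L := by positivity
    linarith
  -- Comparing q' with itself, with D = 0, extracts the plain bound on Φ q' from the hypothesis. The
  -- product difference is then split as (Φq - Φq')Ψq + Φq'(Ψq - Ψq').
  · have h4 : BddC 7 (0 : ℝ) (fun x => q' x - q' x) := by
      simpa using bddC_zero_fun (V := Space) (E := ℂ) (k := 7) le_rfl
    refine ((((h h1 h2 h3).2.mul (h' h1 h2 h3).1).add
      ((h h2 h2 h4).1.mul (h' h1 h2 h3).2)).congr (g := fun p => Φ q p * Ψ q p - Φ q' p * Ψ q' p)
      fun p => by ring).mono le_rfl (le_of_eq (by ring))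

theorem IsLip.const_mul (c : ℂ) (hΦ : IsLip M k Φ) : IsLip M k fun q p => c * Φ q p := by
  obtain ⟨K, hK, h⟩ := hΦ
  refine ⟨‖c‖ * K, by positivity, fun q q' D h1 h2 h3 => ⟨(h h1 h2 h3).1.const_mul c, ?_⟩⟩
  rw [mul_assoc]
  exact ((h h1 h2 h3).2.const_mul c).congr fun p => by ring

theorem IsLip.comp_fst (hΦ : IsLip M k Φ) : IsLip M k fun q (p : V × W) => Φ q p.1 := by
  obtain ⟨K, hK, h⟩ := hΦ
  exact ⟨K, hK, fun q q' D h1 h2 h3 => ⟨(h h1 h2 h3).1.comp_fst, (h h1 h2 h3).2.comp_fst⟩⟩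

theorem IsLip.radial {Φ : (Space → ℂ) → Space → ℂ} (hΦ : IsLip M k Φ) (m : ℕ) :
    IsLip M k fun q => radial m (Φ q) := by
  obtain ⟨K, hK, h⟩ := hΦ
  have h0 : BddC 7 (0 : ℝ) fun _ : Space => (0 : ℂ) := bddC_zero_fun le_rfl
  refine ⟨K, hK, fun q q' D h1 h2 h3 => ⟨(h h1 h2 h3).1.radial m, ?_⟩⟩
  have h4 : BddC 7 (0 : ℝ) (fun x => q' x - q' x) := by simpa using h0
  exact ((h h1 h2 h3).2.radial m).congr fun p => (radial_sub
    ((h h1 h2 h3).1.mono (Nat.zero_le _) le_rfl) ((h h2 h2 h4).1.mono (Nat.zero_le _) le_rfl) m p).symm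

theorem IsLip.lap {Φ : (Space → ℂ) → Space → ℂ} (hΦ : IsLip M (k + 2) Φ) :
    IsLip M k fun q => lap (Φ q) := by
  obtain ⟨K, hK, h⟩ := hΦ
  have h0 : BddC 7 (0 : ℝ) fun _ : Space => (0 : ℂ) := bddC_zero_fun le_rfl
  refine ⟨3 * K, by positivity, fun q q' D h1 h2 h3 => ⟨(h h1 h2 h3).1.lap, ?_⟩⟩
  have h4 : BddC 7 (0 : ℝ) (fun x => q' x - q' x) := by simpa using h0
  have c1 : ContDiff ℝ 2 (Φ q) := ((h h1 h2 h3).1.mono (l := 2) (by omega) le_rfl).1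
  have c2 : ContDiff ℝ 2 (Φ q') := ((h h2 h2 h4).1.mono (l := 2) (by omega) le_rfl).1
  rw [mul_assoc]
  refine (h h1 h2 h3).2.lap.congr fun p => ?_
  simp only [PointSource.lap, dd_sub c1 c2, Finset.sum_sub_distrib]

/-- The difference of the solutions for q and q' solves the equation for q with source (F q - F q')
+ (q - q')g', where g' is the second solution. The estimate `bddC_of_eq_pot` then bounds it linearly
in D. -/
theorem IsLip.resolvent {F : (Space → ℂ) → Spacetime → ℂ} {ℓ ε : ℝ} (hF : IsLip M k F)
    (hℓ : 0 < ℓ) (hk : k ≤ 7) (hQ : 2 ^ k * M * 2 ≤ ℓ ^ 2) :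
    IsLip M k fun q => resolvent ℓ ε q (F q) := by
  obtain ⟨K, hK, h⟩ := hF
  have h0 : BddC 7 (0 : ℝ) fun _ : Space => (0 : ℂ) := bddC_zero_fun le_rfl
  set L := 2 * (K / ℓ ^ 2) with hL
  have hL0 : 0 ≤ L := by positivity
  refine ⟨L + 2 * ((K + 2 ^ k * L) / ℓ ^ 2), by positivity, fun q q' D h1 h2 h3 => ⟨?_, ?_⟩⟩
  · refine (bddC_resolvent hℓ (h1.mono hk le_rfl) hQ (h h1 h2 h3).1).mono le_rfl ?_
    have : 0 ≤ 2 * ((K + 2 ^ k * L) / ℓ ^ 2) := by positivity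
    linarith
  have hD := h3.nonneg
  have h4 : BddC 7 (0 : ℝ) (fun x => q' x - q' x) := by simpa using h0
  have hF1 := (h h1 h2 h3).1
  have hF2 := (h h2 h2 h4).1
  have hq1 := h1.mono hk le_rfl
  have hq2 := h2.mono hk le_rfl
  have r1 := bddC_resolvent (ε := ε) hℓ hq1 hQ hF1
  have r2 := bddC_resolvent (ε := ε) hℓ hq2 hQ hF2
  have hs := (h h1 h2 h3).2.add ((h3.mono hk le_rfl).comp_fst.mul r2)
  refine (bddC_of_eq_pot (ε := ε) hℓ hq1 hQ hs (r1.sub r2) fun p => ?_).mono le_rfl ?_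
  · rw [resolvent_eq hℓ hq1 hQ hF1, resolvent_eq hℓ hq2 hQ hF2,
      ← pot_sub hℓ (hF1.add (hq1.comp_fst.mul r1)) (hF2.add (hq2.comp_fst.mul r2))]
    congr 1
    ext p
    ring
  · rw [← hL]
    have : 2 * ((K * D + 2 ^ k * D * L) / ℓ ^ 2) = 2 * ((K + 2 ^ k * L) / ℓ ^ 2) * D := by ring
    rw [this]
    nlinarith

end Lip

/-! ### The amplitudes of the expansion -/

section Amplitudes

/-- The leading amplitude of the progressing wave expansion. -/
def amp₀ (q : Space → ℂ) (x : Space) : ℂ := (1 / (8 * Real.pi) : ℂ) * radial 0 q x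

/-- The factor 1/4 and the exponent 1 match 8b + 4x·∇b = 4(2b + x·∇b). For the next amplitude, 12 =
4 · 3 gives the exponent 2. -/
def amp₁ (q : Space → ℂ) (x : Space) : ℂ :=
  (1 / 4 : ℂ) * radial 1 (fun x => lap (amp₀ q) x + q x * amp₀ q x) x

def amp₂ (q : Space → ℂ) (x : Space) : ℂ :=
  (1 / 4 : ℂ) * radial 2 (fun x => lap (amp₁ q) x + q x * amp₁ q x) x

/-- The coefficient of the error of the progressing wave expansion. -/
def defect (q : Space → ℂ) (x : Space) : ℂ := lap (amp₂ q) x + q x * amp₂ q x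

variable {M : ℝ}

/-- Radial means preserve the order of differentiability and each Laplacian lowers it by two, so the
orders run 7, 5, 3 and finally 1 for `defect`. This is where seven derivatives of the potential are
spent. -/
theorem isLip_amp₀ : IsLip M 7 amp₀ := ((isLip_id le_rfl).radial 0).const_mul _

theorem isLip_amp₁ : IsLip M 5 amp₁ :=
  ((isLip_amp₀.lap.add ((isLip_id (by norm_num)).mul
    (isLip_amp₀.mono (by norm_num)))).radial 1).const_mul _

theorem isLip_amp₂ : IsLip M 3 amp₂ :=
  ((isLip_amp₁.lap.add ((isLip_id (by norm_num)).mul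
    (isLip_amp₁.mono (by norm_num)))).radial 2).const_mul _

theorem isLip_defect : IsLip M 1 defect :=
  isLip_amp₂.lap.add ((isLip_id (by norm_num)).mul (isLip_amp₂.mono (by norm_num)))

theorem fderiv_const_mul_dir {f : Space → ℂ} {A : ℝ} (hf : BddC 1 A f) (c : ℂ) (x v : Space) :
    fderiv ℝ (fun x => c * f x) x v = c * fderiv ℝ f x v := by
  have hd : Differentiable ℝ f := hf.1.differentiable (by simp)
  rw [fderiv_mul_dir (differentiable_const c) hd]
  simp

variable {q : Space → ℂ}

theorem amp₀_transport (hq : BddC 7 M q) (x : Space) :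
    amp₀ q x + fderiv ℝ (amp₀ q) x x = q x / (8 * Real.pi) := by
  have hq1 := hq.mono (l := 1) (by norm_num) le_rfl
  have := radial_transport hq1 0 x
  unfold amp₀
  rw [fderiv_const_mul_dir (hq1.radial 0)]
  rw [← this]
  push_cast
  ring

theorem amp₁_transport (hq : BddC 7 M q) (x : Space) :
    8 * amp₁ q x + 4 * fderiv ℝ (amp₁ q) x x = lap (amp₀ q) x + q x * amp₀ q x := by
  obtain ⟨K, hK⟩ := (isLip_amp₀ (M := M)).bddC
  have h0 := hK q hq
  have h1 : BddC 1 _ fun x => lap (amp₀ q) x + q x * amp₀ q x :=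
    (h0.mono (l := 3) (by norm_num) le_rfl).lap.add
      ((hq.mono (by norm_num) le_rfl).mul (h0.mono (by norm_num) le_rfl))
  have := radial_transport h1 1 x
  rw [← this]
  unfold amp₁
  rw [fderiv_const_mul_dir (h1.radial 1)]
  push_cast
  ring

theorem amp₂_transport (hq : BddC 7 M q) (x : Space) :
    12 * amp₂ q x + 4 * fderiv ℝ (amp₂ q) x x = lap (amp₁ q) x + q x * amp₁ q x := by
  obtain ⟨K, hK⟩ := (isLip_amp₁ (M := M)).bddC
  have h0 := hK q hq
  have h1 : BddC 1 _ fun x => lap (amp₁ q) x + q x * amp₁ q x :=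
    (h0.mono (l := 3) (by norm_num) le_rfl).lap.add
      ((hq.mono (by norm_num) le_rfl).mul (h0.mono (by norm_num) le_rfl))
  have := radial_transport h1 2 x
  rw [← this]
  unfold amp₂
  rw [fderiv_const_mul_dir (h1.radial 2)]
  push_cast
  ring

end Amplitudes

/-! ### The source of the remainder and its damping -/

section Source

/-- The function `H(t - |x|) (t² - |x|²)² / 2`. -/
def ramp (p : Spacetime) : ℝ := max (max p.2 0 ^ 2 - ‖p.1‖ ^ 2) 0 ^ 2 / 2

theorem ramp_eq_zero {p : Spacetime} (h : p.2 ≤ ‖p.1‖) : ramp p = 0 := by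
  unfold ramp
  have : max p.2 0 ^ 2 ≤ ‖p.1‖ ^ 2 :=
    pow_le_pow_left₀ (le_max_right _ _) (max_le h (norm_nonneg _)) 2
  rw [max_eq_right (by linarith)]
  simp

theorem ofReal_ramp (p : Spacetime) :
    (ramp p : ℂ) = heaviside (p.2 - ‖p.1‖) * (lorentz p ^ 2 / 2) := by
  by_cases h : 0 < p.2 - ‖p.1‖
  · have h0 : 0 < p.2 := by linarith [norm_nonneg p.1]
    have h1 : ‖p.1‖ ^ 2 ≤ p.2 ^ 2 := pow_le_pow_left₀ (norm_nonneg _) (by linarith) 2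
    simp only [ramp, heaviside, h, if_true, lorentz, max_eq_left h0.le,
      max_eq_left (sub_nonneg.2 h1)]
    push_cast
    ring
  · rw [ramp_eq_zero (by linarith)]
    simp [heaviside, h]

/-- The square of a positive part is C¹. In `ramp` it is used twice: for t₊², which discards the
backward cone, and for the square of (t₊² - |x|²)₊. -/
theorem hasDerivAt_max_sq (x : ℝ) : HasDerivAt (fun x : ℝ => max x 0 ^ 2) (2 * max x 0) x := by
  rcases lt_trichotomy x 0 with h | h | h
  · refine (hasDerivAt_const x (0 : ℝ)).congr_of_eventuallyEq ?_ |>.congr_deriv ?_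
    · filter_upwards [eventually_lt_nhds h] with y hy
      simp [max_eq_right hy.le]
    · simp [max_eq_right h.le]
  · subst h
    rw [hasDerivAt_iff_isLittleO_nhds_zero]
    simp only [zero_add, max_self, ne_eq, OfNat.ofNat_ne_zero, not_false_eq_true, zero_pow, sub_zero,
      mul_zero, smul_zero]
    refine Asymptotics.IsBigO.trans_isLittleO (g := fun h : ℝ => h ^ 2) ?_ ?_
    · refine Asymptotics.IsBigO.of_bound 1 (Eventually.of_forall fun h => ?_)
      rw [one_mul, norm_pow, norm_pow]
      refine pow_le_pow_left₀ (norm_nonneg _) ?_ 2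
      rw [Real.norm_eq_abs, Real.norm_eq_abs, abs_of_nonneg (le_max_right h 0)]
      exact max_le (le_abs_self h) (abs_nonneg h)
    · exact Asymptotics.isLittleO_pow_id one_lt_two
  · refine (hasDerivAt_pow 2 x).congr_of_eventuallyEq ?_ |>.congr_deriv ?_
    · filter_upwards [eventually_gt_nhds h] with y hy
      simp [max_eq_left hy.le]
    · simp [max_eq_left h.le]

/-- The derivative of `ramp`. -/
def rampDeriv (p : Spacetime) : Spacetime →L[ℝ] ℝ :=
  max (max p.2 0 ^ 2 - ‖p.1‖ ^ 2) 0 • ((2 * max p.2 0) • ContinuousLinearMap.snd ℝ Space ℝ -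
    (2 : ℝ) • (innerSL ℝ p.1).comp (ContinuousLinearMap.fst ℝ Space ℝ))

theorem hasFDerivAt_ramp (p : Spacetime) : HasFDerivAt ramp (rampDeriv p) p := by
  have h1 := (hasDerivAt_max_sq p.2).comp_hasFDerivAt p (hasFDerivAt_snd (p := p) (𝕜 := ℝ))
  have h2 := (hasFDerivAt_fst (p := p) (𝕜 := ℝ) (E := Space) (F := ℝ)).norm_sq
  have h3 := (hasDerivAt_max_sq (max p.2 0 ^ 2 - ‖p.1‖ ^ 2)).comp_hasFDerivAt p (h1.sub h2)
  have h4 : HasFDerivAt ramp _ p := h3.mul_const (1 / 2) |>.congr_of_eventuallyEq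
    (Eventually.of_forall fun q => by simp [ramp]; ring)
  refine h4.congr_fderiv ?_
  ext v <;> simp [rampDeriv] <;> ring

theorem continuous_rampDeriv : Continuous rampDeriv := by
  unfold rampDeriv
  fun_prop

theorem abs_ramp_le (p : Spacetime) : |ramp p| ≤ max p.2 0 ^ 4 / 2 := by
  have h0 : 0 ≤ ramp p := by unfold ramp; positivity
  rw [abs_of_nonneg h0]
  unfold ramp
  have h1 : max (max p.2 0 ^ 2 - ‖p.1‖ ^ 2) 0 ≤ max p.2 0 ^ 2 :=
    max_le (by nlinarith [norm_nonneg p.1]) (by positivity)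
  have := pow_le_pow_left₀ (le_max_right _ _) h1 2
  nlinarith

theorem norm_rampDeriv_le (p : Spacetime) : ‖rampDeriv p‖ ≤ 4 * max p.2 0 ^ 3 := by
  by_cases h : p.2 ≤ ‖p.1‖
  · have h1 : max p.2 0 ^ 2 ≤ ‖p.1‖ ^ 2 :=
      pow_le_pow_left₀ (le_max_right _ _) (max_le h (norm_nonneg _)) 2
    unfold rampDeriv
    rw [max_eq_right (by linarith : max p.2 0 ^ 2 - ‖p.1‖ ^ 2 ≤ 0), zero_smul, norm_zero]
    positivity
  · push Not at h
    have hm : 0 ≤ max p.2 0 := le_max_right _ _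
    have h1 : max (max p.2 0 ^ 2 - ‖p.1‖ ^ 2) 0 ≤ max p.2 0 ^ 2 :=
      max_le (by nlinarith [norm_nonneg p.1]) (by positivity)
    have h2 : ‖p.1‖ ≤ max p.2 0 := h.le.trans (le_max_left _ _)
    unfold rampDeriv
    rw [norm_smul, Real.norm_of_nonneg (le_max_right _ _)]
    have h3 : ‖(2 * max p.2 0) • ContinuousLinearMap.snd ℝ Space ℝ‖ ≤ 2 * max p.2 0 := by
      rw [norm_smul, Real.norm_of_nonneg (by positivity)]
      exact mul_le_of_le_one_right (by positivity) (ContinuousLinearMap.norm_snd_le ..)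
    have h4 : ‖(2 : ℝ) • (innerSL ℝ p.1).comp (ContinuousLinearMap.fst ℝ Space ℝ)‖ ≤
        2 * max p.2 0 := by
      rw [norm_smul, Real.norm_of_nonneg (by positivity)]
      refine mul_le_mul_of_nonneg_left ((ContinuousLinearMap.opNorm_comp_le _ _).trans ?_) (by simp)
      rw [innerSL_apply_norm]
      exact (mul_le_of_le_one_right (norm_nonneg _) (ContinuousLinearMap.norm_fst_le ..)).trans h2
    calc _ ≤ max p.2 0 ^ 2 * (2 * max p.2 0 + 2 * max p.2 0) :=
          mul_le_mul h1 ((norm_sub_le _ _).trans (add_le_add h3 h4)) (norm_nonneg _) (by positivity)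
      _ = _ := by ring

theorem exp_mul_max_pow_le {ℓ : ℝ} (hℓ : 1 ≤ ℓ) (t : ℝ) (n : ℕ) :
    Real.exp (-(ℓ * t)) * max t 0 ^ (n + 1) ≤ (n + 1).factorial := by
  rcases le_or_gt t 0 with h | h
  · rw [max_eq_right h, zero_pow (by omega), mul_zero]
    positivity
  · rw [max_eq_left h.le]
    have h1 := Real.pow_div_factorial_le_exp t h.le (n + 1)
    rw [div_le_iff₀ (by positivity)] at h1
    have h2 : Real.exp (-(ℓ * t)) ≤ Real.exp (-t) := Real.exp_le_exp.2 (by nlinarith)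
    calc Real.exp (-(ℓ * t)) * t ^ (n + 1)
        ≤ Real.exp (-t) * (Real.exp t * (n + 1).factorial) := by gcongr
      _ = (n + 1).factorial := by rw [← mul_assoc, ← Real.exp_add]; simp

/-- The damped source profile. -/
def dampedRamp (ℓ : ℝ) (p : Spacetime) : ℂ := ((Real.exp (-(ℓ * p.2)) * ramp p : ℝ) : ℂ)

/-- The profile and its derivative are at most t⁴/2 and 4t³ for t > 0, and tᵐ e^{-t} ≤ m!. This
gives 4!/2 = 12 and 4 · 3! = 24; differentiating the exponential adds 12ℓ. -/
theorem bddC_dampedRamp {ℓ : ℝ} (hℓ : 1 ≤ ℓ) : BddC 1 (24 + 12 * ℓ) (dampedRamp ℓ) := by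
  have hd : ∀ p : Spacetime, HasFDerivAt (fun p : Spacetime => Real.exp (-(ℓ * p.2)) * ramp p)
      (Real.exp (-(ℓ * p.2)) • (rampDeriv p - (ℓ * ramp p) • ContinuousLinearMap.snd ℝ Space ℝ))
      p := by
    intro p
    have h1 : HasFDerivAt (fun p : Spacetime => Real.exp (-(ℓ * p.2))) _ p :=
      ((hasFDerivAt_snd (p := p) (𝕜 := ℝ)).const_mul ℓ).neg.exp
    refine (h1.mul (hasFDerivAt_ramp p)).congr_fderiv ?_
    ext v <;> simp
    ring
  have hd' : ∀ p, HasFDerivAt (dampedRamp ℓ) _ p := fun p =>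
    Complex.ofRealCLM.hasFDerivAt.comp p (hd p)
  have hr0 : Continuous ramp := continuous_iff_continuousAt.2 fun p =>
    (hasFDerivAt_ramp p).continuousAt
  have b0 : ∀ p : Spacetime, Real.exp (-(ℓ * p.2)) * |ramp p| ≤ 12 := by
    intro p
    have h1 := exp_mul_max_pow_le hℓ p.2 3
    have h2 := mul_le_mul_of_nonneg_left (abs_ramp_le p) (Real.exp_pos (-(ℓ * p.2))).le
    norm_num [Nat.factorial] at h1
    linarith
  have b1 : ∀ p : Spacetime, Real.exp (-(ℓ * p.2)) * ‖rampDeriv p‖ ≤ 24 := by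
    intro p
    have h1 := exp_mul_max_pow_le hℓ p.2 2
    have h2 := mul_le_mul_of_nonneg_left (norm_rampDeriv_le p) (Real.exp_pos (-(ℓ * p.2))).le
    norm_num [Nat.factorial] at h1
    linarith
  refine bddC_succ_iff.2 ⟨fun p => ?_, fun p => (hd' p).differentiableAt, bddC_zero_iff.2 ⟨?_, ?_⟩⟩
  · unfold dampedRamp
    rw [Complex.norm_real, norm_mul, Real.norm_of_nonneg (Real.exp_pos _).le, Real.norm_eq_abs]
    linarith [b0 p]
  · rw [show fderiv ℝ (dampedRamp ℓ) = _ from funext fun p => (hd' p).fderiv]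
    have := continuous_rampDeriv
    exact continuous_const.clm_comp ((by fun_prop : Continuous fun p : Spacetime =>
      Real.exp (-(ℓ * p.2))).smul (this.sub ((continuous_const.mul hr0).smul continuous_const)))
  · intro p
    rw [(hd' p).fderiv]
    refine (ContinuousLinearMap.opNorm_comp_le _ _).trans ?_
    rw [Complex.ofRealCLM_norm, one_mul, norm_smul, Real.norm_of_nonneg (Real.exp_pos _).le]
    have h1 : ‖(ℓ * ramp p) • ContinuousLinearMap.snd ℝ Space ℝ‖ ≤ ℓ * |ramp p| := by
      rw [norm_smul, norm_mul, Real.norm_of_nonneg (by linarith), Real.norm_eq_abs]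
      exact mul_le_of_le_one_right (by positivity) (ContinuousLinearMap.norm_snd_le ..)
    calc _ ≤ Real.exp (-(ℓ * p.2)) * (‖rampDeriv p‖ + ℓ * |ramp p|) := by
          gcongr
          exact (norm_sub_le _ _).trans (by linarith)
      _ = Real.exp (-(ℓ * p.2)) * ‖rampDeriv p‖ + ℓ * (Real.exp (-(ℓ * p.2)) * |ramp p|) := by ring
      _ ≤ 24 + ℓ * 12 := add_le_add (b1 p) (mul_le_mul_of_nonneg_left (b0 p) (by linarith))
      _ = _ := by ring

end Source

instance : (volume : Measure Spacetime).IsAddHaarMeasure :=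
  inferInstanceAs ((volume : Measure Space).prod (volume : Measure ℝ)).IsAddHaarMeasure

/-- Averages over translates are adjoint to averages over the opposite translates. -/
theorem integral_avg_mul {Ω : Type} [MeasurableSpace Ω] {μ : Measure Ω} [SFinite μ] {κ : Ω → ℝ}
    {τ : Ω → Spacetime} (hκ : Integrable κ μ) (hτ : Measurable τ) {f g : Spacetime → ℂ} {A : ℝ}
    (hf : BddC 0 A f) (hg : Continuous g) (hgi : Integrable g) :
    ∫ p, avg μ κ (fun _ => 1) τ f p * g p =
      ∫ p, f p * avg μ κ (fun _ => 1) (fun ω => -τ ω) g p := by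
  have hfc := hf.1.continuous
  let F : Ω × Spacetime → ℂ := fun x => κ x.1 • (f x.2 * g (x.2 - τ x.1))
  let Θ : Ω × Spacetime → Ω × Spacetime := fun x => (x.1, x.2 + τ x.1)
  -- Θ translates each fibre, so it preserves the product measure. The adjointness is this change of
  -- variables combined with Fubini.
  have hΘ : MeasurePreserving Θ (μ.prod volume) (μ.prod volume) :=
    (MeasurePreserving.id μ).skew_product (g := fun ω p => p + τ ω)
      (measurable_snd.add (hτ.comp measurable_fst))
      (Eventually.of_forall fun ω => map_add_right_eq_self volume (τ ω))
  have hF : AEStronglyMeasurable F (μ.prod volume) :=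
    hκ.1.comp_fst.smul ((hfc.measurable.comp measurable_snd).mul
      (hg.measurable.comp (measurable_snd.sub (hτ.comp measurable_fst)))).aestronglyMeasurable
  have hFΘ : ∀ x, F (Θ x) = κ x.1 • (f (x.2 + τ x.1) * g x.2) := fun x => by simp [F, Θ]
  have hi1 : Integrable (F ∘ Θ) (μ.prod volume) := by
    refine ((hκ.norm.mul_prod hgi.norm).const_mul A).mono'
      (hF.comp_measurePreserving hΘ) (Eventually.of_forall fun x => ?_)
    rw [Function.comp_apply, hFΘ, norm_smul, norm_mul]
    have := hf.norm_le (x.2 + τ x.1)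
    calc ‖κ x.1‖ * (‖f (x.2 + τ x.1)‖ * ‖g x.2‖) ≤ ‖κ x.1‖ * (A * ‖g x.2‖) := by gcongr
      _ = _ := by ring
  have hi2 : Integrable F (μ.prod volume) := (hΘ.integrable_comp hF).1 hi1
  have e1 : ∫ x, F (Θ x) ∂(μ.prod volume) = ∫ x, F x ∂(μ.prod volume) := by
    have h := integral_map hΘ.measurable.aemeasurable (f := F) (by rwa [hΘ.map_eq])
    rw [hΘ.map_eq] at h
    exact h.symm
  have l1 : ∫ p, avg μ κ (fun _ => 1) τ f p * g p = ∫ x, F (Θ x) ∂(μ.prod volume) := by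
    rw [integral_prod_symm (fun x => F (Θ x)) hi1]
    refine integral_congr_ae (Eventually.of_forall fun p => ?_)
    simp only [avg, one_smul, hFΘ]
    rw [← integral_mul_const]
    refine integral_congr_ae (Eventually.of_forall fun ω => ?_)
    simp only [smul_mul_assoc]
  have l2 : ∫ p, f p * avg μ κ (fun _ => 1) (fun ω => -τ ω) g p = ∫ x, F x ∂(μ.prod volume) := by
    rw [integral_prod_symm _ hi2]
    refine integral_congr_ae (Eventually.of_forall fun p => ?_)
    simp only [avg, one_smul, F]
    rw [← integral_const_mul]
    refine integral_congr_ae (Eventually.of_forall fun ω => ?_)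
    simp only [mul_smul_comm, sub_eq_add_neg]
  rw [l1, l2, e1]

/-! ### The remainder and the weak form of the equation -/

section Remainder

/-- The exponentially damped remainder. -/
def dampedRemainder (ℓ : ℝ) (q : Space → ℂ) : Spacetime → ℂ :=
  resolvent ℓ 1 q fun p => dampedRamp ℓ p * defect q p.1

/-- The remainder of the progressing wave expansion. -/
def remainder (ℓ : ℝ) (q : Space → ℂ) (p : Spacetime) : ℂ :=
  (Real.exp (ℓ * p.2) : ℂ) * dampedRemainder ℓ q p

variable {M ℓ : ℝ} {q : Space → ℂ}

theorem isLip_dampedRemainder (hℓ : 1 ≤ ℓ) (hM : 2 ^ 7 * M * 2 ≤ ℓ ^ 2) :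
    IsLip M 1 fun q => dampedRemainder ℓ q :=
  ((isLip_const (bddC_dampedRamp hℓ)).mul isLip_defect.comp_fst).resolvent (by linarith)
    (by norm_num) (by nlinarith)

theorem contDiff_remainder (hℓ : 1 ≤ ℓ) (hM : 2 ^ 7 * M * 2 ≤ ℓ ^ 2) (hq : BddC 7 M q) :
    ContDiff ℝ 1 (remainder ℓ q) := by
  obtain ⟨K, hK⟩ := (isLip_dampedRemainder hℓ hM).bddC
  exact (Complex.ofRealCLM.contDiff.comp (by fun_prop : ContDiff ℝ 1 fun p : Spacetime =>
    Real.exp (ℓ * p.2))).mul (hK q hq).1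

/-- The source lives in the open forward cone, which retarded potentials preserve: |x - z| < t - |z|
implies |x| < t. Hence the factor H(t-|x|) does not change the remainder. -/
theorem remainder_eq_zero {p : Spacetime} (hp : p.2 ≤ ‖p.1‖) : remainder ℓ q p = 0 := by
  have : dampedRemainder ℓ q p = 0 := by
    by_contra h
    have := support_resolvent (S := {p : Spacetime | ‖p.1‖ < p.2}) (fun p z h => ?_)
      (fun p h => ?_) p h
    · exact absurd hp (not_le.2 this)
    · simp only [mem_ofPred_eq, Prod.fst_add, Prod.snd_add, one_mul] at h ⊢
      have h1 := norm_sub_norm_le p.1 z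
      rw [← sub_eq_add_neg] at h
      linarith
    · by_contra hc
      refine h ?_
      simp [dampedRamp, ramp_eq_zero (not_lt.1 hc)]
  simp [remainder, this]

/-- The remainder is only known to be C¹, so its wave equation is proved weakly: the retarded
potential is moved onto the test function, where it becomes an advanced potential inverting `box`.
-/
theorem integral_remainder_mul_box (hℓ : 1 ≤ ℓ) (hM : 2 ^ 7 * M * 2 ≤ ℓ ^ 2) (hq : BddC 7 M q)
    {φ : Spacetime → ℂ} (hφ : ContDiff ℝ 2 φ) (hc : HasCompactSupport φ)
    (hbc : HasCompactSupport (box φ)) :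
    ∫ p, remainder ℓ q p * box φ p =
      ∫ p, ((ramp p : ℂ) * defect q p.1 + q p.1 * remainder ℓ q p) * φ p := by
  have hℓ0 : 0 < ℓ := by linarith
  obtain ⟨K, hK⟩ := (isLip_dampedRemainder hℓ hM).bddC
  obtain ⟨K', hK'⟩ := (((isLip_const (bddC_dampedRamp hℓ)).mul
    isLip_defect.comp_fst : IsLip M 1 fun q (p : Spacetime) => dampedRamp ℓ p * defect q p.1)).bddC
  have hg := hK q hq
  have hF := hK' q hq
  have hq1 := hq.mono (l := 1) (by norm_num) le_rfl
  have heq := resolvent_eq (ε := 1) hℓ0 hq1 (by nlinarith [hq.nonneg]) hF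
  have hG := hF.add (hq1.comp_fst.mul hg)
  have hbcont : Continuous (box φ) := by
    refine (contDiff_dd (k := 0) hφ _).continuous.sub
      (continuous_finsetSum _ fun i _ => (contDiff_dd (k := 0) hφ _).continuous)
  have hexp : Continuous fun p : Spacetime => (Real.exp (ℓ * p.2) : ℂ) := by fun_prop
  obtain ⟨R, hR⟩ := exists_late_of_hasCompactSupport hc
  -- The damping e^{-ℓ|z|} cancels the growth of e^{ℓ(t+|z|)}, leaving the undamped fundamental
  -- solution applied to the translate of φ by p.
  have key : ∀ p, avg volume (ker ℓ) (fun _ => 1)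
      (fun z : Space => -((-z, -(1 * ‖z‖)) : Spacetime))
      (fun p => (Real.exp (ℓ * p.2) : ℂ) * box φ p) p = (Real.exp (ℓ * p.2) : ℂ) * φ p := by
    intro p
    have h1 := integral_box_cone (h := fun x => φ (p + x)) (R := R - p.2)
      (hφ.comp (contDiff_const.add contDiff_id)) (fun x hx => hR _ (by simp; linarith))
    simp only [box_comp_add_left, add_zero] at h1
    rw [← h1, ← integral_const_mul]
    refine integral_congr_ae (Eventually.of_forall fun z => ?_)
    have hz : -((-z, -(1 * ‖z‖)) : Spacetime) = (z, ‖z‖) := by simp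
    simp only [hz, one_smul, Complex.real_smul, ker, Prod.snd_add, mul_add, Real.exp_add,
      Real.exp_neg]
    have := (Real.exp_pos (ℓ * ‖z‖)).ne'
    push_cast
    have h2 : Complex.exp (ℓ * ‖z‖) ≠ 0 := Complex.exp_ne_zero _
    field_simp
  have h1 := integral_avg_mul (g := fun p => (Real.exp (ℓ * p.2) : ℂ) * box φ p)
    (integrable_ker hℓ0)
    (by fun_prop : Measurable fun z : Space => ((-z, -(1 * ‖z‖)) : Spacetime))
    (hG.mono (Nat.zero_le _) le_rfl) (hexp.mul hbcont)
    ((hexp.mul hbcont).integrable_of_hasCompactSupport hbc.mul_left)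
  calc ∫ p, remainder ℓ q p * box φ p
      = ∫ p, pot ℓ 1 (fun p => dampedRamp ℓ p * defect q p.1 + q p.1 * dampedRemainder ℓ q p) p *
          ((Real.exp (ℓ * p.2) : ℂ) * box φ p) := by
        refine integral_congr_ae (Eventually.of_forall fun p => ?_)
        simp only [remainder]
        unfold dampedRemainder
        rw [← heq p]
        ring
    _ = ∫ p, (dampedRamp ℓ p * defect q p.1 + q p.1 * dampedRemainder ℓ q p) *
          ((Real.exp (ℓ * p.2) : ℂ) * φ p) :=
        h1.trans (integral_congr_ae (Eventually.of_forall fun p => congrArg (_ * ·) (key p)))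
    _ = _ := by
        refine integral_congr_ae (Eventually.of_forall fun p => ?_)
        have : Complex.exp (ℓ * p.2) * Complex.exp (-(ℓ * p.2)) = 1 := by
          rw [← Complex.exp_add]; simp
        simp only [remainder, dampedRamp]
        push_cast
        linear_combination (ramp p * defect q p.1 * φ p) * this

/-- A cutoff equal to one inside the light cone and vanishing far outside of it. -/
def coneCutoff (p : Spacetime) : ℂ := (Real.smoothTransition (p.2 ^ 2 - ‖p.1‖ ^ 2 + 1) : ℂ)

theorem contDiff_coneCutoff {k : ℕ} : ContDiff ℝ k coneCutoff :=
  Complex.ofRealCLM.contDiff.comp (Real.smoothTransition.contDiff.comp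
    (((contDiff_snd.pow 2).sub (contDiff_fst.norm_sq ℝ)).add contDiff_const))

/-- After multiplication by H(t-|x|) the cutoff is invisible. It is needed because σ is unbounded in
x at fixed t, whereas the regular part has to be bounded on all of ℝ³ × [0,T]. -/
theorem coneCutoff_eq_one {p : Spacetime} (hp : ‖p.1‖ ≤ p.2) : coneCutoff p = 1 := by
  have : ‖p.1‖ ^ 2 ≤ p.2 ^ 2 := pow_le_pow_left₀ (norm_nonneg _) hp 2
  simp [coneCutoff, Real.smoothTransition.one_of_one_le (by linarith : 1 ≤ p.2 ^ 2 - ‖p.1‖ ^ 2 + 1)]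

theorem coneCutoff_eq_zero {p : Spacetime} (hp : p.2 ^ 2 + 1 ≤ ‖p.1‖ ^ 2) : coneCutoff p = 0 := by
  simp [coneCutoff, Real.smoothTransition.zero_of_nonpos
    (by linarith : p.2 ^ 2 - ‖p.1‖ ^ 2 + 1 ≤ 0)]

/-- The progressing wave attached to the potential `q`. -/
def wave (q : Space → ℂ) : Spacetime → ℂ := ansatz (amp₀ q) (amp₁ q) (amp₂ q)

/-- The regular part of the fundamental solution with pole at the origin. -/
def regularPart (ℓ : ℝ) (q : Space → ℂ) (p : Spacetime) : ℂ :=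
  coneCutoff p * wave q p + remainder ℓ q p

theorem contDiff_wave (hq : BddC 7 M q) : ContDiff ℝ 2 (wave q) := by
  obtain ⟨K₀, h₀⟩ := (isLip_amp₀ (M := M)).bddC
  obtain ⟨K₁, h₁⟩ := (isLip_amp₁ (M := M)).bddC
  obtain ⟨K₂, h₂⟩ := (isLip_amp₂ (M := M)).bddC
  exact contDiff_ansatz ((h₀ q hq).1.of_le (by norm_num)) ((h₁ q hq).1.of_le (by norm_num))
    ((h₂ q hq).1.of_le (by norm_num))

theorem box_wave (hq : BddC 7 M q) (p : Spacetime) :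
    box (wave q) p = q p.1 * wave q p - lorentz p ^ 2 / 2 * defect q p.1 := by
  obtain ⟨K₀, h₀⟩ := (isLip_amp₀ (M := M)).bddC
  obtain ⟨K₁, h₁⟩ := (isLip_amp₁ (M := M)).bddC
  obtain ⟨K₂, h₂⟩ := (isLip_amp₂ (M := M)).bddC
  exact box_ansatz ((h₀ q hq).1.of_le (by norm_num)) ((h₁ q hq).1.of_le (by norm_num))
    ((h₂ q hq).1.of_le (by norm_num)) (amp₁_transport hq) (amp₂_transport hq) p

theorem wave_cone (hq : BddC 7 M q) {z : Space} (hz : z ≠ 0) :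
    fderiv ℝ (wave q) (z, ‖z‖) timeDir +
        (∑ i, (z i * ‖z‖⁻¹) • fderiv ℝ (wave q) (z, ‖z‖) (spaceDir i, 0)) +
        ‖z‖⁻¹ • wave q (z, ‖z‖) = q z / (8 * Real.pi * ‖z‖) := by
  obtain ⟨K₀, h₀⟩ := (isLip_amp₀ (M := M)).bddC
  obtain ⟨K₁, h₁⟩ := (isLip_amp₁ (M := M)).bddC
  obtain ⟨K₂, h₂⟩ := (isLip_amp₂ (M := M)).bddC
  exact ansatz_cone ((h₀ q hq).1.of_le (by norm_num)) ((h₁ q hq).1.of_le (by norm_num))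
    ((h₂ q hq).1.of_le (by norm_num)) (amp₀_transport hq) hz

theorem contDiff_regularPart (hℓ : 1 ≤ ℓ) (hM : 2 ^ 7 * M * 2 ≤ ℓ ^ 2) (hq : BddC 7 M q) :
    ContDiff ℝ 1 (regularPart ℓ q) :=
  (contDiff_coneCutoff.mul ((contDiff_wave hq).of_le (by norm_num))).add
    (contDiff_remainder hℓ hM hq)

theorem hasCompactSupport_dd {φ : Spacetime → ℂ} (hc : HasCompactSupport φ) (v : Spacetime) :
    HasCompactSupport (dd v φ) :=
  (hc.fderiv_apply ℝ v).fderiv_apply ℝ v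

theorem hasCompactSupport_box {φ : Spacetime → ℂ} (hc : HasCompactSupport φ) :
    HasCompactSupport (box φ) := by
  have : box φ = fun p => dd timeDir φ p - (dd ((spaceDir 0, 0) : Spacetime) φ p +
      dd ((spaceDir 1, 0) : Spacetime) φ p + dd ((spaceDir 2, 0) : Spacetime) φ p) := by
    ext p
    simp [box, Fin.sum_univ_three]
  rw [this]
  exact (hasCompactSupport_dd hc _).sub (((hasCompactSupport_dd hc _).add
    (hasCompactSupport_dd hc _)).add (hasCompactSupport_dd hc _))

theorem continuous_box {φ : Spacetime → ℂ} (hφ : ContDiff ℝ 2 φ) : Continuous (box φ) :=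
  (contDiff_dd (k := 0) hφ _).continuous.sub
    (continuous_finsetSum _ fun _ _ => (contDiff_dd (k := 0) hφ _).continuous)

/-- The weak form of the point source problem with pole at the origin. -/
theorem weak_equation (hℓ : 1 ≤ ℓ) (hM : 2 ^ 7 * M * 2 ≤ ℓ ^ 2) (hq : BddC 7 M q)
    {φ : Spacetime → ℂ} (hφ : ContDiff ℝ 2 φ) (hc : HasCompactSupport φ) :
    (∫ z : Space, (4 * Real.pi * ‖z‖)⁻¹ • (box φ (z, ‖z‖) - q z * φ (z, ‖z‖))) +
      ∫ p : Spacetime, heaviside (p.2 - ‖p.1‖) •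
        (regularPart ℓ q p * (box φ p - q p.1 * φ p)) = φ 0 := by
  obtain ⟨R, hR⟩ := exists_late_of_hasCompactSupport hc
  obtain ⟨R', hR'⟩ := exists_late_of_hasCompactSupport (hasCompactSupport_box hc)
  have hqc := hq.1.continuous
  have hφc := hφ.continuous
  have hbc := continuous_box hφ
  have hv := contDiff_wave hq
  have hvc := hv.continuous
  have hbv := continuous_box hv
  have hw := (contDiff_remainder hℓ hM hq).continuous
  have hcone : ∀ F : Spacetime → ℂ, Continuous F → (∃ R, ∀ p : Spacetime, R < p.2 → F p = 0) →
      Integrable fun z : Space => (4 * Real.pi * ‖z‖)⁻¹ • F (z, ‖z‖) := by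
    intro F hF ⟨R, hR⟩
    refine integrable_cone (C := 1) hF hR (by fun_prop) fun z => ?_
    rw [mul_inv, abs_mul, mul_assoc]
    have h1 := abs_inv_norm_le z
    have h2 : |(4 * Real.pi)⁻¹| ≤ 1 := by
      rw [abs_of_nonneg (by positivity)]
      exact inv_le_one_of_one_le₀ (by linarith [Real.pi_gt_three])
    calc _ ≤ 1 * (1 * (1 + ‖z‖)) := by gcongr
      _ = _ := by ring
  have i1 := hcone _ hbc ⟨R', hR'⟩
  have i2 := hcone (fun p => q p.1 * φ p) (by fun_prop)
    ⟨R, fun p hp => by rw [hR p hp, mul_zero]⟩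
  have e1 : ∫ z : Space, (4 * Real.pi * ‖z‖)⁻¹ • (box φ (z, ‖z‖) - q z * φ (z, ‖z‖)) =
      φ 0 - ∫ z : Space, (4 * Real.pi * ‖z‖)⁻¹ • (q z * φ (z, ‖z‖)) := by
    simp_rw [smul_sub]
    rw [integral_sub i1 i2, integral_box_cone hφ hR]
  have hH : Measurable fun p : Spacetime => p.2 - ‖p.1‖ := by fun_prop
  have hbcs := hasCompactSupport_box hc
  have j1 : Integrable fun p : Spacetime => heaviside (p.2 - ‖p.1‖) •
      (wave q p * box φ p - φ p * box (wave q) p) :=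
    integrable_heaviside_smul (((hvc.mul hbc).sub (hφc.mul hbv)).integrable_of_hasCompactSupport
      (hbcs.mul_left.sub hc.mul_right)) hH
  have j2 : Integrable fun p : Spacetime => remainder ℓ q p * box φ p :=
    (hw.mul hbc).integrable_of_hasCompactSupport hbcs.mul_left
  have hdc : Continuous fun p : Spacetime => defect q p.1 := by
    obtain ⟨K, hK⟩ := (isLip_defect (M := M)).bddC
    exact (hK q hq).1.continuous.comp continuous_fst
  have hrc : Continuous ramp := by unfold ramp; fun_prop
  have hrcC : Continuous fun p => (ramp p : ℂ) := by fun_prop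
  have hq1 : Continuous fun p : Spacetime => q p.1 := by fun_prop
  have j3 : Integrable fun p : Spacetime =>
      ((ramp p : ℂ) * defect q p.1 + q p.1 * remainder ℓ q p) * φ p :=
    (((hrcC.mul hdc).add (hq1.mul hw)).mul hφc).integrable_of_hasCompactSupport hc.mul_left
  -- Inside the cone v(box φ - qφ) equals v box φ - φ box v minus the defect term. The remainder's
  -- weak equation absorbs the defect.
  have e2 : ∫ p : Spacetime, heaviside (p.2 - ‖p.1‖) •
      (regularPart ℓ q p * (box φ p - q p.1 * φ p)) =
      (∫ p : Spacetime, heaviside (p.2 - ‖p.1‖) •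
        (wave q p * box φ p - φ p * box (wave q) p)) +
      ((∫ p, remainder ℓ q p * box φ p) -
        ∫ p, ((ramp p : ℂ) * defect q p.1 + q p.1 * remainder ℓ q p) * φ p) := by
    have j4 : Integrable fun p : Spacetime => remainder ℓ q p * box φ p -
        ((ramp p : ℂ) * defect q p.1 + q p.1 * remainder ℓ q p) * φ p := j2.sub j3
    rw [← integral_sub j2 j3, ← integral_add j1 j4]
    refine integral_congr_ae (Eventually.of_forall fun p => ?_)
    simp only [ofReal_ramp, box_wave hq, regularPart, Complex.real_smul]
    by_cases hp : 0 < p.2 - ‖p.1‖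
    · rw [coneCutoff_eq_one (by linarith : ‖p.1‖ ≤ p.2)]
      simp only [heaviside, hp, if_true]
      push_cast
      ring
    · rw [remainder_eq_zero (by linarith : p.2 ≤ ‖p.1‖)]
      simp [heaviside, hp]
  rw [e1, e2, integral_remainder_mul_box hℓ hM hq hφ hc hbcs, sub_self, add_zero,
    integral_green_cone hv hφ hc]
  -- By the jump condition the Green boundary term is 2 · q/(8π|z|) = q/(4π|z|) times φ, exactly the
  -- potential term left by the cone measure.
  have e3 : ∫ z : Space, 2 * φ (z, ‖z‖) * (fderiv ℝ (wave q) (z, ‖z‖) timeDir +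
      (∑ i, (z i * ‖z‖⁻¹) • fderiv ℝ (wave q) (z, ‖z‖) (spaceDir i, 0)) +
      ‖z‖⁻¹ • wave q (z, ‖z‖)) =
      ∫ z : Space, (4 * Real.pi * ‖z‖)⁻¹ • (q z * φ (z, ‖z‖)) := by
    refine integral_congr_ae ?_
    filter_upwards [Measure.ae_ne volume (0 : Space)] with z hz
    rw [wave_cone hq hz, Complex.real_smul]
    have h1 : (‖z‖ : ℂ) ≠ 0 := by exact_mod_cast norm_ne_zero_iff.2 hz
    have h2 : (Real.pi : ℂ) ≠ 0 := by exact_mod_cast Real.pi_ne_zero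
    push_cast
    field_simp
    ring
  rw [e3]
  ring

end Remainder

/-! ### Bounds for the regular part on bounded time intervals -/

section Bounds

/-- A smooth cutoff in time, equal to one near `[-T, T]`. -/
def timeBump (T : ℝ) : ContDiffBump (0 : ℝ) :=
  ⟨|T| + 1, |T| + 2, by positivity, by linarith⟩

def timeCutoff (T : ℝ) (p : Spacetime) : ℂ := (timeBump T p.2 : ℂ)

theorem contDiff_timeCutoff (T : ℝ) {k : ℕ} : ContDiff ℝ k (timeCutoff T) :=
  Complex.ofRealCLM.contDiff.comp ((timeBump T).contDiff.comp contDiff_snd)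

theorem timeCutoff_eq_one {T : ℝ} {p : Spacetime} (hp : |p.2| ≤ |T| + 1) : timeCutoff T p = 1 := by
  have : p.2 ∈ closedBall (0 : ℝ) (timeBump T).rIn := by
    rw [mem_closedBall_zero_iff]
    exact hp
  simp [timeCutoff, (timeBump T).one_of_mem_closedBall this]

theorem timeCutoff_eq_zero {T : ℝ} {p : Spacetime} (hp : |T| + 2 ≤ |p.2|) : timeCutoff T p = 0 := by
  have : (timeBump T).rOut ≤ dist p.2 0 := by
    rw [dist_zero_right]
    exact hp
  simp [timeCutoff, (timeBump T).zero_of_le_dist this]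

theorem hasCompactSupport_timeCutoff_mul_coneCutoff (T : ℝ) :
    HasCompactSupport fun p => timeCutoff T p * coneCutoff p := by
  -- Where |t| < |T| + 2, the cone cutoff vanishes once |x| > |T| + 4, since (|T|+4)² ≥ (|T|+2)² +
  -- 1.
  refine HasCompactSupport.intro (isCompact_closedBall (0 : Spacetime) (|T| + 4)) fun p hp => ?_
  rw [mem_closedBall_zero_iff, Prod.norm_def, sup_le_iff, not_and_or] at hp
  by_cases h : |T| + 2 ≤ |p.2|
  · rw [timeCutoff_eq_zero h, zero_mul]
  · have h2 : |T| + 4 < ‖p.1‖ := by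
      rcases hp with hp | hp
      · exact not_le.1 hp
      · rw [Real.norm_eq_abs] at hp
        linarith
    rw [coneCutoff_eq_zero, mul_zero]
    rw [← sq_abs p.2]
    nlinarith [abs_nonneg p.2, abs_nonneg T]

theorem exists_bddC_cutoff_mul (T : ℝ) {k : ℕ} {m : Spacetime → ℂ} (hm : ContDiff ℝ k m) :
    ∃ B, BddC k B fun p => timeCutoff T p * coneCutoff p * m p :=
  exists_bddC_of_hasCompactSupport (((contDiff_timeCutoff T).mul contDiff_coneCutoff).mul hm)
    (hasCompactSupport_timeCutoff_mul_coneCutoff T).mul_right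

theorem exists_bddC_cutoff_exp (T ℓ : ℝ) {k : ℕ} :
    ∃ B, BddC k B fun p : Spacetime => timeCutoff T p * (Real.exp (ℓ * p.2) : ℂ) := by
  have h1 : ContDiff ℝ k fun t : ℝ => ((timeBump T t : ℝ) : ℂ) * (Real.exp (ℓ * t) : ℂ) :=
    (Complex.ofRealCLM.contDiff.comp (timeBump T).contDiff).mul
      (Complex.ofRealCLM.contDiff.comp (f := fun t : ℝ => Real.exp (ℓ * t)) (by fun_prop))
  have h2 : HasCompactSupport fun t : ℝ => ((timeBump T t : ℝ) : ℂ) * (Real.exp (ℓ * t) : ℂ) :=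
    ((timeBump T).hasCompactSupport.comp_left (g := fun x : ℝ => (x : ℂ)) (by simp)).mul_right
  obtain ⟨B, hB⟩ := exists_bddC_of_hasCompactSupport h1 h2
  exact ⟨B, hB.comp_snd⟩

variable {M ℓ : ℝ}

/-- The time cutoff turns the unbounded coefficients 1, σ, σ²/2 (with the cone cutoff) and e^{ℓt}
into fixed multipliers with bounded C¹ norm, so the Lipschitz calculus applies term by term. -/
theorem isLip_cutoff_regularPart (T : ℝ) (hℓ : 1 ≤ ℓ) (hM : 2 ^ 7 * M * 2 ≤ ℓ ^ 2) :
    IsLip M 1 fun q p => timeCutoff T p * regularPart ℓ q p := by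
  obtain ⟨B₀, h₀⟩ := exists_bddC_cutoff_mul T (k := 1) (m := fun _ => 1) contDiff_const
  obtain ⟨B₁, h₁⟩ := exists_bddC_cutoff_mul T (k := 1) contDiff_lorentz
  obtain ⟨B₂, h₂⟩ := exists_bddC_cutoff_mul T (k := 1) (m := fun p => lorentz p * lorentz p * (1 / 2))
    ((contDiff_lorentz.mul contDiff_lorentz).mul contDiff_const)
  obtain ⟨B₃, h₃⟩ := exists_bddC_cutoff_exp T ℓ (k := 1)
  have l₀ : IsLip M 1 amp₀ := isLip_amp₀.mono (by norm_num)
  have l₁ : IsLip M 1 amp₁ := isLip_amp₁.mono (by norm_num)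
  have l₂ : IsLip M 1 amp₂ := isLip_amp₂.mono (by norm_num)
  have := ((((isLip_const h₀).mul l₀.comp_fst).add ((isLip_const h₁).mul l₁.comp_fst)).add
    ((isLip_const h₂).mul l₂.comp_fst)).add
    ((isLip_const h₃).mul (isLip_dampedRemainder hℓ hM))
  convert this using 3 with q p
  simp only [regularPart, wave, ansatz, remainder]
  ring

theorem cutoff_eventuallyEq {T : ℝ} {p : Spacetime} (hp : |p.2| ≤ |T|) (f : Spacetime → ℂ) :
    (fun p => timeCutoff T p * f p) =ᶠ[𝓝 p] f := by
  have : ∀ᶠ x : Spacetime in 𝓝 p, |x.2| < |T| + 1 :=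
    (by fun_prop : Continuous fun x : Spacetime => |x.2|).continuousAt.eventually_lt
      continuousAt_const (by linarith)
  filter_upwards [this] with x hx
  rw [timeCutoff_eq_one hx.le, one_mul]

theorem regularPart_bound (T : ℝ) (hℓ : 1 ≤ ℓ) (hM : 2 ^ 7 * M * 2 ≤ ℓ ^ 2) :
    ∃ K, 0 ≤ K ∧ ∀ ⦃q q' : Space → ℂ⦄ ⦃D : ℝ⦄, BddC 7 M q → BddC 7 M q' →
      BddC 7 D (fun x => q x - q' x) → ∀ p : Spacetime, |p.2| ≤ |T| →
      ‖regularPart ℓ q p‖ ≤ K ∧ ‖fderiv ℝ (regularPart ℓ q) p‖ ≤ K ∧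
      ‖regularPart ℓ q p - regularPart ℓ q' p‖ ≤ K * D ∧
      ‖fderiv ℝ (regularPart ℓ q) p - fderiv ℝ (regularPart ℓ q') p‖ ≤ K * D := by
  obtain ⟨K, hK, h⟩ := isLip_cutoff_regularPart T hℓ hM
  refine ⟨K, hK, fun q q' D h1 h2 h3 p hp => ?_⟩
  have e := fun q => cutoff_eventuallyEq hp (regularPart ℓ q)
  have d := fun {q} (hq : BddC 7 M q) =>
    (contDiff_regularPart hℓ hM hq).differentiable (by simp) p
  have b1 := (h h1 h2 h3).1
  have b2 := (h h1 h2 h3).2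
  refine ⟨?_, ?_, ?_, ?_⟩
  · rw [← (e q).eq_of_nhds]
    exact b1.norm_le p
  · rw [← (e q).fderiv_eq]
    exact (b1.fderiv (k := 0)).norm_le p
  · rw [← (e q).eq_of_nhds, ← (e q').eq_of_nhds]
    exact b2.norm_le p
  · rw [← fderiv_sub (d h1) (d h2), ← ((e q).sub (e q')).fderiv_eq]
    exact (b2.fderiv (k := 0)).norm_le p

end Bounds

/-! ### Partial derivative norms against Fréchet derivative norms -/

section Norms

/-- The iterated derivative along the coordinate directions listed in a word. -/
def wordDeriv (w : List (Fin 3)) (f : Space → ℂ) : Space → ℂ :=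
  w.foldr (fun i g p => fderiv ℝ g p (spaceDir i)) f

theorem contDiff_wordDeriv {k : ℕ} (w : List (Fin 3)) {f : Space → ℂ}
    (hf : ContDiff ℝ (k + w.length : ℕ) f) : ContDiff ℝ k (wordDeriv w f) := by
  induction w generalizing k with
  | nil => simpa [wordDeriv] using hf
  | cons i w ih =>
    refine contDiff_fderiv_dir (k := k) (ih (k := k + 1) ?_) (spaceDir i)
    convert hf using 2
    simp
    omega

/-- Symmetry of second derivatives handles adjacent swaps, which generate all permutations. Iterated
derivatives in any order therefore reduce to the sorted ones counted by multi-indices. -/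
theorem wordDeriv_perm {w w' : List (Fin 3)} (h : w.Perm w') {f : Space → ℂ}
    (hf : ContDiff ℝ w.length f) : wordDeriv w f = wordDeriv w' f := by
  induction h with
  | nil => rfl
  | cons i h ih =>
    have := ih (hf.of_le (by simp))
    simp only [wordDeriv, List.foldr_cons] at this ⊢
    rw [this]
  | swap i j w =>
    have h2 : ContDiff ℝ 2 (wordDeriv w f) := contDiff_wordDeriv (k := 2) w (by
      convert hf using 2
      simp
      omega)
    ext p
    exact fderiv_dir_symm h2 p _ _
  | trans h1 h2 ih1 ih2 =>
    rw [ih1 hf, ih2 (by rwa [← h1.length_eq])]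

theorem iterate_lineDeriv_eq (i : Fin 3) (n : ℕ) {f : Space → ℂ} (hf : ContDiff ℝ n f) :
    (fun h p => lineDeriv ℝ h p (spaceDir i))^[n] f = wordDeriv (List.replicate n i) f := by
  induction n with
  | zero => rfl
  | succ n ih =>
    rw [Function.iterate_succ_apply', ih (hf.of_le (by norm_cast; omega))]
    have h1 : ContDiff ℝ 1 (wordDeriv (List.replicate n i) f) :=
      contDiff_wordDeriv (k := 1) _ (by
        convert hf using 2
        simp
        omega)
    ext p
    exact (h1.differentiable (by simp) p).lineDeriv_eq_fderiv

theorem partialDeriv_eq_wordDeriv (α : Fin 3 → ℕ) {f : Space → ℂ}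
    (hf : ContDiff ℝ (∑ i, α i : ℕ) f) : partialDeriv spaceDir α f = wordDeriv
      (List.replicate (α 0) 0 ++ List.replicate (α 1) 1 ++ List.replicate (α 2) 2) f := by
  have h2 : ContDiff ℝ (α 2) f := hf.of_le (by
    norm_cast
    simp only [Fin.sum_univ_three]
    omega)
  have h1 : ContDiff ℝ (α 1) (wordDeriv (List.replicate (α 2) 2) f) :=
    contDiff_wordDeriv _ (hf.of_le (by
      norm_cast
      simp only [Fin.sum_univ_three, List.length_replicate]
      omega))
  have h0 : ContDiff ℝ (α 0) (wordDeriv (List.replicate (α 1) 1)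
      (wordDeriv (List.replicate (α 2) 2) f)) :=
    contDiff_wordDeriv _ (contDiff_wordDeriv _ (hf.of_le (by
      norm_cast
      simp only [Fin.sum_univ_three, List.length_replicate]
      omega)))
  have hr : List.finRange 3 = [0, 1, 2] := by decide
  simp only [partialDeriv, hr, List.foldr_cons, List.foldr_nil]
  rw [iterate_lineDeriv_eq 2 _ h2, iterate_lineDeriv_eq 1 _ h1, iterate_lineDeriv_eq 0 _ h0]
  simp [wordDeriv, List.foldr_append]

theorem bddC_succ_of_dir {k : ℕ} {A : ℝ} {f : Space → ℂ} (hf : ContDiff ℝ (k + 1 : ℕ) f)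
    (h0 : ∀ p, ‖f p‖ ≤ A) (h : ∀ i, BddC k A fun p => fderiv ℝ f p (spaceDir i)) :
    BddC (k + 1) (3 * A) f := by
  have hA : 0 ≤ A := (norm_nonneg _).trans (h0 0)
  let L : Fin 3 → ℂ →L[ℝ] (Space →L[ℝ] ℂ) := fun i =>
    (ContinuousLinearMap.smulRightL ℝ Space ℂ (EuclideanSpace.proj i))
  have hp : ∀ i, ‖(EuclideanSpace.proj i : Space →L[ℝ] ℝ)‖ ≤ 1 := fun i =>
    ContinuousLinearMap.opNorm_le_bound _ zero_le_one fun x => by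
      simpa using abs_apply_le_norm x i
  have hL : ∀ i, ‖L i‖ ≤ 1 := fun i => ContinuousLinearMap.opNorm_le_bound _ zero_le_one fun c => by
    change ‖ContinuousLinearMap.smulRight (EuclideanSpace.proj i : Space →L[ℝ] ℝ) c‖ ≤ _
    rw [ContinuousLinearMap.norm_smulRight_apply]
    gcongr
    exact hp i
  have hb : ∀ i, BddC k A fun p => L i (fderiv ℝ f p (spaceDir i)) := fun i =>
    ((h i).clm (L i)).mono le_rfl (mul_le_of_le_one_left hA (hL i))
  refine bddC_succ_iff.2 ⟨fun p => (h0 p).trans (by linarith), hf.differentiable (by simp), ?_⟩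
  refine ((((hb 0).add (hb 1)).add (hb 2)).mono le_rfl (by linarith)).congr fun p => ?_
  ext v
  have hv : fderiv ℝ f p v = ∑ i, v i • fderiv ℝ f p (spaceDir i) := by
    conv_lhs => rw [← sum_coord_smul v]
    simp only [map_sum, map_smul]
  rw [hv, Fin.sum_univ_three]
  rfl

/-- A Fréchet derivative is a sum of three coordinate terms, which costs a factor 3 per order. -/
theorem bddC_of_wordDeriv {k : ℕ} {A : ℝ} {f : Space → ℂ} (hf : ContDiff ℝ k f)
    (h : ∀ w : List (Fin 3), w.length ≤ k → ∀ p, ‖wordDeriv w f p‖ ≤ A) :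
    BddC k (3 ^ k * A) f := by
  induction k generalizing f with
  | zero => exact bddC_zero_iff.2 ⟨hf.continuous, fun p => by
      simpa [wordDeriv] using h [] le_rfl p⟩
  | succ k ih =>
    have hA : 0 ≤ A := (norm_nonneg _).trans (h [] (by simp) 0)
    have h3 : A ≤ 3 ^ k * A := le_mul_of_one_le_left hA (one_le_pow₀ (by norm_num))
    rw [pow_succ', mul_assoc]
    refine bddC_succ_of_dir hf (fun p => (h [] (by simp) p).trans h3) fun i =>
      ih (contDiff_fderiv_dir hf _) fun w hw p => ?_
    -- The last letter of a word is differentiated first, so the word of ∂_i f is extended at its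
    -- end.
    have := h (w ++ [i]) (by simpa using hw) p
    simpa [wordDeriv, List.foldr_append] using this

theorem bddC_of_potentialNorm_le {q : Space → ℂ} (hq : ContDiff ℝ 7 q) {M : ℝ≥0}
    (h : potentialNorm q ≤ M) : BddC 7 (3 ^ 7 * M) q := by
  refine bddC_of_wordDeriv hq fun w hw p => ?_
  set α : Fin 3 → ℕ := fun i => w.count i with hα
  have hperm : w.Perm
      (List.replicate (α 0) 0 ++ List.replicate (α 1) 1 ++ List.replicate (α 2) 2) := by
    rw [List.perm_iff_count]
    intro i
    fin_cases i <;> simp [hα, List.count_replicate]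
  have hsum : ∑ i, α i = w.length := by
    rw [hperm.length_eq, Fin.sum_univ_three]
    simp [add_assoc]
  have hq' : ContDiff ℝ w.length q := hq.of_le (by exact_mod_cast hw)
  have hmem : α ∈ multiIndices 3 7 := by
    simp only [multiIndices, Finset.mem_filter, Fintype.mem_piFinset, Finset.mem_range]
    exact ⟨fun i => by have := w.count_le_length (a := i); simp only [hα]; omega, by omega⟩
  have h1 : ‖partialDeriv spaceDir α q p‖ₑ ≤ M :=
    (le_iSup₂ (f := fun p (_ : p ∈ (univ : Set Space)) => ‖partialDeriv spaceDir α q p‖ₑ)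
      p (mem_univ p)).trans ((Finset.single_le_sum
        (f := fun α => ⨆ p ∈ (univ : Set Space), ‖partialDeriv spaceDir α q p‖ₑ)
        (fun _ _ => zero_le) hmem).trans h)
  rw [partialDeriv_eq_wordDeriv α (by rwa [hsum]), ← wordDeriv_perm hperm hq'] at h1
  rw [enorm_le_coe] at h1
  exact_mod_cast h1

theorem c1Norm_le {T : ℝ} {r : Spacetime → ℂ} (hr : Differentiable ℝ r) {K : ℝ≥0}
    (h0 : ∀ p : Spacetime, p.2 ∈ Icc 0 T → ‖r p‖ ≤ K)
    (h1 : ∀ p : Spacetime, p.2 ∈ Icc 0 T → ‖fderiv ℝ r p‖ ≤ K) :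
    c1Norm T r ≤ ((multiIndices 4 1).card * K : ℝ≥0) := by
  unfold c1Norm cNorm
  push_cast
  rw [← nsmul_eq_mul]
  refine Finset.sum_le_card_nsmul _ _ _ fun α hα => iSup₂_le fun p hp => ?_
  have hp' : p.2 ∈ Icc 0 T := hp.2
  have hd : ∀ i, ‖lineDeriv ℝ r p (spacetimeDir i)‖ₑ ≤ K := by
    intro i
    have hi : ‖spacetimeDir i‖ ≤ 1 := by
      fin_cases i
      · exact (norm_spaceDir_zero 0).le
      · exact (norm_spaceDir_zero 1).le
      · exact (norm_spaceDir_zero 2).le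
      · exact norm_timeDir.le
    rw [enorm_le_coe, (hr p).lineDeriv_eq_fderiv]
    have := ((fderiv ℝ r p).le_opNorm (spacetimeDir i)).trans
      (mul_le_of_le_one_right (norm_nonneg _) hi)
    exact_mod_cast this.trans (h1 p hp')
  simp only [multiIndices, Finset.mem_filter, Fintype.mem_piFinset, Finset.mem_range,
    Fin.sum_univ_four] at hα
  have hr : List.finRange 4 = [0, 1, 2, 3] := by decide
  simp only [partialDeriv, hr, List.foldr_cons, List.foldr_nil]
  have hc : (α 0 = 0 ∧ α 1 = 0 ∧ α 2 = 0 ∧ α 3 = 0) ∨ (α 0 = 1 ∧ α 1 = 0 ∧ α 2 = 0 ∧ α 3 = 0) ∨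
      (α 0 = 0 ∧ α 1 = 1 ∧ α 2 = 0 ∧ α 3 = 0) ∨ (α 0 = 0 ∧ α 1 = 0 ∧ α 2 = 1 ∧ α 3 = 0) ∨
      (α 0 = 0 ∧ α 1 = 0 ∧ α 2 = 0 ∧ α 3 = 1) := by omega
  rcases hc with h | h | h | h | h <;> obtain ⟨e0, e1, e2, e3⟩ := h <;>
    simp only [e0, e1, e2, e3, Function.iterate_zero, Function.iterate_one, id_eq]
  · rw [enorm_le_coe]
    exact_mod_cast h0 p hp'
  all_goals exact hd _

end Norms

/-! ### The cone distribution as a functional -/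

/-- The pairing of `δ(t - |x-a|) / (4π|x-a|) + H(t - |x-a|) r` with a function `ψ`. -/
def conePairing (a : Space) (r ψ : Spacetime → ℂ) : ℂ :=
  (∫ x : Space, (4 * Real.pi * ‖x - a‖)⁻¹ • ψ (x, ‖x - a‖)) +
    ∫ p : Spacetime, heaviside (p.2 - ‖p.1 - a‖) • (r p * ψ p)

section Pairing

variable {a : Space} {r ψ χ : Spacetime → ℂ}

theorem inv_le_ker {R : ℝ} {z : Space} (hz : ‖z‖ ≤ R) :
    (4 * Real.pi * ‖z‖)⁻¹ ≤ Real.exp R * ker 1 z := by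
  unfold ker
  rw [one_mul, div_eq_mul_inv, ← mul_assoc, ← Real.exp_add]
  refine le_mul_of_one_le_left (by positivity) (Real.one_le_exp (by linarith))

theorem norm_cone_integrand_le {A R : ℝ} (hA : ∀ p, ‖ψ p‖ ≤ A) (hR : ∀ p, R < ‖p‖ → ψ p = 0)
    (x : Space) : ‖(4 * Real.pi * ‖x - a‖)⁻¹ • ψ (x, ‖x - a‖)‖ ≤
      A * Real.exp R * ker 1 (x - a) := by
  have hA0 : 0 ≤ A := (norm_nonneg _).trans (hA 0)
  by_cases h : ‖x - a‖ ≤ R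
  · rw [norm_smul, Real.norm_of_nonneg (by positivity)]
    calc _ ≤ (Real.exp R * ker 1 (x - a)) * A := by
          have := ker_nonneg 1 (x - a)
          gcongr
          · exact inv_le_ker h
          · exact hA _
      _ = _ := by ring
  · rw [hR, smul_zero, norm_zero]
    · have := ker_nonneg 1 (x - a)
      positivity
    · refine (not_le.1 h).trans_le ?_
      rw [Prod.norm_def]
      exact (le_abs_self _).trans (le_max_right _ _)

theorem integrable_cone_integrand (hψ : Continuous ψ) (hc : HasCompactSupport ψ) :
    Integrable fun x : Space => (4 * Real.pi * ‖x - a‖)⁻¹ • ψ (x, ‖x - a‖) := by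
  obtain ⟨A, hA⟩ := hψ.bounded_above_of_compact_support hc
  obtain ⟨R, hR⟩ := hc.isCompact.isBounded.subset_closedBall 0
  refine ((((integrable_ker one_pos).comp_sub_right a).const_mul (A * Real.exp R))).mono' ?_
    (Eventually.of_forall fun x => norm_cone_integrand_le hA (fun p hp => ?_) x)
  · exact (by fun_prop : Measurable fun x : Space => (4 * Real.pi * ‖x - a‖)⁻¹
      ).aestronglyMeasurable.smul (by fun_prop : Continuous _).aestronglyMeasurable
  · by_contra h
    have := hR (subset_tsupport _ h)
    rw [mem_closedBall_zero_iff] at this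
    linarith

theorem integrable_heaviside_mul (hr : Continuous r) (hψ : Continuous ψ)
    (hc : HasCompactSupport ψ) :
    Integrable fun p : Spacetime => heaviside (p.2 - ‖p.1 - a‖) • (r p * ψ p) :=
  integrable_heaviside_smul ((hr.mul hψ).integrable_of_hasCompactSupport hc.mul_left) (by fun_prop)

theorem conePairing_add (hr : Continuous r) (hψ : Continuous ψ) (hψc : HasCompactSupport ψ)
    (hχ : Continuous χ) (hχc : HasCompactSupport χ) :
    conePairing a r (fun p => ψ p + χ p) = conePairing a r ψ + conePairing a r χ := by
  unfold conePairing
  simp_rw [mul_add, smul_add]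
  rw [integral_add (integrable_cone_integrand hψ hψc) (integrable_cone_integrand hχ hχc),
    integral_add (integrable_heaviside_mul hr hψ hψc) (integrable_heaviside_mul hr hχ hχc)]
  ring

theorem conePairing_const_mul (c : ℂ) :
    conePairing a r (fun p => c * ψ p) = c * conePairing a r ψ := by
  unfold conePairing
  rw [mul_add, ← integral_const_mul, ← integral_const_mul]
  congr 1 <;> refine integral_congr_ae (Eventually.of_forall fun p => ?_) <;>
    simp only [Complex.real_smul] <;> ring

/-- The constant depends only on the support radius and the estimate uses only the sup norm, so the
pairing is a distribution of order zero and hence of every order n. -/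
theorem norm_conePairing_le (a : Space) (hr : Continuous r) (R : ℝ) :
    ∃ C, 0 ≤ C ∧ ∀ (ψ : Spacetime → ℂ) (A : ℝ), (∀ p, ‖ψ p‖ ≤ A) →
      (∀ p, R < ‖p‖ → ψ p = 0) → ‖conePairing a r ψ‖ ≤ C * A := by
  have h1 := (integrable_ker one_pos).comp_sub_right a
  have h2 : Integrable ((closedBall (0 : Spacetime) R).indicator fun p => ‖r p‖) :=
    (hr.norm.continuousOn.integrableOn_compact (isCompact_closedBall _ _)).integrable_indicator
      measurableSet_closedBall
  have n1 : ∀ z : Space, 0 ≤ ker 1 (z - a) := fun z => ker_nonneg 1 _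
  have n2 : ∀ p, 0 ≤ (closedBall (0 : Spacetime) R).indicator (fun p => ‖r p‖) p :=
    fun p => indicator_nonneg (fun _ _ => norm_nonneg _) p
  refine ⟨Real.exp R * (∫ x, ker 1 (x - a)) +
    ∫ p, (closedBall (0 : Spacetime) R).indicator (fun p => ‖r p‖) p, ?_, fun ψ A hA hR => ?_⟩
  · exact add_nonneg (mul_nonneg (Real.exp_pos _).le (integral_nonneg n1)) (integral_nonneg n2)
  have hA0 : 0 ≤ A := (norm_nonneg _).trans (hA 0)
  have e1 := norm_integral_le_of_norm_le (h1.const_mul (A * Real.exp R))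
    (Eventually.of_forall fun x => norm_cone_integrand_le (a := a) hA hR x)
  have e2 := norm_integral_le_of_norm_le (f := fun p : Spacetime =>
      heaviside (p.2 - ‖p.1 - a‖) • (r p * ψ p)) (h2.const_mul A)
    (Eventually.of_forall fun p => by
      rw [norm_smul, norm_mul]
      by_cases h : p ∈ closedBall (0 : Spacetime) R
      · rw [indicator_of_mem h]
        calc _ ≤ 1 * (‖r p‖ * A) := by
              gcongr
              · exact norm_heaviside_le _
              · exact hA p
          _ = _ := by ring
      · rw [indicator_of_notMem h, hR p (by simpa using h)]
        simp)
  rw [integral_const_mul] at e1 e2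
  unfold conePairing
  calc _ ≤ _ := norm_add_le _ _
    _ ≤ _ := add_le_add e1 e2
    _ = _ := by ring

theorem conePairing_translate (a : Space) (r ψ : Spacetime → ℂ) :
    conePairing a (fun p => r (p - (a, 0))) ψ =
      conePairing 0 r (fun p => ψ ((a, 0) + p)) := by
  unfold conePairing
  rw [← integral_add_left_eq_self _ a, ← integral_add_left_eq_self _ ((a, 0) : Spacetime)]
  simp

end Pairing

/-! ### Distributions of order n and seminorm bounds -/

section Distribution

variable {n : ℕ}

/-- A linear functional that is bounded by the sup norm on every compact set is a distribution. -/
def distributionOfBound (L : 𝓓^{(n : ℕ∞)}((⊤ : Opens Spacetime), ℝ) → ℂ)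
    (hadd : ∀ f g, L (f + g) = L f + L g) (hsmul : ∀ (c : ℝ) f, L (c • f) = c • L f)
    (hb : ∀ R : ℝ, ∃ C, 0 ≤ C ∧ ∀ f A, (∀ p, ‖f p‖ ≤ A) → (∀ p, R < ‖p‖ → f p = 0) →
      ‖L f‖ ≤ C * A) : 𝓓'^{(n : ℕ∞)}((⊤ : Opens Spacetime), ℂ) :=
  TestFunction.mkCLM ℝ L hadd hsmul fun K hK => by
    obtain ⟨R, hR⟩ := K.isCompact.isBounded.subset_closedBall 0
    refine (ContDiffMapSupportedIn.mkCLMtoNormedSpace ℝ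
      (L ∘ TestFunction.ofSupportedIn hK) (fun f g => hadd (TestFunction.ofSupportedIn hK f)
        (TestFunction.ofSupportedIn hK g))
      (fun c f => hsmul c (TestFunction.ofSupportedIn hK f)) ?_).cont
    obtain ⟨C, hC, h⟩ := hb R
    -- Only the zeroth seminorm, the sup norm, is used.
    refine ⟨{0}, C, hC, fun f => ?_⟩
    rw [Finset.sup_singleton]
    refine h _ _ (fun p => ContDiffMapSupportedIn.norm_apply_le_seminorm ℝ) fun p hp => ?_
    refine f.zero_on_compl fun hp' => ?_
    have := hR hp'
    rw [mem_closedBall_zero_iff] at this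
    linarith

/-- Continuity on functions supported in a fixed ball is a bound by finitely many seminorms of order
at most n, each dominated by the constant in `BddC`. This quantitative form makes limits in C^n
possible. -/
theorem exists_bound_of_distribution (W : 𝓓'^{(n : ℕ∞)}((⊤ : Opens Spacetime), ℂ)) (R : ℝ) :
    ∃ C, 0 ≤ C ∧ ∀ (f : 𝓓^{(n : ℕ∞)}((⊤ : Opens Spacetime), ℝ)) (A : ℝ), BddC n A f →
      (∀ p, R < ‖p‖ → f p = 0) → ‖W f‖ ≤ C * A := by
  let K : Compacts Spacetime := ⟨closedBall 0 R, isCompact_closedBall _ _⟩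
  have hK : (K : Set Spacetime) ⊆ (⊤ : Opens Spacetime) := fun _ _ => mem_univ _
  let Wc : 𝓓^{(n : ℕ∞)}((⊤ : Opens Spacetime), ℝ) →L[ℝ] ℂ := W
  let q : Seminorm ℝ 𝓓^{(n : ℕ∞)}_{K}(Spacetime, ℝ) :=
    (normSeminorm ℝ ℂ).comp (Wc.toLinearMap.comp (TestFunction.ofSupportedInCLM ℝ hK).toLinearMap)
  have hq : Continuous q :=
    continuous_norm.comp (Wc.continuous.comp (TestFunction.ofSupportedInCLM ℝ hK).continuous)
  obtain ⟨s, C, _, hC⟩ := Seminorm.bound_of_continuous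
    (ContDiffMapSupportedIn.withSeminorms ℝ Spacetime ℝ n K) q hq
  refine ⟨C, C.2, fun f A hf hR => ?_⟩
  have hA := hf.nonneg
  let g : 𝓓^{(n : ℕ∞)}_{K}(Spacetime, ℝ) := ⟨f, f.contDiff, fun p hp => hR p (by
    simpa [K] using hp)⟩
  have h1 : ‖W f‖ ≤ C * (s.sup (ContDiffMapSupportedIn.seminorm ℝ Spacetime ℝ n K)) g := hC g
  refine h1.trans (mul_le_mul_of_nonneg_left (Seminorm.finset_sup_apply_le hA fun i _ => ?_) C.2)
  rw [ContDiffMapSupportedIn.seminorm_le_iff ℝ hA]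
  exact fun hi x _ => hf.2 i (by exact_mod_cast hi) x

end Distribution

/-! ### Existence of the solution with pole at an arbitrary point -/

section Existence

variable {n : ℕ} {a : Space} {r : Spacetime → ℂ}

/-- The distribution `δ(t - |x-a|) / (4π|x-a|) + H(t - |x-a|) r`. -/
def coneDistribution (n : ℕ) (a : Space) (r : Spacetime → ℂ) (hr : Continuous r) :
    𝓓'^{(n : ℕ∞)}((⊤ : Opens Spacetime), ℂ) :=
  distributionOfBound (fun φ => conePairing a r fun p => (φ p : ℂ))
    (fun f g => by
      rw [← conePairing_add (ψ := fun p => (f p : ℂ)) (χ := fun p => (g p : ℂ)) hr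
        (Complex.continuous_ofReal.comp f.continuous) (f.hasCompactSupport.comp_left Complex.ofReal_zero)
        (Complex.continuous_ofReal.comp g.continuous)
        (g.hasCompactSupport.comp_left Complex.ofReal_zero)]
      congr 1
      ext p
      simp)
    (fun c f => by
      rw [Complex.real_smul, ← conePairing_const_mul]
      congr 1
      ext p
      simp)
    (fun R => by
      obtain ⟨C, hC, h⟩ := norm_conePairing_le a hr R
      refine ⟨C, hC, fun f A hA hR => h _ A (fun p => ?_) fun p hp => ?_⟩
      · simpa using hA p
      · rw [hR p hp, Complex.ofReal_zero])

theorem coneDistribution_apply (hr : Continuous r)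
    (φ : 𝓓^{(n : ℕ∞)}((⊤ : Opens Spacetime), ℝ)) :
    coneDistribution n a r hr φ = conePairing a r fun p => (φ p : ℂ) := rfl

theorem fderiv_ofReal {V : Type} [NormedAddCommGroup V] [NormedSpace ℝ V] {f : V → ℝ} {p : V}
    (hf : DifferentiableAt ℝ f p) (v : V) :
    fderiv ℝ (fun p => (f p : ℂ)) p v = (fderiv ℝ f p v : ℂ) := by
  have h : HasFDerivAt (fun p => (f p : ℂ)) _ p :=
    Complex.ofRealCLM.hasFDerivAt.comp p hf.hasFDerivAt
  rw [h.fderiv]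
  rfl

theorem contDiff_ofReal {V : Type} [NormedAddCommGroup V] [NormedSpace ℝ V] {k : WithTop ℕ∞}
    {f : V → ℝ} (hf : ContDiff ℝ k f) : ContDiff ℝ k fun p => (f p : ℂ) :=
  Complex.ofRealCLM.contDiff.comp hf

theorem lineDeriv_lineDeriv_apply (φ : 𝓓((⊤ : Opens Spacetime), ℝ)) (v p : Spacetime) :
    ((∂_{v} (∂_{v} φ)) p : ℂ) = dd v (fun p => (φ p : ℂ)) p := by
  have h1 : ∀ (ψ : 𝓓((⊤ : Opens Spacetime), ℝ)) p, ((∂_{v} ψ) p : ℂ) =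
      fderiv ℝ (fun p => (ψ p : ℂ)) p v := by
    intro ψ p
    have hd : Differentiable ℝ ψ := ψ.contDiff.differentiable (by simp)
    rw [fderiv_ofReal (hd p), TestFunction.lineDerivOp_eq_lineDerivCLM ℝ,
      TestFunction.lineDerivCLM_apply_of_le (by simp), (hd p).lineDeriv_eq_fderiv]
  rw [h1]
  unfold dd
  congr 2
  ext q
  exact h1 φ q

theorem ofReal_dAlembert (φ : 𝓓((⊤ : Opens Spacetime), ℝ)) (p : Spacetime) :
    (dAlembert φ p : ℂ) = box (fun p => (φ p : ℂ)) p := by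
  unfold dAlembert box
  simp only [Fin.sum_univ_three, ← lineDeriv_lineDeriv_apply]
  simp

theorem ofSmooth_apply (φ : 𝓓((⊤ : Opens Spacetime), ℝ)) (p : Spacetime) :
    ofSmooth n φ p = φ p := by
  unfold ofSmooth
  rw [TestFunction.monoCLM_apply, if_pos ⟨by simp, le_rfl⟩]

variable {ℓ M : ℝ} {q : Space → ℂ}

/-- The regular part of the fundamental solution with pole at `a`. -/
def regularPartAt (ℓ : ℝ) (q : Space → ℂ) (a : Space) (p : Spacetime) : ℂ :=
  regularPart ℓ (fun x => q (a + x)) (p - (a, 0))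

theorem contDiff_regularPartAt (hℓ : 1 ≤ ℓ) (hM : 2 ^ 7 * M * 2 ≤ ℓ ^ 2) (hq : BddC 7 M q)
    (a : Space) : ContDiff ℝ 1 (regularPartAt ℓ q a) :=
  (contDiff_regularPart hℓ hM (hq.comp_add_left a)).comp (contDiff_id.sub contDiff_const)

/-- Translating the pole to the origin replaces q by x ↦ q(a + x), which satisfies the same bounds;
no property of a is needed. -/
theorem conePairing_regularPartAt (hℓ : 1 ≤ ℓ) (hM : 2 ^ 7 * M * 2 ≤ ℓ ^ 2) (hq : BddC 7 M q)
    (a : Space) {φ : Spacetime → ℂ} (hφ : ContDiff ℝ 2 φ) (hc : HasCompactSupport φ) :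
    conePairing a (regularPartAt ℓ q a) (fun p => box φ p - q p.1 * φ p) = φ (a, 0) := by
  have h1 : ContDiff ℝ 2 fun p => φ ((a, 0) + p) := hφ.comp (contDiff_const.add contDiff_id)
  have h2 : HasCompactSupport fun p => φ ((a, 0) + p) :=
    hc.comp_homeomorph (Homeomorph.addLeft ((a, 0) : Spacetime))
  have := weak_equation hℓ hM (hq.comp_add_left a) h1 h2
  have e := conePairing_translate a (regularPart ℓ fun x => q (a + x))
    (fun p => box φ p - q p.1 * φ p)
  unfold regularPartAt
  rw [e]
  unfold conePairing
  simp only [box_comp_add_left, add_zero] at this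
  simpa using this

theorem mulPairing_coneDistribution {n : ℕ} (q : 𝓓^{(n : ℕ∞)}(unitBall, ℂ)) (hr : Continuous r)
    (φ : 𝓓((⊤ : Opens Spacetime), ℝ)) :
    mulPairing q (coneDistribution n a r hr) φ =
      conePairing a r fun p => q p.1 * (φ p : ℂ) := by
  have hφ : Continuous fun p => (φ p : ℂ) := Complex.continuous_ofReal.comp φ.continuous
  have hc : HasCompactSupport fun p => (φ p : ℂ) :=
    φ.hasCompactSupport.comp_left Complex.ofReal_zero
  have h1 : Continuous fun p : Spacetime => (((q p.1).re : ℝ) : ℂ) :=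
    Complex.continuous_ofReal.comp (Complex.continuous_re.comp (q.continuous.comp continuous_fst))
  have h2 : Continuous fun p : Spacetime => (((q p.1).im : ℝ) : ℂ) :=
    Complex.continuous_ofReal.comp (Complex.continuous_im.comp (q.continuous.comp continuous_fst))
  unfold mulPairing
  rw [coneDistribution_apply, coneDistribution_apply, ← conePairing_const_mul]
  have e1 : (fun p => ((mulTest n (fun x => (q x).re)
      (Complex.reCLM.contDiff.comp q.contDiff) φ p : ℝ) : ℂ)) =
      fun p => (((q p.1).re : ℝ) : ℂ) * (φ p : ℂ) := by
    ext p
    exact Complex.ofReal_mul _ _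
  have e2 : (fun p => Complex.I * ((mulTest n (fun x => (q x).im)
      (Complex.imCLM.contDiff.comp q.contDiff) φ p : ℝ) : ℂ)) =
      fun p => Complex.I * ((((q p.1).im : ℝ) : ℂ) * (φ p : ℂ)) := by
    ext p
    exact congrArg _ (Complex.ofReal_mul _ _)
  rw [e1, e2, ← conePairing_add (ψ := fun p : Spacetime => (((q p.1).re : ℝ) : ℂ) * (φ p : ℂ))
    (χ := fun p : Spacetime => Complex.I * ((((q p.1).im : ℝ) : ℂ) * (φ p : ℂ))) hr (h1.mul hφ) hc.mul_left
    (continuous_const.mul (h2.mul hφ)) hc.mul_left.mul_left]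
  congr 1
  ext p
  conv_rhs => rw [← Complex.re_add_im (q p.1)]
  ring

theorem isPointSourceSolution_coneDistribution (q : 𝓓^{(n : ℕ∞)}(unitBall, ℂ)) (hℓ : 1 ≤ ℓ)
    (hM : 2 ^ 7 * M * 2 ≤ ℓ ^ 2) (hq : BddC 7 M q) (a : Space) :
    IsPointSourceSolution q a (coneDistribution n a (regularPartAt ℓ q a)
      (contDiff_regularPartAt hℓ hM hq a).continuous) := by
  set hr := (contDiff_regularPartAt hℓ hM hq a).continuous
  constructor
  · intro φ
    have hφ : ContDiff ℝ 2 fun p => (φ p : ℂ) :=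
      contDiff_ofReal (φ.contDiff.of_le (by norm_cast))
    have hc : HasCompactSupport fun p => (φ p : ℂ) :=
      φ.hasCompactSupport.comp_left Complex.ofReal_zero
    rw [mulPairing_coneDistribution, coneDistribution_apply,
      ← conePairing_regularPartAt hℓ hM hq a hφ hc]
    have e1 : (fun p => ((ofSmooth n (dAlembert φ) p : ℝ) : ℂ)) = box fun p => (φ p : ℂ) := by
      ext p
      rw [ofSmooth_apply, ofReal_dAlembert]
    have hqc : Continuous fun p : Spacetime => (-1 : ℂ) * (q p.1 * (φ p : ℂ)) :=
      continuous_const.mul ((q.continuous.comp continuous_fst).mul hφ.continuous)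
    have e2 : (fun p => box (fun p => (φ p : ℂ)) p - q p.1 * (φ p : ℂ)) =
        fun p => box (fun p => (φ p : ℂ)) p + (-1 : ℂ) * (q p.1 * (φ p : ℂ)) := by
      ext p
      ring
    rw [e1, e2, conePairing_add hr (continuous_box hφ) (hasCompactSupport_box hc) hqc
      hc.mul_left.mul_left, conePairing_const_mul]
    ring
  · intro φ hφ
    have h0 : ∀ p : Spacetime, 0 ≤ p.2 → φ p = 0 := fun p hp => by
      by_contra h
      exact absurd (hφ (subset_tsupport _ h)) (by simpa using hp)
    rw [coneDistribution_apply]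
    unfold conePairing
    have e1 : ∀ x : Space, (4 * Real.pi * ‖x - a‖)⁻¹ • ((φ (x, ‖x - a‖) : ℝ) : ℂ) = 0 := fun x => by
      rw [h0 _ (norm_nonneg _)]
      simp
    have e2 : ∀ p : Spacetime, heaviside (p.2 - ‖p.1 - a‖) •
        (regularPartAt ℓ q a p * ((φ p : ℝ) : ℂ)) = 0 := fun p => by
      by_cases h : 0 < p.2 - ‖p.1 - a‖
      · rw [h0 p (by linarith [norm_nonneg (p.1 - a)])]
        simp
      · simp [heaviside, h]
    simp only [e1, e2, integral_zero, add_zero]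

theorem hasExpansion_coneDistribution (hr : Continuous r) :
    HasExpansion (coneDistribution n a r hr) a r := by
  intro φ
  rw [coneDistribution_apply, ← integral_complex_ofReal]
  unfold conePairing
  congr 1 <;> refine integral_congr_ae (Eventually.of_forall fun p => ?_)
  · simp only [Complex.real_smul]
    push_cast
    ring
  · simp only [Complex.real_smul]
    push_cast
    ring

end Existence

/-! ### The solution as a function off the light cone -/

section OffCone

variable {n : ℕ} {a : Space} {r : Spacetime → ℂ}

theorem isOpen_offCone (a : Space) : IsOpen (offCone a) :=
  isOpen_ne_fun continuous_snd (by fun_prop)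

theorem contDiffOn_heaviside_mul {k : ℕ} (hr : ContDiff ℝ k r) :
    ContDiffOn ℝ k (fun p : Spacetime => (heaviside (p.2 - ‖p.1 - a‖) : ℂ) * r p) (offCone a) := by
  intro p hp
  refine ContDiffAt.contDiffWithinAt ?_
  have hc : ContinuousAt (fun p : Spacetime => p.2 - ‖p.1 - a‖) p := by fun_prop
  rcases lt_or_gt_of_ne hp with h | h
  · refine contDiffAt_const (c := (0 : ℂ)) |>.congr_of_eventuallyEq ?_
    filter_upwards [hc.eventually_lt continuousAt_const (by linarith : p.2 - ‖p.1 - a‖ < 0)] with x hx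
    simp [heaviside, not_lt.2 hx.le]
  · refine hr.contDiffAt.congr_of_eventuallyEq ?_
    filter_upwards [continuousAt_const.eventually_lt hc (by linarith : 0 < p.2 - ‖p.1 - a‖)]
      with x hx
    simp [heaviside, hx]

theorem eqFunctionOn_coneDistribution {k : ℕ} (hr : ContDiff ℝ k r) :
    EqFunctionOn (coneDistribution n a r hr.continuous)
      (fun p : Spacetime => (heaviside (p.2 - ‖p.1 - a‖) : ℂ) * r p) (offCone a) := by
  refine ⟨(contDiffOn_heaviside_mul hr).continuousOn, fun φ hφ => ?_⟩
  rw [coneDistribution_apply]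
  unfold conePairing
  have e1 : ∀ x : Space, (4 * Real.pi * ‖x - a‖)⁻¹ • ((φ (x, ‖x - a‖) : ℝ) : ℂ) = 0 := fun x => by
    have : φ (x, ‖x - a‖) = 0 := by
      by_contra h
      exact hφ (subset_tsupport _ h) rfl
    simp [this]
  simp only [e1, integral_zero, zero_add]
  refine integral_congr_ae (Eventually.of_forall fun p => ?_)
  simp only [Complex.real_smul]
  ring

/-- Testing against smooth functions supported in W gives equality almost everywhere, and continuity
on the open set upgrades it to every point. Values of U at single points, such as (a, 2τ), are
thereby well defined. -/
theorem EqFunctionOn.eqOn {U : 𝓓'^{(n : ℕ∞)}((⊤ : Opens Spacetime), ℂ)} {u v : Spacetime → ℂ}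
    {W : Set Spacetime} (hW : IsOpen W) (hu : EqFunctionOn U u W) (hv : EqFunctionOn U v W) :
    EqOn v u W := by
  have hc : ContinuousOn (fun p => v p - u p) W := hv.1.sub hu.1
  have hae := hW.ae_eq_zero_of_integral_contDiff_smul_eq_zero
    (hc.locallyIntegrableOn hW.measurableSet (μ := volume)) fun g hg hgc hgW => ?_
  · have h1 : (fun p => v p - u p) =ᵐ[volume.restrict W] fun _ => 0 :=
      (ae_restrict_iff' hW.measurableSet).2 hae
    have h2 := Measure.eqOn_open_of_ae_eq h1 hW hc continuousOn_const
    intro p hp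
    exact sub_eq_zero.1 (h2 hp)
  · let φ : 𝓓^{(n : ℕ∞)}((⊤ : Opens Spacetime), ℝ) :=
      ⟨g, hg.of_le (by norm_cast; exact le_top), hgc, fun _ _ => mem_univ _⟩
    have i : ∀ w : Spacetime → ℂ, ContinuousOn w W →
        Integrable fun p => ((φ p : ℝ) : ℂ) * w p := by
      intro w hw
      have hcont : Continuous fun p => ((g p : ℝ) : ℂ) * w p := by
        refine continuous_of_tsupport fun p hp => ?_
        refine (Complex.continuous_ofReal.comp hg.continuous).continuousAt.mul
          (hw.continuousAt (hW.mem_nhds (hgW (closure_mono (fun p hp => ?_) hp))))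
        have := left_ne_zero_of_mul hp
        exact_mod_cast this
      exact hcont.integrable_of_hasCompactSupport
        (hgc.comp_left (g := fun x : ℝ => (x : ℂ)) Complex.ofReal_zero).mul_right
    have h1 := hu.2 φ hgW
    have h2 := hv.2 φ hgW
    calc ∫ p, g p • (v p - u p) = ∫ p, (((φ p : ℝ) : ℂ) * v p - ((φ p : ℝ) : ℂ) * u p) := by
          refine integral_congr_ae (Eventually.of_forall fun p => ?_)
          simp only [Complex.real_smul, mul_sub]
          rfl
      _ = 0 := by rw [integral_sub (i v hv.1) (i u hu.1), ← h1, ← h2, sub_self]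

end OffCone

/-! ### The backward problem -/

section Backward

theorem fderiv_exp_time (c : ℝ) (p v : Spacetime) :
    fderiv ℝ (fun p : Spacetime => (Real.exp (c * p.2) : ℂ)) p v =
      (c * v.2 : ℂ) * (Real.exp (c * p.2) : ℂ) := by
  have h1 : HasFDerivAt (fun p : Spacetime => Real.exp (c * p.2)) _ p :=
    ((hasFDerivAt_snd (p := p) (𝕜 := ℝ)).const_mul c).exp
  have h2 : HasFDerivAt (fun p : Spacetime => (Real.exp (c * p.2) : ℂ)) _ p :=
    Complex.ofRealCLM.hasFDerivAt.comp p h1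
  rw [h2.fderiv]
  simp
  ring

theorem contDiff_exp_time (c : ℝ) {k : WithTop ℕ∞} :
    ContDiff ℝ k fun p : Spacetime => (Real.exp (c * p.2) : ℂ) :=
  contDiff_ofReal (f := fun p : Spacetime => Real.exp (c * p.2)) (by fun_prop)

theorem dd_exp_time (c : ℝ) (p v : Spacetime) :
    dd v (fun p : Spacetime => (Real.exp (c * p.2) : ℂ)) p =
      (c * v.2 : ℂ) ^ 2 * (Real.exp (c * p.2) : ℂ) := by
  unfold dd
  simp_rw [fderiv_exp_time]
  rw [fderiv_mul_dir (differentiable_const _) ((contDiff_exp_time c).differentiable one_ne_zero),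
    fderiv_exp_time]
  simp
  ring

theorem box_exp_mul (c : ℝ) {f : Spacetime → ℂ} (hf : ContDiff ℝ 2 f) (p : Spacetime) :
    box (fun p => (Real.exp (c * p.2) : ℂ) * f p) p =
      (Real.exp (c * p.2) : ℂ) * (box f p + 2 * c * fderiv ℝ f p timeDir + c ^ 2 * f p) := by
  simp only [box, dd_mul (contDiff_exp_time c) hf, fderiv_exp_time, dd_exp_time, timeDir,
    Fin.sum_univ_three, Complex.ofReal_zero, Complex.ofReal_one]
  ring

/-- Retarded potentials for the reversed time direction invert the wave operator. -/
theorem box_exp_mul_pot {ℓ : ℝ} (hℓ : 0 < ℓ) {G : Spacetime → ℂ} {A R : ℝ} (hG : BddC 2 A G)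
    (hR : ∀ p : Spacetime, R < p.2 → G p = 0) (p : Spacetime) :
    box (fun p => (Real.exp (-ℓ * p.2) : ℂ) * pot ℓ (-1) G p) p =
      (Real.exp (-ℓ * p.2) : ℂ) * G p := by
  have hs := aestronglyMeasurable_shift (-1)
  have hb : BddC 0 (A + (A + A + A)) (box G) := by
    have := (hG.dd (k := 0) norm_timeDir.le).sub
      (((hG.dd (k := 0) (norm_spaceDir_zero 0).le).add
        (hG.dd (k := 0) (norm_spaceDir_zero 1).le)).add (hG.dd (k := 0) (norm_spaceDir_zero 2).le))
    exact this.congr fun p => by simp only [box, Fin.sum_univ_three]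
  have hGt : BddC 0 A fun p => fderiv ℝ G p timeDir :=
    (hG.fderiv_dir (k := 1) norm_timeDir.le).mono (Nat.zero_le _) le_rfl
  have e1 : box (pot ℓ (-1) G) p = pot ℓ (-1) (box G) p := box_avg (integrable_ker hℓ) hs hG p
  have e2 : fderiv ℝ (pot ℓ (-1) G) p timeDir = pot ℓ (-1) (fun p => fderiv ℝ G p timeDir) p := by
    unfold pot
    rw [fderiv_avg_apply (integrable_ker hℓ) aestronglyMeasurable_const (by simp) hs
      (hG.mono (by norm_num) le_rfl)]
    simp
  have hpot : ContDiff ℝ 2 (pot ℓ (-1) G) := (hG.pot hℓ).1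
  rw [box_exp_mul (-ℓ) hpot, e1, e2]
  have hS : ContDiff ℝ 2 fun p => (Real.exp (-ℓ * p.2) : ℂ) * G p :=
    (contDiff_exp_time _).mul hG.1
  -- All derivatives have been passed onto G under the integral. The claim is then the fundamental
  -- solution identity for e^{-ℓt}G translated by p, whose exponential supplies the kernel's
  -- damping.
  have key := integral_box_cone (h := fun x => (Real.exp (-ℓ * (p + x).2) : ℂ) * G (p + x))
    (R := R - p.2) (hS.comp (contDiff_const.add contDiff_id)) fun x hx => by
      rw [hR _ (by simp; linarith), mul_zero]
  simp only [box_comp_add_left (fun p => (Real.exp (-ℓ * p.2) : ℂ) * G p) p, add_zero] at key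
  rw [← key]
  have hi := fun {f : Spacetime → ℂ} {B : ℝ} (hf : BddC 0 B f) =>
    integrable_avg (α := fun _ => 1) (integrable_ker hℓ) aestronglyMeasurable_const hs hf p
  have i1 := hi hb
  have i2 := (hi hGt).const_mul (2 * (-ℓ : ℂ))
  have i3 := (hi (hG.mono (Nat.zero_le _) le_rfl)).const_mul ((-ℓ : ℂ) ^ 2)
  unfold pot avg
  simp only [Complex.ofReal_neg]
  rw [← integral_const_mul, ← integral_const_mul, ← integral_add i1 i2,
    ← integral_add (f := fun z => _ + _) (i1.add i2) i3, ← integral_const_mul,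
    ← integral_neg_eq_self]
  refine integral_congr_ae (Eventually.of_forall fun z => ?_)
  have hz : (1 : ℝ) • p + (-(-z), -(-1 * ‖z‖)) = p + (z, ‖z‖) := by simp
  simp only [norm_neg, hz, box_exp_mul (-ℓ) hG.1, Complex.real_smul, ker, Prod.snd_add, mul_add,
    Real.exp_add]
  push_cast
  rw [show (-(ℓ : ℂ) * ‖z‖) = -(ℓ * ‖z‖) by ring]
  ring

variable {n : ℕ} {q : Space → ℂ} {Q : ℝ}

/-- Solvability of the backward problem with data of class `C^n`. -/
theorem exists_backward_solution (hn : 2 ≤ n) (hq : BddC n Q q) {ψ : Spacetime → ℂ}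
    (hψ : ContDiff ℝ n ψ) (hc : HasCompactSupport ψ) :
    ∃ φ : Spacetime → ℂ, ∃ R : ℝ, ContDiff ℝ n φ ∧ (∀ p : Spacetime, φ p ≠ 0 → ‖p.1‖ + p.2 ≤ R) ∧
      ∀ p, box φ p = ψ p + q p.1 * φ p := by
  -- The summand 1 ensures ℓ ≥ 1, so ℓ² ≥ ℓ and the contraction condition follows.
  set ℓ : ℝ := 2 ^ n * Q * 2 + 1 with hℓdef
  have hQ := hq.nonneg
  have hℓ1 : 1 ≤ ℓ := by
    have : 0 ≤ 2 ^ n * Q * 2 := by positivity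
    linarith
  have hℓ : 0 < ℓ := by linarith
  have hM : 2 ^ n * Q * 2 ≤ ℓ ^ 2 := by nlinarith
  obtain ⟨A, hF⟩ := exists_bddC_of_hasCompactSupport
    (f := fun p : Spacetime => (Real.exp (ℓ * p.2) : ℂ) * ψ p)
    ((contDiff_exp_time ℓ).mul hψ) hc.mul_left
  set F : Spacetime → ℂ := fun p => (Real.exp (ℓ * p.2) : ℂ) * ψ p with hFdef
  obtain ⟨R, hR⟩ := hc.isCompact.isBounded.subset_closedBall 0
  have hg := bddC_resolvent (ε := -1) hℓ hq hM hF
  have heq := resolvent_eq (ε := -1) hℓ hq hM hF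
  set g := resolvent ℓ (-1) q F with hgdef
  -- Advanced potentials preserve |x| + t ≤ 2R, because |x| ≤ |x - z| + |z|. The product norm is a
  -- maximum, so on the support of ψ both |x| and t are at most R.
  have hsupp : ∀ p : Spacetime, g p ≠ 0 → ‖p.1‖ + p.2 ≤ 2 * R := by
    refine support_resolvent (S := {p : Spacetime | ‖p.1‖ + p.2 ≤ 2 * R}) (fun p z h => ?_)
      (fun p h => ?_)
    · simp only [mem_ofPred_eq, Prod.fst_add, Prod.snd_add] at h ⊢
      have h1 := norm_sub_norm_le p.1 z
      rw [← sub_eq_add_neg] at h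
      linarith
    · have h1 := hR (subset_tsupport _ (right_ne_zero_of_mul h))
      rw [mem_closedBall_zero_iff, Prod.norm_def, sup_le_iff] at h1
      have h2 := (le_abs_self _).trans h1.2
      simp only [mem_ofPred_eq]
      linarith
  have hG : BddC n _ fun p => F p + q p.1 * g p := hF.add (hq.comp_fst.mul hg)
  have hGlate : ∀ p : Spacetime, 2 * R + |R| < p.2 → F p + q p.1 * g p = 0 := by
    intro p hp
    have h1 : g p = 0 := by
      by_contra h
      have := hsupp p h
      linarith [norm_nonneg p.1, abs_nonneg R]
    have h2 : ψ p = 0 := by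
      by_contra h
      have h1 := hR (subset_tsupport _ h)
      rw [mem_closedBall_zero_iff, Prod.norm_def, sup_le_iff] at h1
      have h2 := (le_abs_self _).trans h1.2
      have h3 : 0 ≤ R := (norm_nonneg _).trans h1.1
      linarith [abs_nonneg R]
    simp [hFdef, h1, h2]
  refine ⟨fun p => (Real.exp (-ℓ * p.2) : ℂ) * g p, 2 * R, (contDiff_exp_time _).mul hg.1,
    fun p hp => hsupp p (right_ne_zero_of_mul hp), fun p => ?_⟩
  have := box_exp_mul_pot hℓ (hG.mono hn le_rfl) hGlate p
  have hpot : pot ℓ (-1) (fun p => F p + q p.1 * g p) = g := funext fun p => (heq p).symm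
  rw [hpot] at this
  rw [this, hFdef]
  have h1 : Complex.exp (-ℓ * p.2) * Complex.exp (ℓ * p.2) = 1 := by
    rw [← Complex.exp_add]
    simp
  push_cast
  linear_combination ψ p * h1

end Backward

/-! ### Mollification -/

section Mollify

variable {E : Type} [NormedAddCommGroup E] [NormedSpace ℝ E]

/-- The mollification of a function by a bump function. -/
def mollify (η : ContDiffBump (0 : Spacetime)) (f : Spacetime → E) : Spacetime → E :=
  avg volume (η.normed volume) (fun _ => 1) (fun ω => -ω) f

/-- The convolution form gives smoothness and convergence; the average form lets derivatives and
`box` pass through. -/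
theorem mollify_eq_convolution (η : ContDiffBump (0 : Spacetime)) (f : Spacetime → E) :
    mollify η f = convolution (η.normed volume) f (ContinuousLinearMap.lsmul ℝ ℝ) volume := by
  ext p
  simp [mollify, avg, convolution, sub_eq_add_neg]

theorem contDiff_mollify (η : ContDiffBump (0 : Spacetime)) {f : Spacetime → E}
    (hf : Continuous f) {k : ℕ∞} : ContDiff ℝ k (mollify η f) := by
  rw [mollify_eq_convolution]
  exact η.hasCompactSupport_normed.contDiff_convolution_left _ η.contDiff_normed
    hf.locallyIntegrable

theorem aestronglyMeasurable_neg_id :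
    AEStronglyMeasurable (fun ω : Spacetime => -ω) volume :=
  continuous_neg.aestronglyMeasurable

theorem fderiv_mollify [CompleteSpace E] (η : ContDiffBump (0 : Spacetime)) {f : Spacetime → E} {A : ℝ}
    (hf : BddC 1 A f) : fderiv ℝ (mollify η f) = mollify η (fderiv ℝ f) := by
  unfold mollify
  rw [fderiv_avg η.integrable_normed aestronglyMeasurable_const (by simp)
    aestronglyMeasurable_neg_id hf]
  simp

/-- Mollification commutes with differentiation, so convergence in C^k reduces to uniform continuity
of each derivative, which compact support provides. -/
theorem exists_bddC_mollify_sub : ∀ {k : ℕ} {E : Type} [NormedAddCommGroup E] [NormedSpace ℝ E]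
    [CompleteSpace E] {f : Spacetime → E} (_ : ContDiff ℝ k f) (_ : HasCompactSupport f) {ε : ℝ}
    (_ : 0 < ε), ∃ δ > 0, ∀ η : ContDiffBump (0 : Spacetime), η.rOut < δ →
      BddC k ε fun p => mollify η f p - f p := by
  have base : ∀ {E : Type} [NormedAddCommGroup E] [NormedSpace ℝ E] [CompleteSpace E]
      {f : Spacetime → E} (_ : Continuous f) (_ : HasCompactSupport f) {ε : ℝ} (_ : 0 < ε),
      ∃ δ > 0, ∀ η : ContDiffBump (0 : Spacetime), η.rOut < δ →
        ∀ p, ‖mollify η f p - f p‖ ≤ ε := by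
    intro E _ _ _ f hf hc ε hε
    obtain ⟨δ, hδ, h⟩ := Metric.uniformContinuous_iff.1 (hc.uniformContinuous_of_continuous hf) ε hε
    refine ⟨δ, hδ, fun η hη p => ?_⟩
    rw [mollify_eq_convolution, ← dist_eq_norm]
    exact η.dist_normed_convolution_le hf.aestronglyMeasurable
      fun x hx => (h ((mem_ball.1 hx).trans hη)).le
  intro k
  induction k with
  | zero =>
    intro E _ _ _ f hf hc ε hε
    obtain ⟨δ, hδ, h⟩ := base hf.continuous hc hε
    exact ⟨δ, hδ, fun η hη => bddC_zero_iff.2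
      ⟨(contDiff_mollify η hf.continuous (k := 0)).continuous.sub hf.continuous, h η hη⟩⟩
  | succ k ih =>
    intro E _ _ _ f hf hc ε hε
    obtain ⟨δ, hδ, h⟩ := base hf.continuous hc hε
    have hf' : ContDiff ℝ k (fderiv ℝ f) := hf.fderiv_right (by norm_cast)
    obtain ⟨δ', hδ', h'⟩ := ih hf' (hc.fderiv ℝ) hε
    obtain ⟨A, hA⟩ := exists_bddC_of_hasCompactSupport hf hc
    have hd : Differentiable ℝ f := hf.differentiable (by simp)
    refine ⟨min δ δ', lt_min hδ hδ', fun η hη => ?_⟩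
    have hm : Differentiable ℝ (mollify η f) :=
      (contDiff_mollify η hf.continuous (k := 1)).differentiable (by simp)
    refine bddC_succ_iff.2 ⟨h η (hη.trans_le (min_le_left _ _)), hm.sub hd, ?_⟩
    refine (h' η (hη.trans_le (min_le_right _ _))).congr fun p => ?_
    rw [← fderiv_mollify η (hA.mono (by omega) le_rfl), fderiv_fun_sub (hm p) (hd p)]

theorem exists_of_mollify_ne_zero {η : ContDiffBump (0 : Spacetime)} {f : Spacetime → E}
    {p : Spacetime} (h : mollify η f p ≠ 0) : ∃ ω, ‖ω‖ < η.rOut ∧ f (p - ω) ≠ 0 := by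
  by_contra! hc
  refine h (integral_eq_zero_of_ae (Eventually.of_forall fun ω => ?_))
  by_cases hω : ‖ω‖ < η.rOut
  · simp [← sub_eq_add_neg, hc ω hω]
  · have : η.normed volume ω = 0 := by
      rw [← Function.notMem_support, η.support_normed_eq]
      simpa using hω
    simp [this]

theorem hasCompactSupport_mollify (η : ContDiffBump (0 : Spacetime)) {f : Spacetime → E}
    (hc : HasCompactSupport f) : HasCompactSupport (mollify η f) := by
  rw [mollify_eq_convolution]
  exact η.hasCompactSupport_normed.convolution _ hc

end Mollify

/-! ### Complex valued test functions -/

section Complexify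

variable {n : ℕ}

/-- A compactly supported `C^n` function as a test function. -/
def mkTest {F : Type} [NormedAddCommGroup F] [NormedSpace ℝ F] {k : ℕ∞} (f : Spacetime → F)
    (hf : ContDiff ℝ k f) (hc : HasCompactSupport f) : 𝓓^{k}((⊤ : Opens Spacetime), F) :=
  ⟨f, hf, hc, fun _ _ => mem_univ _⟩

def reTest {k : ℕ∞} (f : 𝓓^{k}((⊤ : Opens Spacetime), ℂ)) : 𝓓^{k}((⊤ : Opens Spacetime), ℝ) :=
  mkTest (fun p => (f p).re) (Complex.reCLM.contDiff.comp f.contDiff)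
    (f.hasCompactSupport.comp_left Complex.zero_re)

def imTest {k : ℕ∞} (f : 𝓓^{k}((⊤ : Opens Spacetime), ℂ)) : 𝓓^{k}((⊤ : Opens Spacetime), ℝ) :=
  mkTest (fun p => (f p).im) (Complex.imCLM.contDiff.comp f.contDiff)
    (f.hasCompactSupport.comp_left Complex.zero_im)

@[simp]
theorem mkTest_apply {F : Type} [NormedAddCommGroup F] [NormedSpace ℝ F] {k : ℕ∞}
    (f : Spacetime → F) (hf : ContDiff ℝ k f) (hc : HasCompactSupport f) (p : Spacetime) :
    mkTest f hf hc p = f p := rfl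

@[simp]
theorem reTest_apply {k : ℕ∞} (f : 𝓓^{k}((⊤ : Opens Spacetime), ℂ)) (p : Spacetime) :
    reTest f p = (f p).re := rfl

@[simp]
theorem imTest_apply {k : ℕ∞} (f : 𝓓^{k}((⊤ : Opens Spacetime), ℂ)) (p : Spacetime) :
    imTest f p = (f p).im := rfl

/-- The extension of a distribution to complex valued test functions. -/
def complexify (W : 𝓓'^{(n : ℕ∞)}((⊤ : Opens Spacetime), ℂ))
    (f : 𝓓^{(n : ℕ∞)}((⊤ : Opens Spacetime), ℂ)) : ℂ :=
  W (reTest f) + Complex.I * W (imTest f)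

variable (W : 𝓓'^{(n : ℕ∞)}((⊤ : Opens Spacetime), ℂ))

theorem complexify_add (f g : 𝓓^{(n : ℕ∞)}((⊤ : Opens Spacetime), ℂ)) :
    complexify W (f + g) = complexify W f + complexify W g := by
  have h1 : reTest (f + g) = reTest f + reTest g := by
    ext p
    simp
  have h2 : imTest (f + g) = imTest f + imTest g := by
    ext p
    simp
  unfold complexify
  rw [h1, h2, map_add, map_add]
  ring

theorem complexify_sub (f g : 𝓓^{(n : ℕ∞)}((⊤ : Opens Spacetime), ℂ)) :
    complexify W (f - g) = complexify W f - complexify W g := by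
  rw [eq_sub_iff_add_eq, ← complexify_add, sub_add_cancel]

theorem exists_bound_complexify (R : ℝ) :
    ∃ C, 0 ≤ C ∧ ∀ (f : 𝓓^{(n : ℕ∞)}((⊤ : Opens Spacetime), ℂ)) (A : ℝ), BddC n A f →
      (∀ p, R < ‖p‖ → f p = 0) → ‖complexify W f‖ ≤ C * A := by
  obtain ⟨C, hC, h⟩ := exists_bound_of_distribution W R
  refine ⟨2 * C, by positivity, fun f A hf hR => ?_⟩
  have h1 := h (reTest f) A ((hf.clm Complex.reCLM).mono le_rfl
    (mul_le_of_le_one_left hf.nonneg (by simp))) fun p hp => by rw [reTest_apply, hR p hp, Complex.zero_re]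
  have h2 := h (imTest f) A ((hf.clm Complex.imCLM).mono le_rfl
    (mul_le_of_le_one_left hf.nonneg (by simp))) fun p hp => by rw [imTest_apply, hR p hp, Complex.zero_im]
  unfold complexify
  refine (norm_add_le _ _).trans ?_
  rw [norm_mul, Complex.norm_I, one_mul]
  linarith

theorem complexify_eq_zero {s : Set Spacetime} (hs : IsClosed s)
    (hW : Distribution.IsVanishingOn W {p : Spacetime | p.2 < 0}) (hs0 : ∀ p ∈ s, p.2 < 0)
    (f : 𝓓^{(n : ℕ∞)}((⊤ : Opens Spacetime), ℂ)) (hf : ∀ p, f p ≠ 0 → p ∈ s) :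
    complexify W f = 0 := by
  have key : ∀ g : 𝓓^{(n : ℕ∞)}((⊤ : Opens Spacetime), ℝ), (∀ p, f p = 0 → g p = 0) → W g = 0 := by
    intro g hg
    have hsub : tsupport g ⊆ s :=
      closure_minimal (fun p (hp : g p ≠ 0) => hf p fun h => hp (hg p h)) hs
    exact hW g (hsub.trans hs0)
  unfold complexify
  rw [key (reTest f) fun p hp => by rw [reTest_apply, hp, Complex.zero_re],
    key (imTest f) fun p hp => by rw [imTest_apply, hp, Complex.zero_im]]
  simp

theorem box_const_mul (c : ℂ) {f : Spacetime → ℂ} (hf : ContDiff ℝ 2 f) (p : Spacetime) :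
    box (fun p => c * f p) p = c * box f p := by
  have h : ∀ v, dd v (fun _ : Spacetime => c) p = 0 := fun v => by simp [dd]
  simp only [box, dd_mul (contDiff_const (c := c)) hf, h, fderiv_fun_const, Fin.sum_univ_three]
  simp
  ring

variable {W} in
/-- The homogeneous equation, tested with complex valued functions. -/
theorem complexify_box {q : 𝓓^{(n : ℕ∞)}(unitBall, ℂ)}
    (hW : ∀ φ : 𝓓((⊤ : Opens Spacetime), ℝ), W (ofSmooth n (dAlembert φ)) = mulPairing q W φ)
    (f : 𝓓((⊤ : Opens Spacetime), ℂ)) {b m : 𝓓^{(n : ℕ∞)}((⊤ : Opens Spacetime), ℂ)}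
    (hb : ∀ p, b p = box f p) (hm : ∀ p, m p = q p.1 * f p) :
    complexify W b = complexify W m := by
  have hre : ContDiff ℝ 2 fun p => ((reTest f p : ℝ) : ℂ) :=
    contDiff_ofReal ((reTest f).contDiff.of_le (by norm_cast))
  have him : ContDiff ℝ 2 fun p => ((imTest f p : ℝ) : ℂ) :=
    contDiff_ofReal ((imTest f).contDiff.of_le (by norm_cast))
  have hbox : ∀ p, b p = (dAlembert (reTest f) p : ℂ) + Complex.I * (dAlembert (imTest f) p : ℂ) := by
    intro p
    rw [hb, ofReal_dAlembert, ofReal_dAlembert, ← box_const_mul _ him,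
      ← box_add hre (contDiff_const.mul him)]
    congr 1
    ext x
    rw [reTest_apply, imTest_apply, mul_comm, Complex.re_add_im]
  have e1 : reTest b = ofSmooth n (dAlembert (reTest f)) := by
    ext p
    rw [ofSmooth_apply]
    change (b p).re = _
    rw [hbox]
    simp
  have e2 : imTest b = ofSmooth n (dAlembert (imTest f)) := by
    ext p
    rw [ofSmooth_apply]
    change (b p).im = _
    rw [hbox]
    simp
  set M1 := fun φ => mulTest n (fun x => (q x).re) (Complex.reCLM.contDiff.comp q.contDiff) φ
    with hM1
  set M2 := fun φ => mulTest n (fun x => (q x).im) (Complex.imCLM.contDiff.comp q.contDiff) φ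
    with hM2
  have e3 : reTest m = M1 (reTest f) - M2 (imTest f) := by
    ext p
    change (m p).re = (q p.1).re * (f p).re - (q p.1).im * (f p).im
    rw [hm, Complex.mul_re]
  have e4 : imTest m = M1 (imTest f) + M2 (reTest f) := by
    ext p
    change (m p).im = (q p.1).re * (f p).im + (q p.1).im * (f p).re
    rw [hm, Complex.mul_im]
  unfold complexify
  rw [e1, e2, e3, e4, hW, hW, map_sub, map_add]
  change W (M1 (reTest f)) + Complex.I * W (M2 (reTest f)) +
    Complex.I * (W (M1 (imTest f)) + Complex.I * W (M2 (imTest f))) = _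
  linear_combination W (M2 (imTest f)) * Complex.I_mul_I

end Complexify

/-! ### Uniqueness by duality -/

section Uniqueness

variable {n : ℕ}

/-- A cutoff in time that vanishes for `t ≤ -1` and is one for `t ≥ -1/2`. -/
def initialCutoff (p : Spacetime) : ℂ := (Real.smoothTransition (2 * p.2 + 2) : ℂ)

theorem contDiff_initialCutoff {k : ℕ} : ContDiff ℝ k initialCutoff :=
  contDiff_ofReal (f := fun p : Spacetime => Real.smoothTransition (2 * p.2 + 2))
    (Real.smoothTransition.contDiff.comp ((contDiff_const.mul contDiff_snd).add contDiff_const))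

theorem initialCutoff_eq_one {p : Spacetime} (hp : -1 / 2 ≤ p.2) : initialCutoff p = 1 := by
  simp [initialCutoff, Real.smoothTransition.one_of_one_le (by linarith : 1 ≤ 2 * p.2 + 2)]

theorem initialCutoff_eq_zero {p : Spacetime} (hp : p.2 ≤ -1) : initialCutoff p = 0 := by
  simp [initialCutoff, Real.smoothTransition.zero_of_nonpos (by linarith : 2 * p.2 + 2 ≤ 0)]

/-- Let χ be the initial cutoff, φ the backward solution for ψ and u = χφ. Then box u = χψ + qu + e
with e supported in t ≤ -1/2, where W vanishes, so formally W(χψ) = W(box u - qu) = 0. Since u is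
only C^n, the equation is applied to its mollification. The mollified box u is the sum of the
mollified χψ, qu and e; the first two converge in C^n, while the third stays in the past and needs
no convergence. -/
theorem complexify_initialCutoff_eq_zero (hn : 2 ≤ n) {q : 𝓓^{(n : ℕ∞)}(unitBall, ℂ)}
    {W : 𝓓'^{(n : ℕ∞)}((⊤ : Opens Spacetime), ℂ)}
    (hW : ∀ φ : 𝓓((⊤ : Opens Spacetime), ℝ), W (ofSmooth n (dAlembert φ)) = mulPairing q W φ)
    (hv : Distribution.IsVanishingOn W {p : Spacetime | p.2 < 0}) {ψ : Spacetime → ℂ}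
    (hψ : ContDiff ℝ n ψ) (hψc : HasCompactSupport ψ)
    (T₀ : 𝓓^{(n : ℕ∞)}((⊤ : Opens Spacetime), ℂ)) (hT₀ : ∀ p, T₀ p = initialCutoff p * ψ p) :
    complexify W T₀ = 0 := by
  obtain ⟨Q, hQ⟩ := exists_bddC_of_hasCompactSupport q.contDiff q.hasCompactSupport
  obtain ⟨φ, R, hφ, hφs, hφe⟩ := exists_backward_solution hn hQ hψ hψc
  have hq : ContDiff ℝ n fun p : Spacetime => q p.1 := q.contDiff.comp contDiff_fst
  set u : Spacetime → ℂ := fun p => initialCutoff p * φ p with hu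
  have huC : ContDiff ℝ n u := contDiff_initialCutoff.mul hφ
  have hu2 : ContDiff ℝ 2 u := huC.of_le (by exact_mod_cast hn)
  -- The backward solution lives in |x| + t ≤ R and the cutoff in t > -1, and together these confine
  -- the support to a bounded set.
  have huc : HasCompactSupport u := by
    refine HasCompactSupport.intro (isCompact_closedBall (0 : Spacetime) (|R| + 1)) fun p hp => ?_
    by_contra h
    have h1 := hφs p (right_ne_zero_of_mul h)
    have h2 : -1 < p.2 := by
      by_contra h2
      exact left_ne_zero_of_mul h (initialCutoff_eq_zero (not_lt.1 h2))
    refine hp ?_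
    rw [mem_closedBall_zero_iff, Prod.norm_def, sup_le_iff, Real.norm_eq_abs, abs_le]
    have h3 := norm_nonneg p.1
    have h4 := le_abs_self R
    have h5 := abs_nonneg R
    refine ⟨by linarith, by linarith, by linarith⟩
  set s : Spacetime → ℂ := fun p => initialCutoff p * ψ p with hs
  have hsC : ContDiff ℝ n s := contDiff_initialCutoff.mul hψ
  have hsc : HasCompactSupport s := hψc.mul_left
  set w : Spacetime → ℂ := fun p => q p.1 * u p with hw
  have hwC : ContDiff ℝ n w := hq.mul huC
  have hwc : HasCompactSupport w := huc.mul_left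
  set e : Spacetime → ℂ := fun p => box u p - w p - s p with he
  have hec : HasCompactSupport e := ((hasCompactSupport_box huc).sub hwc).sub hsc
  have heC : Continuous e := ((continuous_box hu2).sub hwC.continuous).sub hsC.continuous
  have hes : ∀ p : Spacetime, e p ≠ 0 → p.2 ≤ -1 / 2 := by
    intro p hp
    by_contra h
    refine hp ?_
    have hev : ∀ᶠ x : Spacetime in 𝓝 p, -1 / 2 < x.2 :=
      continuousAt_const.eventually_lt continuousAt_snd (not_le.1 h)
    have h1 : u =ᶠ[𝓝 p] φ := by
      filter_upwards [hev] with x hx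
      simp [hu, initialCutoff_eq_one hx.le]
    have h2 : box u p = box φ p := by
      have : ∀ v, dd v u p = dd v φ p := fun v =>
        congrArg (fun L : Spacetime →L[ℝ] ℂ => L v) (Filter.EventuallyEq.fderiv_eq
          (h1.fderiv.mono fun x hx => congrArg (fun L : Spacetime →L[ℝ] ℂ => L v) hx))
      simp only [box, this]
    have h3 : e p = box u p - w p - s p := rfl
    rw [h3, h2, hφe]
    simp only [hw, hs, hu, initialCutoff_eq_one (not_le.1 h).le]
    ring
  obtain ⟨Rs, hRs⟩ := hsc.isCompact.isBounded.subset_closedBall 0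
  obtain ⟨Ru, hRu⟩ := huc.isCompact.isBounded.subset_closedBall 0
  set R₁ := max Rs Ru + 1 with hR₁
  have hs0 : ∀ p, max Rs Ru < ‖p‖ → s p = 0 := fun p hp => by
    by_contra h
    have := hRs (subset_tsupport _ h)
    rw [mem_closedBall_zero_iff] at this
    linarith [le_max_left Rs Ru]
  have hu0 : ∀ p, max Rs Ru < ‖p‖ → u p = 0 := fun p hp => by
    by_contra h
    have := hRu (subset_tsupport _ h)
    rw [mem_closedBall_zero_iff] at this
    linarith [le_max_right Rs Ru]
  have hw0 : ∀ p, max Rs Ru < ‖p‖ → w p = 0 := fun p hp => by simp [hw, hu0 p hp]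
  have hmoll : ∀ (η : ContDiffBump (0 : Spacetime)) (f : Spacetime → ℂ), η.rOut < 1 / 4 →
      (∀ p, max Rs Ru < ‖p‖ → f p = 0) → ∀ p, R₁ < ‖p‖ → mollify η f p = 0 := by
    intro η f hη hf p hp
    by_contra h
    obtain ⟨ω, h1, h2⟩ := exists_of_mollify_ne_zero h
    refine h2 (hf _ ?_)
    have := norm_sub_norm_le p ω
    linarith
  obtain ⟨C, hC, hbound⟩ := exists_bound_complexify W R₁
  obtain ⟨As, hAs⟩ := exists_bddC_of_hasCompactSupport (k := 0) (hsC.of_le (by simp)) hsc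
  obtain ⟨Aw, hAw⟩ := exists_bddC_of_hasCompactSupport (k := 0) (hwC.of_le (by simp)) hwc
  obtain ⟨Ae, hAe⟩ := exists_bddC_of_hasCompactSupport (k := 0) (contDiff_zero.2 heC) hec
  obtain ⟨Au, hAu⟩ := exists_bddC_of_hasCompactSupport (k := 2) hu2 huc
  have hQ0 := hQ.nonneg
  have main : ∀ ε > 0, ‖complexify W T₀‖ ≤ C * (ε + ε + 2 ^ n * Q * ε) := by
    intro ε hε
    obtain ⟨δ₁, hδ₁, h₁⟩ := exists_bddC_mollify_sub hsC hsc hε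
    obtain ⟨δ₂, hδ₂, h₂⟩ := exists_bddC_mollify_sub hwC hwc hε
    obtain ⟨δ₃, hδ₃, h₃⟩ := exists_bddC_mollify_sub huC huc hε
    -- A mollification radius below 1/4 keeps all supports in the ball of radius R₁ and the
    -- mollified e in t ≤ -1/4.
    set δ := min (min δ₁ δ₂) (min δ₃ (1 / 4)) with hδdef
    have hδ : 0 < δ := by positivity
    let η : ContDiffBump (0 : Spacetime) := ⟨δ / 4, δ / 2, by positivity, by linarith⟩
    have hη : η.rOut < δ := by
      change δ / 2 < δ
      linarith
    have hη1 : η.rOut < δ₁ := hη.trans_le ((min_le_left _ _).trans (min_le_left _ _))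
    have hη2 : η.rOut < δ₂ := hη.trans_le ((min_le_left _ _).trans (min_le_right _ _))
    have hη3 : η.rOut < δ₃ := hη.trans_le ((min_le_right _ _).trans (min_le_left _ _))
    have hη4 : η.rOut < 1 / 4 := hη.trans_le ((min_le_right _ _).trans (min_le_right _ _))
    have hmu : ContDiff ℝ ((⊤ : ℕ∞) : WithTop ℕ∞) (mollify η u) := contDiff_mollify η huC.continuous
    have hboxC : ContDiff ℝ n (box (mollify η u)) := by
      have h : ContDiff ℝ (n + 2 : ℕ) (mollify η u) := hmu.of_le (by
        change (((n + 2 : ℕ) : ℕ∞) : WithTop ℕ∞) ≤ _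
        exact WithTop.coe_le_coe.2 le_top)
      exact (contDiff_dd h _).sub (ContDiff.sum fun i _ => contDiff_dd h _)
    let Tb : 𝓓^{(n : ℕ∞)}((⊤ : Opens Spacetime), ℂ) := mkTest _ hboxC
      (hasCompactSupport_box (hasCompactSupport_mollify η huc))
    let T₁ : 𝓓^{(n : ℕ∞)}((⊤ : Opens Spacetime), ℂ) := mkTest _
      (contDiff_mollify η hsC.continuous) (hasCompactSupport_mollify η hsc)
    let T₂ : 𝓓^{(n : ℕ∞)}((⊤ : Opens Spacetime), ℂ) := mkTest _
      (contDiff_mollify η hwC.continuous) (hasCompactSupport_mollify η hwc)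
    let T₃ : 𝓓^{(n : ℕ∞)}((⊤ : Opens Spacetime), ℂ) := mkTest _
      (contDiff_mollify η heC) (hasCompactSupport_mollify η hec)
    let Tq : 𝓓^{(n : ℕ∞)}((⊤ : Opens Spacetime), ℂ) := mkTest w hwC hwc
    let Tm : 𝓓^{(n : ℕ∞)}((⊤ : Opens Spacetime), ℂ) := mkTest (fun p => q p.1 * mollify η u p)
      (hq.mul (contDiff_mollify η huC.continuous)) (hasCompactSupport_mollify η huc).mul_left
    have eq1 : complexify W Tb = complexify W Tm :=
      complexify_box hW (mkTest (mollify η u) hmu (hasCompactSupport_mollify η huc))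
        (fun _ => rfl) fun _ => rfl
    have eq2 : Tb = T₁ + T₂ + T₃ := by
      ext p
      have h1 : box (mollify η u) p = mollify η (box u) p :=
        box_avg η.integrable_normed aestronglyMeasurable_neg_id hAu p
      have h2 : box u = fun p => s p + w p + e p := by
        ext p
        simp only [he]
        ring
      have h3 : mollify η (fun p => s p + w p + e p) p =
          mollify η s p + mollify η w p + mollify η e p := by
        unfold mollify
        rw [avg_add η.integrable_normed aestronglyMeasurable_const aestronglyMeasurable_neg_id
          (hAs.add hAw) hAe, avg_add η.integrable_normed aestronglyMeasurable_const
          aestronglyMeasurable_neg_id hAs hAw]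
      change box (mollify η u) p = mollify η s p + mollify η w p + mollify η e p
      rw [h1, h2, h3]
    have eq3 : complexify W T₃ = 0 := by
      refine complexify_eq_zero W (s := {p : Spacetime | p.2 ≤ -1 / 4})
        (isClosed_le continuous_snd continuous_const) hv (fun p hp => ?_) T₃ fun p hp => ?_
      · have : p.2 ≤ -1 / 4 := hp
        linarith
      · obtain ⟨ω, h1, h2⟩ := exists_of_mollify_ne_zero hp
        have h3 := hes _ h2
        have h4 : |ω.2| ≤ ‖ω‖ := le_max_right _ _
        have h5 := le_abs_self ω.2
        simp only [Prod.snd_sub] at h3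
        change p.2 ≤ -1 / 4
        linarith
    -- W(Tb) = W(Tm) is the equation and W(T₃) = 0, so W(T₀) is a combination of W on functions that
    -- are small in C^n.
    have eq4 : complexify W T₀ = -complexify W (T₁ - T₀) - complexify W (T₂ - Tq) +
        complexify W (Tm - Tq) := by
      simp only [complexify_sub]
      rw [← eq1, eq2, complexify_add, complexify_add, eq3]
      ring
    have b1 := hbound (T₁ - T₀) ε ((h₁ η hη1).congr fun p => by
      change mollify η s p - T₀ p = _
      rw [hT₀]) fun p hp => by
        change mollify η s p - T₀ p = 0
        rw [hT₀, hmoll η s hη4 hs0 p hp]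
        have : s p = 0 := hs0 p (by linarith)
        simp only [hs] at this
        rw [this, sub_zero]
    have b2 := hbound (T₂ - Tq) ε (h₂ η hη2) fun p hp => by
        change mollify η w p - w p = 0
        rw [hmoll η w hη4 hw0 p hp, hw0 p (by linarith), sub_zero]
    have b3 := hbound (Tm - Tq) (2 ^ n * Q * ε) ((hQ.comp_fst.mul (h₃ η hη3)).congr fun p => by
        change q p.1 * mollify η u p - q p.1 * u p = _
        ring) fun p hp => by
        change q p.1 * mollify η u p - q p.1 * u p = 0
        rw [hmoll η u hη4 hu0 p hp, hu0 p (by linarith), sub_self]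
    rw [eq4]
    calc _ ≤ ‖complexify W (T₁ - T₀)‖ + ‖complexify W (T₂ - Tq)‖ + ‖complexify W (Tm - Tq)‖ := by
          refine (norm_add_le _ _).trans (add_le_add ((norm_sub_le _ _).trans ?_) le_rfl)
          rw [norm_neg]
      _ ≤ C * ε + C * ε + C * (2 ^ n * Q * ε) := by gcongr
      _ = _ := by ring
  have hlim : Tendsto (fun ε : ℝ => C * (ε + ε + 2 ^ n * Q * ε)) (𝓝[>] 0) (𝓝 0) := by
    have : Continuous fun ε : ℝ => C * (ε + ε + 2 ^ n * Q * ε) := by fun_prop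
    have := this.tendsto 0
    simp only [mul_zero, add_zero] at this
    exact tendsto_nhdsWithin_of_tendsto_nhds this
  have : ‖complexify W T₀‖ ≤ 0 := ge_of_tendsto hlim (by
    filter_upwards [self_mem_nhdsWithin] with ε hε
    exact main ε hε)
  exact norm_le_zero_iff.1 this

/-- A distribution solving the homogeneous problem and vanishing in the past is zero. -/
theorem eq_zero_of_homogeneous (hn : 2 ≤ n) {q : 𝓓^{(n : ℕ∞)}(unitBall, ℂ)}
    {W : 𝓓'^{(n : ℕ∞)}((⊤ : Opens Spacetime), ℂ)}
    (hW : ∀ φ : 𝓓((⊤ : Opens Spacetime), ℝ), W (ofSmooth n (dAlembert φ)) = mulPairing q W φ)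
    (hv : Distribution.IsVanishingOn W {p : Spacetime | p.2 < 0})
    (ψ : 𝓓^{(n : ℕ∞)}((⊤ : Opens Spacetime), ℝ)) : W ψ = 0 := by
  have hψ : ContDiff ℝ n fun p => (ψ p : ℂ) := contDiff_ofReal ψ.contDiff
  have hψc : HasCompactSupport fun p => (ψ p : ℂ) :=
    ψ.hasCompactSupport.comp_left (g := fun x : ℝ => (x : ℂ)) Complex.ofReal_zero
  obtain ⟨T, hT⟩ : ∃ T : 𝓓^{(n : ℕ∞)}((⊤ : Opens Spacetime), ℂ), ∀ p, T p = (ψ p : ℂ) :=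
    ⟨mkTest _ hψ hψc, mkTest_apply _ hψ hψc⟩
  obtain ⟨T₀, hT₀⟩ : ∃ T : 𝓓^{(n : ℕ∞)}((⊤ : Opens Spacetime), ℂ),
      ∀ p, T p = initialCutoff p * (ψ p : ℂ) :=
    ⟨mkTest _ (contDiff_initialCutoff.mul hψ) hψc.mul_left,
      mkTest_apply _ (contDiff_initialCutoff.mul hψ) hψc.mul_left⟩
  have hr : complexify W T = W ψ := by
    have h1 : reTest T = ψ := by
      ext p
      rw [reTest_apply, hT, Complex.ofReal_re]
    have h2 : imTest T = 0 := by
      ext p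
      rw [imTest_apply, hT, Complex.ofReal_im]
      rfl
    rw [complexify, h1, h2, map_zero, mul_zero, add_zero]
  have h0 := complexify_initialCutoff_eq_zero hn hW hv hψ hψc T₀ hT₀
  have h1 : complexify W (T - T₀) = 0 := by
    refine complexify_eq_zero W (s := {p : Spacetime | p.2 ≤ -1 / 2})
      (isClosed_le continuous_snd continuous_const) hv (fun p hp => ?_) _ fun p hp => ?_
    · have : p.2 ≤ -1 / 2 := hp
      linarith
    · by_contra h
      refine hp ?_
      change T p - T₀ p = 0
      rw [hT, hT₀, initialCutoff_eq_one (not_le.1 h).le, one_mul, sub_self]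
  rw [complexify_sub, h0, sub_zero] at h1
  exact hr.symm.trans h1

theorem IsPointSourceSolution.unique (hn : 2 ≤ n) {q : 𝓓^{(n : ℕ∞)}(unitBall, ℂ)} {a : Space}
    {U V : 𝓓'^{(n : ℕ∞)}((⊤ : Opens Spacetime), ℂ)} (hU : IsPointSourceSolution q a U)
    (hV : IsPointSourceSolution q a V) : V = U := by
  have key := eq_zero_of_homogeneous (W := V - U) hn (q := q) (fun φ => ?_) fun φ hφ => ?_
  · ext φ
    exact sub_eq_zero.1 (key φ)
  · have h1 := hU.equation φ
    have h2 := hV.equation φ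
    unfold mulPairing at h1 h2 ⊢
    simp only [_root_.sub_apply]
    linear_combination h2 - h1
  · simp [hU.vanishing φ hφ, hV.vanishing φ hφ]

end Uniqueness

/-! ### Uniform constants and the backscattering estimate -/

section Main

variable {n : ℕ}

/-- A damping rate that is admissible for potentials bounded by `3 ^ 7 * M`. -/
def dampingRate (M : ℝ) : ℝ := 2 ^ 7 * (3 ^ 7 * M) * 2 + 1

theorem one_le_dampingRate {M : ℝ} (hM : 0 ≤ M) : 1 ≤ dampingRate M := by
  unfold dampingRate
  linarith

theorem le_dampingRate_sq {M : ℝ} (hM : 0 ≤ M) : 2 ^ 7 * (3 ^ 7 * M) * 2 ≤ dampingRate M ^ 2 := by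
  unfold dampingRate
  nlinarith

theorem contDiff_seven (hn : 7 ≤ n) (q : 𝓓^{(n : ℕ∞)}(unitBall, ℂ)) : ContDiff ℝ 7 q :=
  q.contDiff.of_le (WithTop.coe_le_coe.2 (Nat.cast_le.2 hn : ((7 : ℕ) : ℕ∞) ≤ n))

/-- The regular part must be fixed by q alone, before T and M are given, yet be bounded in terms of
T and M. The damping rate is therefore chosen from an integer N attached to q, and N ≤ ⌈M⌉ leaves
finitely many rates for each M. An infinite norm makes the second claim vacuous. -/
theorem exists_nat_bddC (hn : 7 ≤ n) (q : 𝓓^{(n : ℕ∞)}(unitBall, ℂ)) :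
    ∃ N : ℕ, BddC 7 (3 ^ 7 * N) q ∧ ∀ M : ℝ≥0, potentialNorm q ≤ M → N ≤ ⌈M⌉₊ := by
  have hq := contDiff_seven hn q
  by_cases h : potentialNorm q = ⊤
  · obtain ⟨A, hA⟩ := exists_bddC_of_hasCompactSupport (k := 7) hq q.hasCompactSupport
    refine ⟨⌈A⌉₊, hA.mono le_rfl ?_, fun M hM => ?_⟩
    · have h1 := Nat.le_ceil A
      have h2 : (0 : ℝ) ≤ ⌈A⌉₊ := Nat.cast_nonneg _
      linarith
    · rw [h] at hM
      exact absurd hM (by simp)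
  · lift potentialNorm q to ℝ≥0 using h with m hm
    refine ⟨⌈m⌉₊, (bddC_of_potentialNorm_le hq hm.symm.le).mono le_rfl ?_, fun M hM => ?_⟩
    · have h1 : (m : ℝ) ≤ (⌈m⌉₊ : ℝ) := by exact_mod_cast Nat.le_ceil m
      linarith
    · exact Nat.ceil_mono (by exact_mod_cast hM)

theorem fderiv_regularPartAt (ℓ : ℝ) (q : Space → ℂ) (a : Space) (p : Spacetime) :
    fderiv ℝ (regularPartAt ℓ q a) p = fderiv ℝ (regularPart ℓ fun x => q (a + x)) (p - (a, 0)) :=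
  fderiv_comp_sub (f := regularPart ℓ fun x => q (a + x)) (a, 0)

theorem regularPartAt_bound (T : ℝ) {ℓ M : ℝ} (hℓ : 1 ≤ ℓ) (hM : 2 ^ 7 * M * 2 ≤ ℓ ^ 2) :
    ∃ K : ℝ≥0, ∀ ⦃q q' : Space → ℂ⦄ ⦃D : ℝ⦄, BddC 7 M q → BddC 7 M q' →
      BddC 7 D (fun x => q x - q' x) → ∀ (a : Space) (p : Spacetime), |p.2| ≤ |T| →
      ‖regularPartAt ℓ q a p‖ ≤ K ∧ ‖fderiv ℝ (regularPartAt ℓ q a) p‖ ≤ K ∧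
      ‖regularPartAt ℓ q a p - regularPartAt ℓ q' a p‖ ≤ K * D ∧
      ‖fderiv ℝ (regularPartAt ℓ q a) p - fderiv ℝ (regularPartAt ℓ q' a) p‖ ≤ K * D := by
  obtain ⟨K, hK, h⟩ := regularPart_bound T hℓ hM
  refine ⟨⟨K, hK⟩, fun q q' D h1 h2 h3 a p hp => ?_⟩
  rw [fderiv_regularPartAt, fderiv_regularPartAt]
  exact h (h1.comp_add_left a) (h2.comp_add_left a) (h3.comp_add_left a) (p - (a, 0))
    (by simpa using hp)

theorem exists_c1Norm_regularPartAt_le (T : ℝ) (N : ℕ) :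
    ∃ K : ℝ≥0, ∀ ⦃q : Space → ℂ⦄, BddC 7 (3 ^ 7 * N) q → ∀ a,
      c1Norm T (regularPartAt (dampingRate N) q a) ≤ K := by
  have h1 := one_le_dampingRate (Nat.cast_nonneg (α := ℝ) N)
  have h2 := le_dampingRate_sq (Nat.cast_nonneg (α := ℝ) N)
  obtain ⟨K, h⟩ := regularPartAt_bound T h1 h2
  refine ⟨(multiIndices 4 1).card * K, fun q hq a => ?_⟩
  have hT : ∀ p : Spacetime, p.2 ∈ Icc 0 T → |p.2| ≤ |T| := fun p hp =>
    abs_le_abs_of_nonneg hp.1 hp.2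
  exact c1Norm_le ((contDiff_regularPartAt h1 h2 hq a).differentiable (by simp))
    (fun p hp => (h hq hq (hq.sub hq) a p (hT p hp)).1)
    fun p hp => (h hq hq (hq.sub hq) a p (hT p hp)).2.1

theorem exists_solution :
    ∃ C : ℝ → ℝ≥0 → ℝ≥0, ∀ n : ℕ, 7 ≤ n → ∀ (q : 𝓓^{(n : ℕ∞)}(unitBall, ℂ)) (a : Space),
      ∃ (r : Spacetime → ℂ) (hr : ContDiff ℝ 1 r),
        IsPointSourceSolution q a (coneDistribution n a r hr.continuous) ∧
        ∀ (T : ℝ) (M : ℝ≥0), potentialNorm q ≤ M → c1Norm T r ≤ C T M := by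
  choose K hK using exists_c1Norm_regularPartAt_le
  -- The sum dominates the constants of all integers N that potentials of norm at most M can
  -- produce.
  refine ⟨fun T M => ∑ N ∈ Finset.range (⌈M⌉₊ + 1), K T N, fun n hn q a => ?_⟩
  obtain ⟨N, hN, hNM⟩ := exists_nat_bddC hn q
  have h1 := one_le_dampingRate (Nat.cast_nonneg (α := ℝ) N)
  have h2 := le_dampingRate_sq (Nat.cast_nonneg (α := ℝ) N)
  refine ⟨_, contDiff_regularPartAt h1 h2 hN a, isPointSourceSolution_coneDistribution q h1 h2 hN a,
    fun T M hM => (hK T N hN a).trans ?_⟩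
  exact ENNReal.coe_le_coe.2 (Finset.single_le_sum (f := fun N => K T N) (fun _ _ => zero_le)
    (Finset.mem_range.2 (Nat.lt_succ_of_le (hNM M hM))))

theorem mem_offCone_of_pos {a : Space} {τ : ℝ} (hτ : 0 < τ) : (a, 2 * τ) ∈ offCone a := by
  change 2 * τ ≠ ‖a - a‖
  simp [hτ.ne']

theorem contDiffOn_backscattering {a : Space} {u : Spacetime → ℂ}
    (hu : ContDiffOn ℝ 1 u (offCone a)) : ContDiffOn ℝ 1 (fun τ : ℝ => u (a, 2 * τ)) (Ioo 0 1) :=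
  hu.comp (contDiff_const.prodMk (contDiff_const.mul contDiff_id)).contDiffOn
    fun _ hτ => mem_offCone_of_pos hτ.1

/-- At the source point the solution is given by the regular part. -/
theorem eqFunctionOn_backscattering {a : Space} {r u : Spacetime → ℂ} (hr : ContDiff ℝ 1 r)
    (hu : EqFunctionOn (coneDistribution n a r hr.continuous) u (offCone a)) {τ : ℝ} (hτ : 0 < τ) :
    u (a, 2 * τ) = r (a, 2 * τ) := by
  rw [(eqFunctionOn_coneDistribution (k := 1) hr).eqOn (isOpen_offCone a) hu
    (mem_offCone_of_pos hτ)]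
  simp [heaviside, hτ]

theorem norm_iteratedDeriv_le {f : Spacetime → ℂ} (hf : ContDiff ℝ 1 f) {g : ℝ → ℂ} {a : Space}
    {A : ℝ} (hg : ∀ τ, 0 < τ → g τ = f (a, 2 * τ)) {τ : ℝ} (hτ : 0 < τ)
    (h0 : ‖f (a, 2 * τ)‖ ≤ A) (h1 : ‖fderiv ℝ f (a, 2 * τ)‖ ≤ A) {β : ℕ} (hβ : β ≤ 1) :
    ‖iteratedDeriv β g τ‖ ≤ 2 * A := by
  interval_cases β
  · rw [iteratedDeriv_zero, hg τ hτ]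
    linarith [norm_nonneg (f (a, 2 * τ))]
  · rw [iteratedDeriv_one]
    have hev : g =ᶠ[𝓝 τ] fun s => f (a, 2 * s) := by
      filter_upwards [lt_mem_nhds hτ] with s hs using hg s hs
    have hd : HasDerivAt (fun s : ℝ => ((a, 2 * s) : Spacetime)) (0, 2 * 1) τ :=
      (hasDerivAt_const τ a).prodMk ((hasDerivAt_id τ).const_mul 2)
    have hfd := ((hf.differentiable (by simp) (a, 2 * τ)).hasFDerivAt).comp_hasDerivAt τ hd
    rw [hev.deriv_eq, show deriv (fun s => f (a, 2 * s)) τ = _ from hfd.deriv]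
    have hv : ‖((0, 2 * 1) : Spacetime)‖ = 2 := by
      rw [Prod.norm_def]
      simp
    refine ((fderiv ℝ f (a, 2 * τ)).le_opNorm _).trans ?_
    rw [hv]
    linarith

/-- Uniqueness identifies both given solutions with constructed ones using the same damping rate,
taken from M rather than from each potential. Their regular parts are then comparable. -/
theorem exists_lipschitz_backscattering (M : ℝ≥0) :
    ∃ C : ℝ≥0, ∀ n : ℕ, 7 ≤ n → ∀ q₁ q₂ : 𝓓^{(n : ℕ∞)}(unitBall, ℂ),
      potentialNorm q₁ ≤ M → potentialNorm q₂ ≤ M → ∀ a : Space,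
      ∀ U₁ U₂ : 𝓓'^{(n : ℕ∞)}((⊤ : Opens Spacetime), ℂ),
      IsPointSourceSolution q₁ a U₁ → IsPointSourceSolution q₂ a U₂ →
      ∀ u₁ u₂ : Spacetime → ℂ,
      EqFunctionOn U₁ u₁ (offCone a) → EqFunctionOn U₂ u₂ (offCone a) →
      ∀ τ ∈ Ioo (0 : ℝ) 1, ∀ β : ℕ, β ≤ 1 →
        ‖iteratedDeriv β (fun s : ℝ => u₁ (a, 2 * s) - u₂ (a, 2 * s)) τ‖ₑ
          ≤ C * potentialNorm (⇑(q₁ - q₂)) := by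
  have h1 := one_le_dampingRate M.coe_nonneg
  have h2 := le_dampingRate_sq M.coe_nonneg
  -- The times 2τ with τ < 1 stay below T = 2.
  obtain ⟨K, hK⟩ := regularPartAt_bound 2 h1 h2
  -- The 2 is the chain rule factor of τ ↦ (a, 2τ), and 3⁷ converts partial derivative norms. The
  -- added 1 makes the constant nonzero, so that the bound is ∞ when the norm of the difference is.
  refine ⟨2 * (K * 3 ^ 7) + 1, fun n hn q₁ q₂ hq₁ hq₂ a U₁ U₂ hU₁ hU₂ u₁ u₂ hu₁ hu₂ τ hτ β hβ => ?_⟩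
  by_cases htop : potentialNorm (⇑(q₁ - q₂)) = ⊤
  · rw [htop, ENNReal.mul_top (by simp)]
    exact le_top
  obtain ⟨d, hd⟩ : ∃ d : ℝ≥0, (d : ℝ≥0∞) = potentialNorm (⇑(q₁ - q₂)) :=
    ⟨_, ENNReal.coe_toNNReal htop⟩
  have b₁ := bddC_of_potentialNorm_le (contDiff_seven hn q₁) hq₁
  have b₂ := bddC_of_potentialNorm_le (contDiff_seven hn q₂) hq₂
  have b : BddC 7 (3 ^ 7 * d) fun x => q₁ x - q₂ x :=
    bddC_of_potentialNorm_le (contDiff_seven hn (q₁ - q₂)) hd.symm.le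
  have hn2 : 2 ≤ n := by omega
  have c₁ := contDiff_regularPartAt h1 h2 b₁ a
  have c₂ := contDiff_regularPartAt h1 h2 b₂ a
  rw [(isPointSourceSolution_coneDistribution q₁ h1 h2 b₁ a).unique hn2 hU₁] at hu₁
  rw [(isPointSourceSolution_coneDistribution q₂ h1 h2 b₂ a).unique hn2 hU₂] at hu₂
  have hτ2 : |2 * τ| ≤ |(2 : ℝ)| := by
    rw [abs_mul, abs_of_pos hτ.1]
    exact mul_le_of_le_one_right (abs_nonneg _) hτ.2.le
  obtain ⟨-, -, k0, k1⟩ := hK b₁ b₂ b a (a, 2 * τ) hτ2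
  rw [← fderiv_fun_sub (c₁.differentiable (by simp) _) (c₂.differentiable (by simp) _)] at k1
  have key := norm_iteratedDeriv_le (c₁.sub c₂) (A := K * (3 ^ 7 * d))
    (g := fun s : ℝ => u₁ (a, 2 * s) - u₂ (a, 2 * s)) (fun s hs => by
      rw [eqFunctionOn_backscattering c₁ hu₁ hs, eqFunctionOn_backscattering c₂ hu₂ hs]) hτ.1 k0 k1 hβ
  rw [← hd, ← ENNReal.coe_mul, enorm_le_coe, ← NNReal.coe_le_coe]
  push_cast
  refine key.trans ?_
  have := d.coe_nonneg
  linarith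

end Main

end PointSource

end

theorem theorem1p2 :
    -- existence, uniqueness, expansion, regularity; the bound depends only on `T` and `M`
    (∃ C : ℝ → ℝ≥0 → ℝ≥0,
      ∀ n : ℕ, 7 ≤ n → ∀ q : 𝓓^{(n : ℕ∞)}(PointSource.unitBall, ℂ),
      ∀ a ∈ sphere (0 : PointSource.Space) 1,
      ∃ U : 𝓓'^{(n : ℕ∞)}((⊤ : Opens PointSource.Spacetime), ℂ),
        PointSource.IsPointSourceSolution q a U ∧
        (∀ V : 𝓓'^{(n : ℕ∞)}((⊤ : Opens PointSource.Spacetime), ℂ),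
          PointSource.IsPointSourceSolution q a V → V = U) ∧
        (∃ r : PointSource.Spacetime → ℂ,
          ContDiff ℝ 1 r ∧ PointSource.HasExpansion U a r ∧
          ∀ T : ℝ, 0 < T → ∀ M : ℝ≥0, PointSource.potentialNorm q ≤ M →
            PointSource.c1Norm T r ≤ C T M) ∧
        (∃ u : PointSource.Spacetime → ℂ,
          PointSource.EqFunctionOn U u (PointSource.offCone a) ∧
          ContDiffOn ℝ 1 u (PointSource.offCone a) ∧
          (∀ v : PointSource.Spacetime → ℂ,
            PointSource.EqFunctionOn U v (PointSource.offCone a) →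
              EqOn v u (PointSource.offCone a)) ∧
          ContDiffOn ℝ 1 (fun τ : ℝ => u (a, 2 * τ)) (Ioo 0 1))) ∧
    -- Lipschitz dependence of the backscattering data; the constant depends only on `M`
    (∀ M : ℝ≥0, ∃ C : ℝ≥0,
      ∀ n : ℕ, 7 ≤ n → ∀ q₁ q₂ : 𝓓^{(n : ℕ∞)}(PointSource.unitBall, ℂ),
      PointSource.potentialNorm q₁ ≤ M → PointSource.potentialNorm q₂ ≤ M →
      ∀ a ∈ sphere (0 : PointSource.Space) 1,
      ∀ U₁ U₂ : 𝓓'^{(n : ℕ∞)}((⊤ : Opens PointSource.Spacetime), ℂ),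
      PointSource.IsPointSourceSolution q₁ a U₁ → PointSource.IsPointSourceSolution q₂ a U₂ →
      ∀ u₁ u₂ : PointSource.Spacetime → ℂ,
      PointSource.EqFunctionOn U₁ u₁ (PointSource.offCone a) →
      PointSource.EqFunctionOn U₂ u₂ (PointSource.offCone a) →
      ∀ τ ∈ Ioo (0 : ℝ) 1, ∀ β : ℕ, β ≤ 1 →
        ‖iteratedDeriv β (fun s : ℝ => u₁ (a, 2 * s) - u₂ (a, 2 * s)) τ‖ₑ
          ≤ C * PointSource.potentialNorm (⇑(q₁ - q₂))) := by
  obtain ⟨C, hC⟩ := PointSource.exists_solution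
  refine ⟨⟨C, fun n hn q a _ => ?_⟩, fun M => ?_⟩
  · obtain ⟨r, hr, hsol, hbound⟩ := hC n hn q a
    have hu := PointSource.contDiffOn_heaviside_mul (a := a) (k := 1) hr
    have hU := PointSource.eqFunctionOn_coneDistribution (n := n) (a := a) (k := 1) hr
    exact ⟨_, hsol, fun V hV => hsol.unique (by omega) hV,
      ⟨r, hr, PointSource.hasExpansion_coneDistribution hr.continuous, fun T _ => hbound T⟩,
      ⟨_, hU, hu, fun v hv => hU.eqOn (PointSource.isOpen_offCone a) hv,
        PointSource.contDiffOn_backscattering hu⟩⟩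
  · obtain ⟨C, hC⟩ := PointSource.exists_lipschitz_backscattering M
    exact ⟨C, fun n hn q₁ q₂ h₁ h₂ a _ => hC n hn q₁ q₂ h₁ h₂ a⟩
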